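/- Let $S^3$ be the sphere of unit quaternions with its standard Riemannian metric, $A(x)=xi$ the Hopf vector field, $\alpha=\langle A,\cdot\rangle$ the standard contact form and $\xi=\ker\alpha$. Let $p\colon S^3\to S^2$, $p(x)=x\,i\,\bar x$, be the Hopf map onto the unit sphere of the imaginary quaternions; its fibers are the great circles $\{xe^{i\theta}\}$. Let $\mathrm{Aut}_1(\xi)$ be the group of strict contactomorphisms, i.e. of $C^\infty$ diffeomorphisms $F$ of $S^3$ with $F^*\alpha=\alpha$; let $\mathrm{Aut}_1(\mathcal H)$ be the group of $C^\infty$ diffeomorphisms $F$ of $S^3$ with $F_*A=A$; and let $\mathrm{SDiff}^+(S^2)$ be the group of orientation-preserving, area-preserving $C^\infty$ diffeomorphisms of $S^2$. For a smooth path $\gamma\colon[0,1]\to S^2$, a horizontal lift of $\gamma$ is a smooth $\bar\gamma\colon[0,1]\to S^3$ with $p\circ\bar\gamma=\gamma$ that is everywhere orthogonal to the Hopf fibers. **Theorem.** 1. (Exact sequence.) Every $F\in\mathrm{Aut}_1(\xi)$ permutes the Hopf fibers and induces $P(F)\in\mathrm{SDiff}^+(S^2)$ with $P(F)\circ p=p\circ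 F$. Let $J(e^{i\theta})$ be the rotation $x\mapsto xe^{i\theta}$ of all Hopf fibers by the angle $\theta$. Then $J\colon S^1\to\mathrm{Aut}_1(\xi)$ and $P\colon\mathrm{Aut}_1(\xi)\to\mathrm{SDiff}^+(S^2)$ are homomorphisms which carry smooth (finite-dimensional) families to smooth families, and $$\{1\}\to S^1\xrightarrow{\ J\ }\mathrm{Aut}_1(\xi)\xrightarrow{\ P\ }\mathrm{SDiff}^+(S^2)\to\{1\}$$ is exact: $J$ is injective, the kernel of $P$ is the circle $J(S^1)$ of uniform fiber rotations, and $P$ is onto. 2. (Horizontal transport.) A smooth path $\gamma\colon[0,1]\to S^2$ has a unique horizontal lift starting at any given point $x\in p^{-1}(\gamma(0))$. Sending $x$ to the endpoint of this lift gives a bijection $H_\gamma\colon p^{-1}(\gamma(0))\to p^{-1}(\gamma(1))$, and $H_\gamma(xe^{i\theta})=H_\gamma(x)e^{i\theta}$. 3. (Holonomy.) Let $\sigma\colon[0,1]^2\to S^2$ be smooth with $\sigma(s,0)=\sigma(s,1)=\sigma(0,t)=y$ for all $s,t$, and let $\gamma=\sigma(1,\cdot)$ be the loop that $\sigma$ contracts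 to $y$. Let $a$ be the signed area (with multiplicity) swept out by $\sigma$, measured on the sphere of radius $\tfrac12$ (that is, one quarter of the integral over $[0,1]^2$ of the pullback under $\sigma$ of the area form of the unit sphere oriented by its outward normal). Then $H_\gamma(x)=x\,e^{2ia}$ for all $x\in p^{-1}(y)$: the holonomy angle is twice the enclosed area. 4. Let $F\in\mathrm{Aut}_1(\mathcal H)$ induce $f\in\mathrm{SDiff}^+(S^2)$, i.e. $f\circ p=p\circ F$. Then $F\in\mathrm{Aut}_1(\xi)$ if and only if $F\circ H_\gamma=H_{f\circ\gamma}\circ F$ on $p^{-1}(\gamma(0))$ for all smooth $\gamma\colon[0,1]\to S^2$. 5. (The lift.) Let $f\in\mathrm{SDiff}^+(S^2)$, let $y_0\in S^2$, and let $F_0\colon p^{-1}(y_0)\to p^{-1}(f(y_0))$ be a rigid orientation-preserving map, i.e. $F_0(xe^{i\theta})=F_0(x)e^{i\theta}$. Then there is a unique diffeomorphism $F\in\mathrm{Aut}_1(\xi)$ with $P(F)=f$ such that $$F=H_{f\circ\gamma}\circ F_0\circ H_\gamma^{-1}\quad\text{on } p^{-1}(\gamma(1))$$ for every smooth path $\gamma\colon[0,1]\to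 S^2$ with $\gamma(0)=y_0$; in particular the right-hand side depends only on the endpoint of $\gamma$, and $F$ is smooth. -/

import Mathlib

open scoped Manifold ContDiff Quaternion RealInnerProductSpace

namespace HopfContact

noncomputable section

/-! ### The two spheres and their diffeomorphism groups -/

instance instFactFinrankQuaternion : Fact (Module.finrank ℝ ℍ[ℝ] = 3 + 1) :=
  ⟨Quaternion.finrank_eq_four⟩

instance instFactFinrankEuclideanThree :
    Fact (Module.finrank ℝ (EuclideanSpace ℝ (Fin 3)) = 2 + 1) :=
  ⟨by simp⟩

/-- The three-sphere of unit quaternions. -/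
abbrev S3 : Type := Metric.sphere (0 : ℍ[ℝ]) 1

/-- The two-sphere, modelled as the unit sphere of Euclidean three-space. -/
abbrev S2 : Type := Metric.sphere (0 : EuclideanSpace ℝ (Fin 3)) 1

/-- The group of smooth diffeomorphisms of a manifold, with composition as multiplication. -/
instance instGroupDiffeomorph {E H M : Type*} [NormedAddCommGroup E] [NormedSpace ℝ E]
    [TopologicalSpace H] {I : ModelWithCorners ℝ E H} [TopologicalSpace M] [ChartedSpace H M] :
    Group (M ≃ₘ⟮I, I⟯ M) where
  mul F G := G.trans F
  one := Diffeomorph.refl I M ∞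
  inv F := F.symm
  mul_assoc _ _ _ := rfl
  one_mul _ := rfl
  mul_one _ := rfl
  inv_mul_cancel F := Diffeomorph.self_trans_symm F

abbrev DiffS3 : Type := S3 ≃ₘ⟮𝓡 3, 𝓡 3⟯ S3

abbrev DiffS2 : Type := S2 ≃ₘ⟮𝓡 2, 𝓡 2⟯ S2

/-- The tangent vector `v` to `S3` at `x`, seen as a quaternion. -/
def ambient3 (x : S3) (v : TangentSpace (𝓡 3) x) : ℍ[ℝ] :=
  mvfderiv (𝓡 3) ((↑) : S3 → ℍ[ℝ]) x v

/-- The tangent vector `v` to `S2` at `y`, seen as a vector of Euclidean three-space. -/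
def ambient2 (y : S2) (v : TangentSpace (𝓡 2) y) : EuclideanSpace ℝ (Fin 3) :=
  mvfderiv (𝓡 2) ((↑) : S2 → EuclideanSpace ℝ (Fin 3)) y v

/-! ### The Hopf fibration and the contact form -/

/-- The imaginary unit `i`. -/
def quatI : ℍ[ℝ] := ⟨0, 1, 0, 0⟩

theorem re_quatI : quatI.re = 0 := rfl

theorem imI_quatI : quatI.imI = 1 := rfl

theorem imJ_quatI : quatI.imJ = 0 := rfl

theorem imK_quatI : quatI.imK = 0 := rfl

theorem inner_mul_quatI (q : ℍ[ℝ]) : ⟪q, q * quatI⟫ = 0 := by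
  simp only [Quaternion.inner_def, Quaternion.re_mul, Quaternion.imI_mul,
    Quaternion.imJ_mul, Quaternion.imK_mul, Quaternion.re_star, Quaternion.imI_star,
    Quaternion.imJ_star, Quaternion.imK_star, re_quatI, imI_quatI, imJ_quatI, imK_quatI]
  ring

theorem exists_ambient3_eq (x : S3) :
    ∃ v : TangentSpace (𝓡 3) x, ambient3 x v = (x : ℍ[ℝ]) * quatI := by
  have h : (x : ℍ[ℝ]) * quatI ∈ (mvfderiv (𝓡 3) ((↑) : S3 → ℍ[ℝ]) x).range := by
    rw [range_mvfderiv_subtypeVal, Submodule.mem_orthogonal_singleton_iff_inner_right]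
    exact inner_mul_quatI _
  exact h

/-- The Hopf vector field `A(x) = x i` on `S3`. -/
def hopfField (x : S3) : TangentSpace (𝓡 3) x := (exists_ambient3_eq x).choose

theorem ambient3_hopfField (x : S3) : ambient3 x (hopfField x) = (x : ℍ[ℝ]) * quatI :=
  (exists_ambient3_eq x).choose_spec

/-- The standard contact form: the inner product with the Hopf vector field. -/
def contactForm (x : S3) (v : TangentSpace (𝓡 3) x) : ℝ :=
  ⟪ambient3 x (hopfField x), ambient3 x v⟫

/-- The vector of the `i`, `j`, `k` coordinates of `q i q̄`. -/
def hopfVec (q : ℍ[ℝ]) : EuclideanSpace ℝ (Fin 3) :=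
  !₂[(q * quatI * star q).imI, (q * quatI * star q).imJ, (q * quatI * star q).imK]

theorem hopfVec_mem (x : S3) :
    hopfVec x ∈ Metric.sphere (0 : EuclideanSpace ℝ (Fin 3)) 1 := by
  have hx : ‖(x : ℍ[ℝ])‖ = 1 := by simp
  have h1 : Quaternion.normSq (x : ℍ[ℝ]) = 1 := by
    rw [Quaternion.normSq_eq_norm_mul_self, hx, one_mul]
  rw [Quaternion.normSq_def'] at h1
  rw [mem_sphere_zero_iff_norm, EuclideanSpace.norm_eq, Real.sqrt_eq_one]
  simp only [hopfVec, re_quatI, imI_quatI, imJ_quatI, imK_quatI, Quaternion.re_mul, Quaternion.imI_mul, Quaternion.imJ_mul,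
    Quaternion.imK_mul, Quaternion.re_star, Quaternion.imI_star, Quaternion.imJ_star,
    Quaternion.imK_star, Fin.sum_univ_three, Real.norm_eq_abs, sq_abs, Matrix.cons_val]
  generalize (x : ℍ[ℝ]) = q at *
  obtain ⟨a, b, c, d⟩ := q
  simp only at h1 ⊢
  have h2 : (a ^ 2 + b ^ 2 + c ^ 2 + d ^ 2) ^ 2 = 1 := by rw [h1]; norm_num
  linear_combination h2

/-- The Hopf map `x ↦ x i x̄` from `S3` to `S2`. -/
def hopf (x : S3) : S2 := ⟨hopfVec x, hopfVec_mem x⟩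

/-- The Hopf fiber over a point of `S2`. -/
def hopfFiber (y : S2) : Set S3 := {x | hopf x = y}

/-- The rotation of all Hopf fibers within themselves by the unit complex number `z = e^{iθ}`:
the point `x` goes to `x e^{iθ}`. -/
def rot (z : Circle) (x : S3) : S3 :=
  ⟨(x : ℍ[ℝ]) * ((z : ℂ) : ℍ[ℝ]), by
    have hz : ‖((z : ℂ) : ℍ[ℝ])‖ = 1 := by
      have h : ‖((z : ℂ) : ℍ[ℝ])‖ * ‖((z : ℂ) : ℍ[ℝ])‖ = 1 := by
        rw [← Quaternion.normSq_eq_norm_mul_self, Quaternion.normSq_def']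
        have := Circle.normSq_coe z
        rw [Complex.normSq_apply] at this
        simp
        linarith
      nlinarith [norm_nonneg ((z : ℂ) : ℍ[ℝ])]
    simp [hz]⟩

theorem coe_rot (z : Circle) (x : S3) :
    (rot z x : ℍ[ℝ]) = (x : ℍ[ℝ]) * ((z : ℂ) : ℍ[ℝ]) := rfl

theorem rot_one (x : S3) : rot 1 x = x := by
  apply Subtype.ext
  simp [coe_rot]

theorem rot_rot (z w : Circle) (x : S3) : rot z (rot w x) = rot (z * w) x := by
  apply Subtype.ext
  rw [coe_rot, coe_rot, coe_rot, mul_assoc, ← Quaternion.coeComplex_mul, Circle.coe_mul,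
    mul_comm (z : ℂ)]

theorem contMDiff_rot (z : Circle) : ContMDiff (𝓡 3) (𝓡 3) ∞ (rot z) := by
  have h : ContMDiff (𝓡 3) 𝓘(ℝ, ℍ[ℝ]) ∞
      (fun x : S3 => (x : ℍ[ℝ]) * ((z : ℂ) : ℍ[ℝ])) := by
    have h0 : ContDiff ℝ ∞ (fun q : ℍ[ℝ] => q * ((z : ℂ) : ℍ[ℝ])) := by fun_prop
    exact h0.contMDiff.comp contMDiff_coe_sphere
  exact h.codRestrict_sphere (fun x => (rot z x).2)

/-- The rotation of all Hopf fibers by `z`, as a diffeomorphism of `S3`. -/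
def rotDiff (z : Circle) : DiffS3 where
  toFun := rot z
  invFun := rot z⁻¹
  left_inv x := by rw [rot_rot, inv_mul_cancel, rot_one]
  right_inv x := by rw [rot_rot, mul_inv_cancel, rot_one]
  contMDiff_toFun := contMDiff_rot z
  contMDiff_invFun := contMDiff_rot z⁻¹

/-! ### The groups -/

/-- The group of strict contactomorphisms of `S3`: diffeomorphisms `F` with `F^* α = α`. -/
def strictContact : Subgroup DiffS3 where
  carrier := {F | ∀ (x : S3) (v : TangentSpace (𝓡 3) x),
    contactForm (F x) (mfderiv (𝓡 3) (𝓡 3) F x v) = contactForm x v}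
  mul_mem' := by
    intro F G hF hG x v
    have h : mfderiv (𝓡 3) (𝓡 3) (F * G : DiffS3) x v
        = mfderiv (𝓡 3) (𝓡 3) F (G x) (mfderiv (𝓡 3) (𝓡 3) G x v) :=
      mfderiv_comp_apply x (F.mdifferentiable (by simp) _) (G.mdifferentiable (by simp) _) v
    rw [h]
    exact (hF (G x) _).trans (hG x v)
  one_mem' := by
    intro x v
    have h : mfderiv (𝓡 3) (𝓡 3) (1 : DiffS3) x v = v := by
      change mfderiv (𝓡 3) (𝓡 3) (id : S3 → S3) x v = v
      rw [mfderiv_id]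
      rfl
    rw [h]
    rfl
  inv_mem' := by
    intro F hF x v
    have h : mfderiv (𝓡 3) (𝓡 3) F (F.symm x) (mfderiv (𝓡 3) (𝓡 3) F.symm x v) = v := by
      have h1 := mfderiv_comp_apply (I := 𝓡 3) (I' := 𝓡 3) (I'' := 𝓡 3) (g := F) x
        (F.mdifferentiable (by simp) _) (F.symm.mdifferentiable (by simp) _) v
      have h2 : (F ∘ F.symm : S3 → S3) = id := funext F.apply_symm_apply
      rw [← h1, h2, mfderiv_id]
      rfl
    have h3 := hF (F.symm x) (mfderiv (𝓡 3) (𝓡 3) F.symm x v)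
    rw [h] at h3
    refine h3.symm.trans ?_
    exact congrArg (fun y : S3 => contactForm y (show EuclideanSpace ℝ (Fin 3) from v))
      (F.apply_symm_apply x)

/-- The strict automorphisms of the Hopf fibration: diffeomorphisms `F` of `S3` with
`F_* A = A`. -/
def strictHopfAut : Set DiffS3 :=
  {F | ∀ x : S3, mfderiv (𝓡 3) (𝓡 3) F x (hopfField x) = hopfField (F x)}

/-- The determinant of three vectors of Euclidean three-space. -/
def det3 (a b c : EuclideanSpace ℝ (Fin 3)) : ℝ :=
  (Matrix.of ![a.ofLp, b.ofLp, c.ofLp]).det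

/-- The area form of the unit sphere `S2`, for the orientation by the outward normal. -/
def areaForm (y : S2) (v w : TangentSpace (𝓡 2) y) : ℝ :=
  det3 y (ambient2 y v) (ambient2 y w)

/-- The group `SDiff⁺(S2)` of orientation-preserving, area-preserving diffeomorphisms of `S2`:
diffeomorphisms `f` with `f^* ω = ω` for the area form `ω`. -/
def areaPreserving : Subgroup DiffS2 where
  carrier := {f | ∀ (y : S2) (v w : TangentSpace (𝓡 2) y),
    areaForm (f y) (mfderiv (𝓡 2) (𝓡 2) f y v) (mfderiv (𝓡 2) (𝓡 2) f y w) = areaForm y v w}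
  mul_mem' := by
    intro f g hf hg y v w
    have h : ∀ v, mfderiv (𝓡 2) (𝓡 2) (f * g : DiffS2) y v
        = mfderiv (𝓡 2) (𝓡 2) f (g y) (mfderiv (𝓡 2) (𝓡 2) g y v) := fun v =>
      mfderiv_comp_apply y (f.mdifferentiable (by simp) _) (g.mdifferentiable (by simp) _) v
    rw [h, h]
    exact (hf (g y) _ _).trans (hg y v w)
  one_mem' := by
    intro y v w
    have h : ∀ v, mfderiv (𝓡 2) (𝓡 2) (1 : DiffS2) y v = v := by
      intro v
      change mfderiv (𝓡 2) (𝓡 2) (id : S2 → S2) y v = v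
      rw [mfderiv_id]
      rfl
    rw [h, h]
    rfl
  inv_mem' := by
    intro f hf y v w
    have h : ∀ v, mfderiv (𝓡 2) (𝓡 2) f (f.symm y) (mfderiv (𝓡 2) (𝓡 2) f.symm y v) = v := by
      intro v
      have h1 := mfderiv_comp_apply (I := 𝓡 2) (I' := 𝓡 2) (I'' := 𝓡 2) (g := f) y
        (f.mdifferentiable (by simp) _) (f.symm.mdifferentiable (by simp) _) v
      have h2 : (f ∘ f.symm : S2 → S2) = id := funext f.apply_symm_apply
      rw [← h1, h2, mfderiv_id]
      rfl
    have h3 := hf (f.symm y) (mfderiv (𝓡 2) (𝓡 2) f.symm y v) (mfderiv (𝓡 2) (𝓡 2) f.symm y w)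
    rw [h, h] at h3
    refine h3.symm.trans ?_
    exact congrArg (fun u : S2 => areaForm u (show EuclideanSpace ℝ (Fin 2) from v)
      (show EuclideanSpace ℝ (Fin 2) from w)) (f.apply_symm_apply y)

theorem ambient3_mfderiv_rot (z : Circle) (x : S3) (v : TangentSpace (𝓡 3) x) :
    ambient3 (rot z x) (mfderiv (𝓡 3) (𝓡 3) (rot z) x v)
      = ambient3 x v * ((z : ℂ) : ℍ[ℝ]) := by
  have hc : ∀ y : S3, MDifferentiableAt (𝓡 3) 𝓘(ℝ, ℍ[ℝ]) ((↑) : S3 → ℍ[ℝ]) y := fun y =>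
    (contMDiff_coe_sphere (m := 1) y).mdifferentiableAt one_ne_zero
  have hr : MDifferentiableAt (𝓡 3) (𝓡 3) (rot z) x :=
    (contMDiff_rot z x).mdifferentiableAt (by simp)
  have h1 := mfderiv_comp_apply (I := 𝓡 3) (I' := 𝓡 3) (I'' := 𝓘(ℝ, ℍ[ℝ])) (f := rot z)
    (g := ((↑) : S3 → ℍ[ℝ])) x (hc (rot z x)) hr v
  have h2 : HasFDerivAt (fun q : ℍ[ℝ] => q * ((z : ℂ) : ℍ[ℝ]))
      ((ContinuousLinearMap.mul ℝ ℍ[ℝ]).flip ((z : ℂ) : ℍ[ℝ])) (x : ℍ[ℝ]) :=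
    ((ContinuousLinearMap.mul ℝ ℍ[ℝ]).flip ((z : ℂ) : ℍ[ℝ])).hasFDerivAt
  have h3 := mfderiv_comp_apply (I := 𝓡 3) (I' := 𝓘(ℝ, ℍ[ℝ])) (I'' := 𝓘(ℝ, ℍ[ℝ])) x
    h2.differentiableAt.mdifferentiableAt (hc x) v
  rw [mfderiv_eq_fderiv, h2.fderiv] at h3
  exact h1.symm.trans h3

theorem inner_mul_right_circle (z : Circle) (p q : ℍ[ℝ]) :
    ⟪p * ((z : ℂ) : ℍ[ℝ]), q * ((z : ℂ) : ℍ[ℝ])⟫ = ⟪p, q⟫ := by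
  have hz := Circle.normSq_coe z
  rw [Complex.normSq_apply] at hz
  simp only [Quaternion.inner_def, Quaternion.re_mul, Quaternion.imI_mul,
    Quaternion.imJ_mul, Quaternion.imK_mul, star_mul, Quaternion.re_star, Quaternion.imI_star,
    Quaternion.imJ_star, Quaternion.imK_star, Quaternion.re_coeComplex, Quaternion.imI_coeComplex,
    Quaternion.imJ_coeComplex, Quaternion.imK_coeComplex]
  linear_combination (p.re * q.re + p.imI * q.imI + p.imJ * q.imJ + p.imK * q.imK) * hz

theorem rotDiff_mem (z : Circle) : rotDiff z ∈ strictContact := by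
  intro x v
  have hcomm : ((z : ℂ) : ℍ[ℝ]) * quatI = quatI * ((z : ℂ) : ℍ[ℝ]) := by
    ext <;> simp [re_quatI, imI_quatI, imJ_quatI, imK_quatI]
  change ⟪ambient3 (rot z x) (hopfField (rot z x)),
    ambient3 (rot z x) (mfderiv (𝓡 3) (𝓡 3) (rot z) x v)⟫ = ⟪ambient3 x (hopfField x), _⟫
  rw [ambient3_mfderiv_rot, ambient3_hopfField, ambient3_hopfField, coe_rot, mul_assoc, hcomm,
    ← mul_assoc, inner_mul_right_circle]

/-- The map `J` from the circle to the group of strict contactomorphisms: `J(e^{iθ})` rotates all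
Hopf fibers within themselves by the angle `θ`. -/
def fiberRotation : Circle →* strictContact where
  toFun z := ⟨rotDiff z, rotDiff_mem z⟩
  map_one' := Subtype.ext (Diffeomorph.ext rot_one)
  map_mul' z w := Subtype.ext (Diffeomorph.ext fun x => (rot_rot z w x).symm)

/-! ### Horizontal transport -/

/-- `γ` is a smooth path on `[0, 1]` in `S2`; its values outside `[0, 1]` are irrelevant. -/
def IsSmoothPath (γ : ℝ → S2) : Prop :=
  ContMDiffOn 𝓘(ℝ, ℝ) (𝓡 2) ∞ γ (Set.Icc 0 1)

/-- On `[0, 1]`, the smooth curve `c` in `S3` covers `γ` and is orthogonal to the Hopf fibers. -/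
def IsHorizontalLift (γ : ℝ → S2) (c : ℝ → S3) : Prop :=
  ContMDiffOn 𝓘(ℝ, ℝ) (𝓡 3) ∞ c (Set.Icc 0 1) ∧
  (∀ t ∈ Set.Icc (0 : ℝ) 1, hopf (c t) = γ t) ∧
  ∀ t ∈ Set.Icc (0 : ℝ) 1,
    ⟪(c t : ℍ[ℝ]) * quatI, derivWithin (fun s => (c s : ℍ[ℝ])) (Set.Icc 0 1) t⟫ = 0

open Classical in
/-- The horizontal transport `H_γ` along `γ`: the point `x` of the fiber over `γ 0` goes to the
endpoint of the horizontal lift of `γ` that starts at `x`. -/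
def transport (γ : ℝ → S2) (x : S3) : S3 :=
  if h : ∃ c, IsHorizontalLift γ c ∧ c 0 = x then h.choose 1 else x

/-- A contraction of the loop `σ(1, ·)` to its base point `y`: a smooth map `σ` of the unit square
to `S2` which takes the other three sides of the square to `y`. -/
def IsContraction (y : S2) (σ : ℝ × ℝ → S2) : Prop :=
  ContMDiffOn 𝓘(ℝ, ℝ × ℝ) (𝓡 2) ∞ σ (Set.Icc 0 1 ×ˢ Set.Icc 0 1) ∧
  (∀ s ∈ Set.Icc (0 : ℝ) 1, σ (s, 0) = y ∧ σ (s, 1) = y) ∧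
  ∀ t ∈ Set.Icc (0 : ℝ) 1, σ (0, t) = y

/-- The signed area (with multiplicity) of the map `σ` of the unit square, measured on the sphere
of radius `1/2`, whose area form is one quarter of that of the unit sphere. -/
def sweptArea (σ : ℝ × ℝ → S2) : ℝ :=
  ∫ s in (0 : ℝ)..1, ∫ t in (0 : ℝ)..1,
    (1 / 4) * det3 (σ (s, t))
      (derivWithin (fun s' => (σ (s', t) : EuclideanSpace ℝ (Fin 3))) (Set.Icc 0 1) s)
      (derivWithin (fun t' => (σ (s, t') : EuclideanSpace ℝ (Fin 3))) (Set.Icc 0 1) t)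

end

end HopfContact

open HopfContact

/-! The argument rests on one identity and one formula. The identity is dα = -½ p^*ω, with ω the
area form of the unit sphere (`det3_dHopf`, `fderiv_pullContact_sub_eq_det3`). The gauge formula
(`ambientContact_gauge`) says that rotating a lift along the fibers by an angle θ adds dθ to its
pullback of α.

A strict contactomorphism preserves α, hence dα, hence the Reeb field A, which is determined by α(A)
= 1 and ι_A dα = 0 (`dAmb3_reeb`). It therefore commutes with the flow of A and descends to S²;
since it preserves dα, the identity shows that the induced map preserves ω.

By the gauge formula, two lifts of the same map with equal pullbacks of α differ by a constant phase
(`hasFDerivWithinAt_fiberQuot`). This gives uniqueness of horizontal lifts, the kernel of P and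
uniqueness of the lift of f. Conversely, a phase can be chosen to correct the pullback. Along a
curve, integrating the vertical speed makes any lift horizontal. Over a disc, with τ a section of p
and K a lift of f, the form τ^*α - K^*α is closed because f preserves ω, so it has a primitive, and
rotating K by that primitive gives a contact lift of f. The complements of two antipodal points
cover S²; over the connected overlap the two contact lifts differ by a constant phase, so after one
rotation they glue (`exists_contact_lift`).

Holonomy is Green's formula for dα = -½ p^*ω on strips of the square that a single local section can
lift, followed by a connectedness argument in the deformation parameter. That equivariance under
transport forces F^*α = α is tested on horizontal great circles.

Calculus on the spheres is carried out in the ambient vector spaces, by extending maps so as to be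
constant on rays. -/

namespace HopfContact

noncomputable section

/-! ### Quaternionic algebra of the Hopf map and the contact form -/

/-- The value at `v` of the contact form at `q`, on the ambient space of quaternions. -/
def ambientContact (q v : ℍ[ℝ]) : ℝ := ⟪q * quatI, v⟫

theorem contactForm_eq (x : S3) (v : TangentSpace (𝓡 3) x) :
    contactForm x v = ambientContact x (ambient3 x v) := by
  rw [contactForm, ambient3_hopfField]; rfl

/-- The polarization of the quadratic map `hopfVec`: its derivative at `q` in the direction `v`. -/
def dHopf (q v : ℍ[ℝ]) : EuclideanSpace ℝ (Fin 3) :=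
  !₂[(q * quatI * star v + v * quatI * star q).imI,
    (q * quatI * star v + v * quatI * star q).imJ,
    (q * quatI * star v + v * quatI * star q).imK]

/-- Three-space as the space of imaginary quaternions. -/
def imQuat (w : EuclideanSpace ℝ (Fin 3)) : ℍ[ℝ] := ⟨0, w 0, w 1, w 2⟩

theorem norm_eq_one_iff_normSq (q : ℍ[ℝ]) :
    ‖q‖ = 1 ↔ q.re ^ 2 + q.imI ^ 2 + q.imJ ^ 2 + q.imK ^ 2 = 1 := by
  rw [← Quaternion.normSq_def', Quaternion.normSq_eq_norm_mul_self]
  constructor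
  · intro h; rw [h, one_mul]
  · intro h; nlinarith [norm_nonneg q]

theorem inner_eq (p q : ℍ[ℝ]) :
    ⟪p, q⟫ = p.re * q.re + p.imI * q.imI + p.imJ * q.imJ + p.imK * q.imK := by
  simp only [Quaternion.inner_def, Quaternion.re_mul, Quaternion.re_star, Quaternion.imI_star,
    Quaternion.imJ_star, Quaternion.imK_star]
  ring

theorem ambientContact_eq (q v : ℍ[ℝ]) :
    ambientContact q v = -q.imI * v.re + q.re * v.imI + q.imK * v.imJ - q.imJ * v.imK := by
  simp only [ambientContact, inner_eq, Quaternion.re_mul, Quaternion.imI_mul,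
    Quaternion.imJ_mul, Quaternion.imK_mul, re_quatI, imI_quatI, imJ_quatI, imK_quatI]
  ring

theorem hopfVec_apply (q : ℍ[ℝ]) :
    hopfVec q = !₂[q.re ^ 2 + q.imI ^ 2 - q.imJ ^ 2 - q.imK ^ 2,
      2 * (q.imI * q.imJ + q.re * q.imK), 2 * (q.imI * q.imK - q.re * q.imJ)] := by
  ext i
  fin_cases i <;>
  simp [hopfVec, re_quatI, imI_quatI, imJ_quatI, imK_quatI, Quaternion.imI_mul,
    Quaternion.imJ_mul, Quaternion.imK_mul] <;> ring

theorem dHopf_apply (q v : ℍ[ℝ]) :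
    dHopf q v = !₂[2 * (q.re * v.re + q.imI * v.imI - q.imJ * v.imJ - q.imK * v.imK),
      2 * (q.imI * v.imJ + q.imJ * v.imI + q.re * v.imK + q.imK * v.re),
      2 * (q.imI * v.imK + q.imK * v.imI - q.re * v.imJ - q.imJ * v.re)] := by
  ext i
  fin_cases i <;>
  simp [dHopf, re_quatI, imI_quatI, imJ_quatI, imK_quatI, Quaternion.imI_mul,
    Quaternion.imJ_mul, Quaternion.imK_mul] <;> ring

theorem imQuat_hopfVec (q : ℍ[ℝ]) : imQuat (hopfVec q) = q * quatI * star q := by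
  rw [hopfVec_apply]
  ext <;>
  simp [imQuat, re_quatI, imI_quatI, imJ_quatI, imK_quatI, Quaternion.imI_mul,
    Quaternion.imJ_mul, Quaternion.imK_mul] <;> ring

theorem det3_apply (a b c : EuclideanSpace ℝ (Fin 3)) :
    det3 a b c = a 0 * (b 1 * c 2 - b 2 * c 1) - a 1 * (b 0 * c 2 - b 2 * c 0)
      + a 2 * (b 0 * c 1 - b 1 * c 0) := by
  simp [det3, Matrix.det_fin_three]; ring

/-- Left translation by q turns tangent vectors at q into imaginary quaternions, and in these
coordinates the pullback of the area form is a polynomial identity. Keeping the factor |q|⁶ makes it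
valid for all q, so no norm condition is needed. -/
theorem det3_dHopf_mul (q m n : ℍ[ℝ]) (hm : m.re = 0) (hn : n.re = 0) :
    det3 (hopfVec q) (dHopf q (q * m)) (dHopf q (q * n)) =
      4 * (q.re ^ 2 + q.imI ^ 2 + q.imJ ^ 2 + q.imK ^ 2) ^ 3
        * (m.imJ * n.imK - m.imK * n.imJ) := by
  rw [det3_apply, hopfVec_apply, dHopf_apply, dHopf_apply]
  simp only [Matrix.cons_val, Quaternion.re_mul, Quaternion.imI_mul, Quaternion.imJ_mul,
    Quaternion.imK_mul, hm, hn]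
  ring

/-- The exterior derivative of the contact form is `-1/2` times the pullback of the area form. -/
theorem det3_dHopf (q u v : ℍ[ℝ]) (hq : ‖q‖ = 1) (hu : ⟪q, u⟫ = 0) (hv : ⟪q, v⟫ = 0) :
    det3 (hopfVec q) (dHopf q u) (dHopf q v) = -4 * ⟪u * quatI, v⟫ := by
  have h1 : q * star q = 1 := by
    rw [Quaternion.self_mul_star, Quaternion.normSq_eq_norm_mul_self, hq]; simp
  have h2 : ∀ w, q * (star q * w) = w := fun w => by rw [← mul_assoc, h1, one_mul]
  have hre : ∀ w, ⟪q, w⟫ = 0 → (star q * w).re = 0 := by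
    intro w hw
    rw [inner_eq] at hw
    simp
    linarith
  have key := det3_dHopf_mul q (star q * u) (star q * v) (hre u hu) (hre v hv)
  rw [(norm_eq_one_iff_normSq q).1 hq, h2, h2] at key
  have h3 : ⟪u * quatI, v⟫ = ⟪(q * (star q * u)) * quatI, q * (star q * v)⟫ := by rw [h2, h2]
  have h4 : ∀ m n : ℍ[ℝ], m.re = 0 → n.re = 0 → ⟪q * m * quatI, q * n⟫ =
      (q.re ^ 2 + q.imI ^ 2 + q.imJ ^ 2 + q.imK ^ 2) * (m.imK * n.imJ - m.imJ * n.imK) := by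
    intro m n hm hn
    simp only [inner_eq, Quaternion.re_mul, Quaternion.imI_mul,
      Quaternion.imJ_mul, Quaternion.imK_mul, re_quatI, imI_quatI, imJ_quatI, imK_quatI, hm, hn]
    ring
  rw [key, h3, h4 _ _ (hre u hu) (hre v hv), (norm_eq_one_iff_normSq q).1 hq]
  ring

/-- The complex number `q̄ r`, for quaternions `q`, `r` in the same Hopf fiber. -/
def fiberQuot (q r : ℍ[ℝ]) : ℂ := ⟨(star q * r).re, (star q * r).imI⟩

/-- From q i q̄ = r i r̄ it follows that q̄ r commutes with i, so it is a complex number and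
`fiberQuot` loses nothing. -/
theorem mul_fiberQuot {q r : ℍ[ℝ]} (hq : ‖q‖ = 1) (hr : ‖r‖ = 1) (h : hopfVec q = hopfVec r) :
    q * (fiberQuot q r : ℍ[ℝ]) = r := by
  have h1 : q * star q = 1 := by
    rw [Quaternion.self_mul_star, Quaternion.normSq_eq_norm_mul_self, hq]; simp
  have h1' : star q * q = 1 := by
    rw [Quaternion.star_mul_self, Quaternion.normSq_eq_norm_mul_self, hq]; simp
  have h2' : star r * r = 1 := by
    rw [Quaternion.star_mul_self, Quaternion.normSq_eq_norm_mul_self, hr]; simp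
  have h3 : q * quatI * star q = r * quatI * star r := by
    rw [← imQuat_hopfVec, h, imQuat_hopfVec]
  have h4 : quatI * (star q * r) = star q * r * quatI := by
    calc quatI * (star q * r) = star q * q * quatI * star q * r := by rw [h1']; noncomm_ring
      _ = star q * (q * quatI * star q) * r := by noncomm_ring
      _ = star q * r * quatI * (star r * r) := by rw [h3]; noncomm_ring
      _ = _ := by rw [h2', mul_one]
  have h5 : ((fiberQuot q r : ℂ) : ℍ[ℝ]) = star q * r := by
    have hJ := congrArg QuaternionAlgebra.imJ h4
    have hK := congrArg QuaternionAlgebra.imK h4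
    rw [fiberQuot]
    generalize star q * r = c at *
    simp [re_quatI, imI_quatI, imJ_quatI, imK_quatI, Quaternion.imJ_mul, Quaternion.imK_mul]
      at hJ hK
    ext <;> simp <;> linarith
  rw [h5, ← mul_assoc, h1, one_mul]

theorem norm_coeComplex (z : ℂ) : ‖(z : ℍ[ℝ])‖ = ‖z‖ := by
  rw [← sq_eq_sq₀ (norm_nonneg _) (norm_nonneg _), sq, ← Quaternion.normSq_eq_norm_mul_self,
    Quaternion.normSq_def', ← Complex.normSq_eq_norm_sq, Complex.normSq_apply]
  simp; ring

/-- The vector v z + a w is the velocity of a product of a curve through a and a phase through z. On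
the complex line the contact form measures angular velocity, so for unit a and z a phase adds
exactly its own angular speed. -/
theorem ambientContact_gauge (a v : ℍ[ℝ]) (z w : ℂ) :
    ambientContact (a * z) (v * z + a * w) =
      ‖z‖ ^ 2 * ambientContact a v + ‖a‖ ^ 2 * ambientContact z w := by
  rw [sq ‖a‖, ← Quaternion.normSq_eq_norm_mul_self, Quaternion.normSq_def',
    ← Complex.normSq_eq_norm_sq, Complex.normSq_apply]
  simp [ambientContact_eq]
  ring

theorem inner_gauge (a v : ℍ[ℝ]) (z w : ℂ) :
    ⟪a * (z : ℍ[ℝ]), v * z + a * w⟫ = ‖z‖ ^ 2 * ⟪a, v⟫ + ‖a‖ ^ 2 * ⟪z, w⟫ := by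
  rw [sq ‖a‖, ← Quaternion.normSq_eq_norm_mul_self, Quaternion.normSq_def',
    ← Complex.normSq_eq_norm_sq, Complex.normSq_apply, Complex.inner]
  simp [inner_eq]
  ring

/-- Two curves in the same Hopf fibers with the same vertical velocity differ by a phase
of zero velocity. -/
theorem phase_velocity_eq_zero {a v v' : ℍ[ℝ]} {z w : ℂ} (ha : ‖a‖ = 1) (hz : ‖z‖ = 1)
    (hv' : v' = v * z + a * w) (h : ambientContact a v = ambientContact (a * z) v')
    (h0 : ⟪a, v⟫ = 0) (h0' : ⟪a * (z : ℍ[ℝ]), v'⟫ = 0) : w = 0 := by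
  rw [hv', ambientContact_gauge, ha, hz] at h
  rw [hv', inner_gauge, ha, hz, h0] at h0'
  have hc : ambientContact z w = 0 := by linarith
  have hi : ⟪z, w⟫ = 0 := by linarith
  rw [Complex.inner] at hi
  rw [ambientContact_eq] at hc
  have hz2 : z.re ^ 2 + z.im ^ 2 = 1 := by
    have : ‖z‖ ^ 2 = 1 := by rw [hz]; norm_num
    rw [← Complex.normSq_eq_norm_sq, Complex.normSq_apply] at this; linarith
  simp at hc hi
  apply Complex.ext <;> simp
  · linear_combination z.re * hi - z.im * hc - w.re * hz2
  · linear_combination z.im * hi + z.re * hc - w.im * hz2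

/-! ### Calculus on unit spheres through radial extensions -/

section Sphere

variable {E : Type*} [NormedAddCommGroup E] [InnerProductSpace ℝ E] {n : ℕ}
  [Fact (Module.finrank ℝ E = n + 1)]

/-- The charts of the unit sphere are restrictions of smooth maps on the ambient space. -/
theorem exists_contDiffAt_extChartAt_eq (y : Metric.sphere (0 : E) 1) :
    ∃ Φ : E → EuclideanSpace ℝ (Fin n), ContDiffAt ℝ ∞ Φ y ∧
      ∀ x : Metric.sphere (0 : E) 1, extChartAt (𝓡 n) y x = Φ x := by
  let U := (OrthonormalBasis.fromOrthogonalSpanSingleton (𝕜 := ℝ)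
        n (ne_zero_of_mem_unit_sphere (-y))).repr
  refine ⟨U ∘ stereoToFun ((-y : Metric.sphere (0 : E) 1) : E), ?_, fun x => ?_⟩
  · refine U.contDiff.contDiffAt.comp _ (contDiffOn_stereoToFun.contDiffAt ?_)
    refine (isOpen_ne_fun (innerSL ℝ _).continuous continuous_const).mem_nhds ?_
    simp only [coe_neg_sphere, Set.mem_ofPred_eq, innerSL_apply_apply, inner_neg_left,
      real_inner_self_eq_norm_sq, norm_eq_of_mem_sphere]
    norm_num
  · simp only [extChartAt, chartAt, ChartedSpace.chartAt]
    rfl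

theorem exists_mvfderiv_coe_eq {x : Metric.sphere (0 : E) 1} {w : E} (h : ⟪(x : E), w⟫ = 0) :
    ∃ v : TangentSpace (𝓡 n) x, mvfderiv (𝓡 n) ((↑) : Metric.sphere (0 : E) 1 → E) x v = w := by
  have h1 : w ∈ (mvfderiv (𝓡 n) ((↑) : Metric.sphere (0 : E) 1 → E) x).range := by
    rw [range_mvfderiv_subtypeVal, Submodule.mem_orthogonal_singleton_iff_inner_right]
    exact h
  exact h1

theorem inner_mvfderiv_coe (x : Metric.sphere (0 : E) 1) (v : TangentSpace (𝓡 n) x) :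
    ⟪(x : E), mvfderiv (𝓡 n) ((↑) : Metric.sphere (0 : E) 1 → E) x v⟫ = 0 := by
  rw [← Submodule.mem_orthogonal_singleton_iff_inner_right, ← range_mvfderiv_subtypeVal (n := n)]
  exact ⟨v, rfl⟩

variable {F H M : Type*} [NormedAddCommGroup F] [NormedSpace ℝ F] [TopologicalSpace H]
  {I : ModelWithCorners ℝ F H} [TopologicalSpace M] [ChartedSpace H M]

/-- Composing with the inclusion gives one direction. For the other, the charts of the sphere extend
to smooth maps of the ambient space, so smoothness in E passes to the chart. -/
theorem contMDiffWithinAt_sphere_iff {f : M → Metric.sphere (0 : E) 1} {s : Set M} {x : M} :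
    ContMDiffWithinAt I (𝓡 n) ∞ f s x ↔
      ContMDiffWithinAt I 𝓘(ℝ, E) ∞ (fun y => (f y : E)) s x := by
  constructor
  · intro h
    exact (contMDiff_coe_sphere (f x)).comp_contMDiffWithinAt x h
  · intro h
    rw [contMDiffWithinAt_iff_target]
    refine ⟨(Topology.IsInducing.subtypeVal.continuousWithinAt_iff).2 h.continuousWithinAt, ?_⟩
    obtain ⟨Φ, hΦ, hx⟩ := exists_contDiffAt_extChartAt_eq (n := n) (f x)
    have h2 : extChartAt (𝓡 n) (f x) ∘ f = Φ ∘ fun y => (f y : E) := funext fun y => hx _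
    rw [h2]
    exact ContMDiffAt.comp_contMDiffWithinAt x hΦ.contMDiffAt h

theorem contMDiffAt_sphere_iff {f : M → Metric.sphere (0 : E) 1} {x : M} :
    ContMDiffAt I (𝓡 n) ∞ f x ↔ ContMDiffAt I 𝓘(ℝ, E) ∞ (fun y => (f y : E)) x :=
  contMDiffWithinAt_sphere_iff

theorem contMDiffOn_sphere_iff {f : M → Metric.sphere (0 : E) 1} {s : Set M} :
    ContMDiffOn I (𝓡 n) ∞ f s ↔ ContMDiffOn I 𝓘(ℝ, E) ∞ (fun y => (f y : E)) s :=
  forall₂_congr fun _ _ => contMDiffWithinAt_sphere_iff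

theorem contMDiff_sphere_iff {f : M → Metric.sphere (0 : E) 1} :
    ContMDiff I (𝓡 n) ∞ f ↔ ContMDiff I 𝓘(ℝ, E) ∞ (fun y => (f y : E)) :=
  forall_congr' fun _ => contMDiffAt_sphere_iff

variable [Nontrivial E]

open Classical in
/-- The radial projection to the unit sphere, with an arbitrary value at the origin. -/
def sphereProj (q : E) : Metric.sphere (0 : E) 1 :=
  if h : q = 0 then ⟨_, (NormedSpace.sphere_nonempty.2 (zero_le_one (α := ℝ))).choose_spec⟩
  else ⟨‖q‖⁻¹ • q, by simp [norm_smul, h]⟩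

theorem coe_sphereProj {q : E} (h : q ≠ 0) : (sphereProj q : E) = ‖q‖⁻¹ • q := by
  simp [sphereProj, h]

theorem sphereProj_coe (x : Metric.sphere (0 : E) 1) : sphereProj (x : E) = x := by
  apply Subtype.ext
  rw [coe_sphereProj (ne_zero_of_mem_unit_sphere x)]
  simp

theorem contMDiffAt_sphereProj {q : E} (h : q ≠ 0) :
    ContMDiffAt 𝓘(ℝ, E) (𝓡 n) ∞ sphereProj q := by
  rw [contMDiffAt_sphere_iff, contMDiffAt_iff_contDiffAt]
  have h1 : ContDiffAt ℝ ∞ (fun q : E => ‖q‖⁻¹ • q) q :=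
    ((contDiffAt_norm ℝ h).inv (norm_ne_zero_iff.2 h)).smul contDiffAt_id
  refine h1.congr_of_eventuallyEq ?_
  filter_upwards [isOpen_ne.mem_nhds h] with p hp using coe_sphereProj hp

variable {X : Type*}

/-- The extension of a map on the unit sphere that is constant on rays. -/
def radialExt (g : Metric.sphere (0 : E) 1 → X) (q : E) : X := g (sphereProj q)

theorem radialExt_coe (g : Metric.sphere (0 : E) 1 → X) (x : Metric.sphere (0 : E) 1) :
    radialExt g x = g x := congrArg g (sphereProj_coe x)

variable [NormedAddCommGroup X] [NormedSpace ℝ X]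

theorem contDiffAt_radialExt {g : Metric.sphere (0 : E) 1 → X} {q : E} (h : q ≠ 0)
    (hg : ContMDiffAt (𝓡 n) 𝓘(ℝ, X) ∞ g (sphereProj q)) :
    ContDiffAt ℝ ∞ (radialExt g) q :=
  contMDiffAt_iff_contDiffAt.1 (hg.comp q (contMDiffAt_sphereProj h))

/-- The derivative of a map on the sphere is that of its radial extension. -/
theorem mvfderiv_eq_fderiv_radialExt {g : Metric.sphere (0 : E) 1 → X}
    {x : Metric.sphere (0 : E) 1} (hg : ContMDiffAt (𝓡 n) 𝓘(ℝ, X) ∞ g x)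
    (v : TangentSpace (𝓡 n) x) :
    mvfderiv (𝓡 n) g x v = fderiv ℝ (radialExt g) x
      (mvfderiv (𝓡 n) ((↑) : Metric.sphere (0 : E) 1 → E) x v) := by
  have h1 : ContDiffAt ℝ ∞ (radialExt g) (x : E) :=
    contDiffAt_radialExt (ne_zero_of_mem_unit_sphere x) (by rwa [sphereProj_coe])
  have h2 := mfderiv_comp_apply (I := 𝓡 n) (I' := 𝓘(ℝ, E)) (I'' := 𝓘(ℝ, X))
    (f := ((↑) : Metric.sphere (0 : E) 1 → E)) (g := radialExt g) x
    (h1.differentiableAt (by simp)).mdifferentiableAt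
    ((contMDiff_coe_sphere (m := 1) x).mdifferentiableAt one_ne_zero) v
  have h3 : radialExt g ∘ ((↑) : Metric.sphere (0 : E) 1 → E) = g :=
    funext fun y => radialExt_coe g y
  rw [h3, mfderiv_eq_fderiv] at h2
  exact h2

/-- The extension is constant along the ray through x. This lets identities between differentials be
checked on tangent vectors only. -/
theorem fderiv_radialExt_self {g : Metric.sphere (0 : E) 1 → X} {x : Metric.sphere (0 : E) 1}
    (hg : ContMDiffAt (𝓡 n) 𝓘(ℝ, X) ∞ g x) : fderiv ℝ (radialExt g) x x = 0 := by
  have h1 : HasFDerivAt (radialExt g) (fderiv ℝ (radialExt g) (x : E)) ((1 : ℝ) • (x : E)) := by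
    rw [one_smul]
    exact ((contDiffAt_radialExt (ne_zero_of_mem_unit_sphere x)
      (by rwa [sphereProj_coe])).differentiableAt (by simp)).hasFDerivAt
  have h2 : HasDerivAt (fun t : ℝ => t • (x : E)) ((1 : ℝ) • (x : E)) 1 :=
    (hasDerivAt_id (1 : ℝ)).smul_const (x : E)
  have h3 := h1.comp_hasDerivAt (1 : ℝ) h2
  have h4 : HasDerivAt (radialExt g ∘ fun t : ℝ => t • (x : E)) 0 1 := by
    refine (hasDerivAt_const (1 : ℝ) (g x)).congr_of_eventuallyEq ?_
    filter_upwards [lt_mem_nhds (zero_lt_one (α := ℝ))] with t ht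
    refine congrArg g (Subtype.ext ?_)
    rw [coe_sphereProj (smul_ne_zero ht.ne' (ne_zero_of_mem_unit_sphere x)), norm_smul,
      norm_eq_of_mem_sphere, mul_one, Real.norm_of_nonneg ht.le, smul_smul,
      inv_mul_cancel₀ ht.ne', one_smul]
  simpa using h3.unique h4

end Sphere

theorem fderiv_radialExt_coe {E : Type*} [NormedAddCommGroup E] [InnerProductSpace ℝ E]
    [Nontrivial E] (n : ℕ) [Fact (Module.finrank ℝ E = n + 1)] {x : Metric.sphere (0 : E) 1}
    {w : E} (h : ⟪(x : E), w⟫ = 0) :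
    fderiv ℝ (radialExt ((↑) : Metric.sphere (0 : E) 1 → E)) x w = w := by
  obtain ⟨v, rfl⟩ := exists_mvfderiv_coe_eq (n := n) h
  exact (mvfderiv_eq_fderiv_radialExt (contMDiff_coe_sphere x) v).symm

/-! ### Derivatives of maps of the spheres, in ambient terms -/

/-- The differential of a map of `S3`, as a linear map of quaternions. -/
def dAmb3 (F : S3 → S3) (x : S3) : ℍ[ℝ] →L[ℝ] ℍ[ℝ] :=
  fderiv ℝ (radialExt fun y => (F y : ℍ[ℝ])) x

/-- The differential of a map of `S2`, as a linear map of Euclidean three-space. -/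
def dAmb2 (f : S2 → S2) (y : S2) : EuclideanSpace ℝ (Fin 3) →L[ℝ] EuclideanSpace ℝ (Fin 3) :=
  fderiv ℝ (radialExt fun z => (f z : EuclideanSpace ℝ (Fin 3))) y

theorem hasFDerivAt_dAmb3 {F : S3 → S3} {x : S3} (hF : ContMDiffAt (𝓡 3) (𝓡 3) ∞ F x) :
    HasFDerivAt (radialExt fun y => (F y : ℍ[ℝ])) (dAmb3 F x) x :=
  ((contDiffAt_radialExt (ne_zero_of_mem_unit_sphere x) (by
    rw [sphereProj_coe]; exact contMDiffAt_sphere_iff.1 hF)).differentiableAt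
      (by simp)).hasFDerivAt

theorem hasFDerivAt_dAmb2 {f : S2 → S2} {y : S2} (hf : ContMDiffAt (𝓡 2) (𝓡 2) ∞ f y) :
    HasFDerivAt (radialExt fun z => (f z : EuclideanSpace ℝ (Fin 3))) (dAmb2 f y) y :=
  ((contDiffAt_radialExt (ne_zero_of_mem_unit_sphere y) (by
    rw [sphereProj_coe]; exact contMDiffAt_sphere_iff.1 hf)).differentiableAt
      (by simp)).hasFDerivAt

theorem ambient3_mfderiv {F : S3 → S3} {x : S3} (hF : ContMDiffAt (𝓡 3) (𝓡 3) ∞ F x)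
    (v : TangentSpace (𝓡 3) x) :
    ambient3 (F x) (mfderiv (𝓡 3) (𝓡 3) F x v) = dAmb3 F x (ambient3 x v) := by
  have h1 := mfderiv_comp_apply (I := 𝓡 3) (I' := 𝓡 3) (I'' := 𝓘(ℝ, ℍ[ℝ])) (f := F)
    (g := ((↑) : S3 → ℍ[ℝ])) x
    ((contMDiff_coe_sphere (m := 1) (F x)).mdifferentiableAt one_ne_zero)
    (hF.mdifferentiableAt (by simp)) v
  exact h1.symm.trans (mvfderiv_eq_fderiv_radialExt (contMDiffAt_sphere_iff.1 hF) v)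

theorem ambient2_mfderiv {f : S2 → S2} {y : S2} (hf : ContMDiffAt (𝓡 2) (𝓡 2) ∞ f y)
    (v : TangentSpace (𝓡 2) y) :
    ambient2 (f y) (mfderiv (𝓡 2) (𝓡 2) f y v) = dAmb2 f y (ambient2 y v) := by
  have h1 := mfderiv_comp_apply (I := 𝓡 2) (I' := 𝓡 2) (I'' := 𝓘(ℝ, EuclideanSpace ℝ (Fin 3)))
    (f := f) (g := ((↑) : S2 → EuclideanSpace ℝ (Fin 3))) y
    ((contMDiff_coe_sphere (m := 1) (f y)).mdifferentiableAt one_ne_zero)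
    (hf.mdifferentiableAt (by simp)) v
  exact h1.symm.trans (mvfderiv_eq_fderiv_radialExt (contMDiffAt_sphere_iff.1 hf) v)

theorem ambientContact_add (q v w : ℍ[ℝ]) :
    ambientContact q (v + w) = ambientContact q v + ambientContact q w := inner_add_right _ _ _

theorem ambientContact_smul (q v : ℍ[ℝ]) (r : ℝ) :
    ambientContact q (r • v) = r * ambientContact q v := real_inner_smul_right _ _ _

theorem ambientContact_self (q : ℍ[ℝ]) : ambientContact q q = 0 := by
  rw [ambientContact_eq]; ring

theorem ambientContact_reeb {q : ℍ[ℝ]} (hq : ‖q‖ = 1) : ambientContact q (q * quatI) = 1 := by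
  have : ‖q * quatI‖ = 1 := by
    rw [norm_mul, hq, one_mul, norm_eq_one_iff_normSq]
    simp [re_quatI, imI_quatI, imJ_quatI, imK_quatI]
  rw [ambientContact, real_inner_self_eq_norm_sq, this, one_pow]

/-- `F` preserves the contact form at `x`. -/
def IsContactAt (F : S3 → S3) (x : S3) : Prop :=
  ∀ w, ambientContact (F x) (dAmb3 F x w) = ambientContact x w

/-- Both sides vanish in the radial direction: the radial extension of F has zero derivative there,
and x is orthogonal to x i. -/
theorem isContactAt_of_tangent {F : S3 → S3} {x : S3} (hF : ContMDiffAt (𝓡 3) (𝓡 3) ∞ F x)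
    (h : ∀ w, ⟪(x : ℍ[ℝ]), w⟫ = 0 → ambientContact (F x) (dAmb3 F x w) = ambientContact x w) :
    IsContactAt F x := by
  intro w
  have h1 : dAmb3 F x (x : ℍ[ℝ]) = 0 := fderiv_radialExt_self (contMDiffAt_sphere_iff.1 hF)
  have h2 : w = (w - ⟪(x : ℍ[ℝ]), w⟫ • (x : ℍ[ℝ])) + ⟪(x : ℍ[ℝ]), w⟫ • (x : ℍ[ℝ]) := by simp
  have h3 : ⟪(x : ℍ[ℝ]), w - ⟪(x : ℍ[ℝ]), w⟫ • (x : ℍ[ℝ])⟫ = 0 := by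
    rw [inner_sub_right, real_inner_smul_right, real_inner_self_eq_norm_sq, norm_eq_of_mem_sphere]
    ring
  rw [h2, map_add, map_smul, h1, smul_zero, add_zero, h _ h3, ambientContact_add,
    ambientContact_smul, ambientContact_self, mul_zero, add_zero]

theorem mem_strictContact_iff {F : DiffS3} : F ∈ strictContact ↔ ∀ x, IsContactAt F x := by
  change (∀ (x : S3) (v : TangentSpace (𝓡 3) x),
    contactForm (F x) (mfderiv (𝓡 3) (𝓡 3) F x v) = contactForm x v) ↔ _
  simp only [contactForm_eq, ambient3_mfderiv (F.contMDiff _)]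
  constructor
  · intro h x
    refine isContactAt_of_tangent (F.contMDiff x) fun w hw => ?_
    obtain ⟨v, rfl⟩ := exists_mvfderiv_coe_eq (n := 3) hw
    exact h x v
  · exact fun h x v => h x _

theorem mem_strictHopfAut_iff {F : DiffS3} :
    F ∈ strictHopfAut ↔ ∀ x : S3, dAmb3 F x ((x : ℍ[ℝ]) * quatI) = (F x : ℍ[ℝ]) * quatI := by
  change (∀ x : S3, mfderiv (𝓡 3) (𝓡 3) F x (hopfField x) = hopfField (F x)) ↔ _
  refine forall_congr' fun x => ?_
  rw [← ambient3_hopfField, ← ambient3_hopfField, ← ambient3_mfderiv (F.contMDiff x)]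
  exact ((injective_mvfderiv_subtypeVal_sphere (F x)).eq_iff).symm

theorem mem_areaPreserving_iff {f : DiffS2} :
    f ∈ areaPreserving ↔ ∀ (y : S2) (v w : EuclideanSpace ℝ (Fin 3)),
      ⟪(y : EuclideanSpace ℝ (Fin 3)), v⟫ = 0 → ⟪(y : EuclideanSpace ℝ (Fin 3)), w⟫ = 0 →
      det3 (f y) (dAmb2 f y v) (dAmb2 f y w) = det3 y v w := by
  change (∀ (y : S2) (v w : TangentSpace (𝓡 2) y),
    areaForm (f y) (mfderiv (𝓡 2) (𝓡 2) f y v) (mfderiv (𝓡 2) (𝓡 2) f y w) = areaForm y v w) ↔ _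
  simp only [areaForm, ambient2_mfderiv (f.contMDiff _)]
  constructor
  · intro h y v w hv hw
    obtain ⟨v, rfl⟩ := exists_mvfderiv_coe_eq (n := 2) hv
    obtain ⟨w, rfl⟩ := exists_mvfderiv_coe_eq (n := 2) hw
    exact h y v w
  · exact fun h y v w => h y _ _ (inner_mvfderiv_coe y v) (inner_mvfderiv_coe y w)

/-! ### The pullback of the contact form and its exterior derivative -/

section Pullback

variable {E : Type*} [NormedAddCommGroup E] [NormedSpace ℝ E]

/-- The contact form as a bilinear map. -/
def contactBilin : ℍ[ℝ] →L[ℝ] ℍ[ℝ] →L[ℝ] ℝ :=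
  (innerSL ℝ).comp ((ContinuousLinearMap.mul ℝ ℍ[ℝ]).flip quatI)

theorem contDiff_contactBilin : ContDiff ℝ ∞ fun q => contactBilin q :=
  (innerSL ℝ (E := ℍ[ℝ])).contDiff.comp (contDiff_id.mul contDiff_const)

theorem ambientContact_swap (q v : ℍ[ℝ]) : ambientContact v q = -ambientContact q v := by
  rw [ambientContact_eq, ambientContact_eq]; ring

/-- The pullback of the contact form by a map to the quaternions. -/
def pullContact (K : E → ℍ[ℝ]) (u : E) : E →L[ℝ] ℝ := (contactBilin (K u)).comp (fderiv ℝ K u)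

theorem pullContact_apply (K : E → ℍ[ℝ]) (u v : E) :
    pullContact K u v = ambientContact (K u) (fderiv ℝ K u v) := rfl

theorem contDiffAt_pullContact {K : E → ℍ[ℝ]} {u : E} (hK : ContDiffAt ℝ ∞ K u) :
    ContDiffAt ℝ ∞ (pullContact K) u :=
  ContDiffAt.clm_comp (g := fun u => contactBilin (K u))
    (contDiff_contactBilin.contDiffAt.comp u hK) (hK.fderiv_right (m := ∞) (by simp))

/-- The exterior derivative of the pullback of the contact form. -/
theorem fderiv_pullContact_sub {K : E → ℍ[ℝ]} {u : E} (hK : ContDiffAt ℝ ∞ K u) (a b : E) :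
    fderiv ℝ (pullContact K) u a b - fderiv ℝ (pullContact K) u b a =
      2 * ambientContact (fderiv ℝ K u a) (fderiv ℝ K u b) := by
  have h1 : HasFDerivAt K (fderiv ℝ K u) u := (hK.differentiableAt (by simp)).hasFDerivAt
  have h2 : HasFDerivAt (fderiv ℝ K) (fderiv ℝ (fderiv ℝ K) u) u :=
    ((hK.fderiv_right (m := ∞) (by simp)).differentiableAt (by simp)).hasFDerivAt
  have h3 := (HasFDerivAt.clm_comp (c := fun u => contactBilin (K u))
    (contactBilin.hasFDerivAt.comp u h1) h2).fderiv
  have h4 : ∀ a b, fderiv ℝ (pullContact K) u a b =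
      ambientContact (K u) (fderiv ℝ (fderiv ℝ K) u a b)
        + ambientContact (fderiv ℝ K u a) (fderiv ℝ K u b) := by
    intro a b
    change fderiv ℝ (fun u => (contactBilin (K u)).comp (fderiv ℝ K u)) u a b = _
    rw [h3]
    rfl
  have h5 : fderiv ℝ (fderiv ℝ K) u a b = fderiv ℝ (fderiv ℝ K) u b a :=
    (hK.isSymmSndFDerivAt (by simpa using WithTop.coe_le_coe.2 (le_top : (2 : ℕ∞) ≤ ⊤))) a b
  rw [h4, h4, h5, ambientContact_swap (fderiv ℝ K u a) (fderiv ℝ K u b)]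
  ring

/-- Differentiate ‖K‖² = 1. The version within a set also covers curves at the endpoints of [0, 1].
-/
theorem inner_fderiv_eq_zero {V : Type*} [NormedAddCommGroup V] [InnerProductSpace ℝ V]
    {K : E → V} {u : E} {s : Set E} {K' : E →L[ℝ] V} (hK : HasFDerivWithinAt K K' s u)
    (hs : UniqueDiffWithinAt ℝ s u) (hu : u ∈ s)
    (h : ∀ x ∈ s, ‖K x‖ = 1) (v : E) : ⟪K u, K' v⟫ = 0 := by
  have h1 := hK.inner ℝ hK
  have h2 : HasFDerivWithinAt (fun x => ⟪K x, K x⟫) (0 : E →L[ℝ] ℝ) s u := by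
    refine (hasFDerivWithinAt_const (1 : ℝ) u s).congr' (fun x hx => ?_) hu
    rw [real_inner_self_eq_norm_sq, h x hx, one_pow]
  have h3 := congrArg (fun L => L v) (hs.eq h1 h2)
  simp only [ContinuousLinearMap.comp_apply, ContinuousLinearMap.prod_apply,
    fderivInnerCLM_apply, zero_apply] at h3
  rw [real_inner_comm (K u)] at h3
  linarith

/-- The imaginary part of a quaternion, as a vector of Euclidean three-space. -/
def imVec : ℍ[ℝ] →L[ℝ] EuclideanSpace ℝ (Fin 3) :=
  LinearMap.toContinuousLinearMap
    { toFun := fun q => !₂[q.imI, q.imJ, q.imK]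
      map_add' := fun p q => by ext i; fin_cases i <;> simp
      map_smul' := fun r q => by ext i; fin_cases i <;> simp }

/-- Quaternionic conjugation as a continuous linear map. -/
def starQuat : ℍ[ℝ] →L[ℝ] ℍ[ℝ] :=
  LinearMap.toContinuousLinearMap
    { toFun := star
      map_add' := star_add
      map_smul' := fun r q => by ext <;> simp }

theorem contDiff_star_quaternion : ContDiff ℝ ∞ (star : ℍ[ℝ] → ℍ[ℝ]) := starQuat.contDiff

theorem hasFDerivAt_hopfVec (q : ℍ[ℝ]) :
    ∃ D : ℍ[ℝ] →L[ℝ] EuclideanSpace ℝ (Fin 3), HasFDerivAt hopfVec D q ∧ ∀ v, D v = dHopf q v :=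
  ⟨_, imVec.hasFDerivAt.comp q (((hasFDerivAt_id q).mul_const' quatI).mul' starQuat.hasFDerivAt),
    fun v => by
      change imVec _ = imVec _
      congr 1⟩

theorem contDiff_hopfVec : ContDiff ℝ ∞ hopfVec :=
  imVec.contDiff.comp ((contDiff_id.mul contDiff_const).mul contDiff_star_quaternion)

theorem fderiv_hopfVec_comp {K : E → ℍ[ℝ]} {u : E} (hK : DifferentiableAt ℝ K u) (v : E) :
    fderiv ℝ (fun u => hopfVec (K u)) u v = dHopf (K u) (fderiv ℝ K u v) := by
  obtain ⟨D, hD, h⟩ := hasFDerivAt_hopfVec (K u)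
  have h1 : HasFDerivAt (fun u => hopfVec (K u)) _ u := hD.comp u hK.hasFDerivAt
  rw [h1.fderiv, ← h]
  rfl

/-- The exterior derivative of the pullback of the contact form is `-1/2` times the pullback of
the area form. -/
theorem fderiv_pullContact_sub_eq_det3 {K : E → ℍ[ℝ]} {u : E} (hK : ContDiffAt ℝ ∞ K u)
    {s : Set E} (hs : s ∈ nhds u) (h : ∀ x ∈ s, ‖K x‖ = 1) (a b : E) :
    fderiv ℝ (pullContact K) u a b - fderiv ℝ (pullContact K) u b a =
      -(1 / 2) * det3 (hopfVec (K u)) (fderiv ℝ (fun u => hopfVec (K u)) u a)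
        (fderiv ℝ (fun u => hopfVec (K u)) u b) := by
  have hd := hK.differentiableAt (by simp)
  have h0 : ∀ v, ⟪K u, fderiv ℝ K u v⟫ = 0 := by
    refine inner_fderiv_eq_zero (hd.hasFDerivAt.hasFDerivWithinAt (s := interior s))
      (isOpen_interior.uniqueDiffWithinAt (mem_interior_iff_mem_nhds.2 hs))
      (mem_interior_iff_mem_nhds.2 hs) fun x hx => h x (interior_subset hx)
  rw [fderiv_pullContact_sub hK, fderiv_hopfVec_comp hd, fderiv_hopfVec_comp hd,
    det3_dHopf _ _ _ (h u (mem_of_mem_nhds hs)) (h0 a) (h0 b), ambientContact]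
  ring

end Pullback

/-! ### Strict contactomorphisms preserve the Reeb field -/

section Chain

variable {E : Type*} [NormedAddCommGroup E] [NormedSpace ℝ E]

theorem hasFDerivWithinAt_dAmb3_comp {F : S3 → S3} {k : E → S3} {s : Set E} {u : E}
    {K' : E →L[ℝ] ℍ[ℝ]} (hF : ContMDiffAt (𝓡 3) (𝓡 3) ∞ F (k u))
    (hk : HasFDerivWithinAt (fun t => (k t : ℍ[ℝ])) K' s u) :
    HasFDerivWithinAt (fun t => (F (k t) : ℍ[ℝ])) ((dAmb3 F (k u)).comp K') s u := by
  have h := (hasFDerivAt_dAmb3 hF).comp_hasFDerivWithinAt u hk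
  simpa only [Function.comp_def, radialExt_coe] using h

theorem hasFDerivWithinAt_dAmb2_comp {f : S2 → S2} {k : E → S2} {s : Set E} {u : E}
    {K' : E →L[ℝ] EuclideanSpace ℝ (Fin 3)} (hf : ContMDiffAt (𝓡 2) (𝓡 2) ∞ f (k u))
    (hk : HasFDerivWithinAt (fun t => (k t : EuclideanSpace ℝ (Fin 3))) K' s u) :
    HasFDerivWithinAt (fun t => (f (k t) : EuclideanSpace ℝ (Fin 3)))
      ((dAmb2 f (k u)).comp K') s u := by
  have h := (hasFDerivAt_dAmb2 hf).comp_hasFDerivWithinAt u hk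
  simpa only [Function.comp_def, radialExt_coe] using h

end Chain

theorem norm_coe_S3 (x : S3) : ‖(x : ℍ[ℝ])‖ = 1 := norm_eq_of_mem_sphere x

theorem contDiffAt_radialExt_coe3 {F : S3 → S3} {q : ℍ[ℝ]} (hq : q ≠ 0)
    (hF : ContMDiffAt (𝓡 3) (𝓡 3) ∞ F (sphereProj q)) :
    ContDiffAt ℝ ∞ (radialExt fun y => (F y : ℍ[ℝ])) q :=
  contDiffAt_radialExt hq (contMDiffAt_sphere_iff.1 hF)

/-- This is F^*dα = dα. The radial extensions of F and of the inclusion pull α back to the same form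
off the origin; equating the exterior derivatives of these pullbacks at x gives the claim. -/
theorem ambientContact_dAmb3 {F : S3 → S3} (hF : ContMDiff (𝓡 3) (𝓡 3) ∞ F)
    (h : ∀ x, IsContactAt F x) (x : S3) {a b : ℍ[ℝ]}
    (ha : ⟪(x : ℍ[ℝ]), a⟫ = 0) (hb : ⟪(x : ℍ[ℝ]), b⟫ = 0) :
    ambientContact (dAmb3 F x a) (dAmb3 F x b) = ambientContact a b := by
  set K := radialExt fun y => (F y : ℍ[ℝ]) with hK
  set K₀ := radialExt ((↑) : S3 → ℍ[ℝ]) with hK₀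
  have hx := ne_zero_of_mem_unit_sphere x
  have h1 : ∀ q : ℍ[ℝ], q ≠ 0 → pullContact K q = pullContact K₀ q := by
    intro q hq
    have h2 : HasFDerivAt K₀ (fderiv ℝ K₀ q) q :=
      ((contDiffAt_radialExt (n := 3) hq (contMDiff_coe_sphere _)).differentiableAt
        (by simp)).hasFDerivAt
    have h3 : HasFDerivAt K ((dAmb3 F (sphereProj q)).comp (fderiv ℝ K₀ q)) q :=
      hasFDerivWithinAt_univ.1 (hasFDerivWithinAt_dAmb3_comp (k := sphereProj) (hF _)
        h2.hasFDerivWithinAt)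
    ext w
    rw [pullContact_apply, pullContact_apply, h3.fderiv]
    exact h (sphereProj q) _
  have h2 : fderiv ℝ (pullContact K) x = fderiv ℝ (pullContact K₀) x :=
    Filter.EventuallyEq.fderiv_eq (by filter_upwards [isOpen_ne.mem_nhds hx] using h1)
  have h3 := fderiv_pullContact_sub (contDiffAt_radialExt_coe3 hx (hF _)) a b
  have h4 := fderiv_pullContact_sub
    (contDiffAt_radialExt (n := 3) hx (contMDiff_coe_sphere (E := ℍ[ℝ]) _)) a b
  rw [h2, h4, fderiv_radialExt_coe 3 ha, fderiv_radialExt_coe 3 hb] at h3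
  exact (mul_left_cancel₀ two_ne_zero h3).symm

theorem inner_dAmb3 {F : S3 → S3} {x : S3} (hF : ContMDiffAt (𝓡 3) (𝓡 3) ∞ F x) (v : ℍ[ℝ]) :
    ⟪(F x : ℍ[ℝ]), dAmb3 F x v⟫ = 0 := by
  have h := inner_fderiv_eq_zero ((hasFDerivAt_dAmb3 hF).hasFDerivWithinAt (s := Set.univ))
    uniqueDiffWithinAt_univ (Set.mem_univ _) (fun q _ => norm_coe_S3 (F (sphereProj q))) v
  rwa [radialExt_coe] at h

theorem dAmb3_dAmb3_symm (F : DiffS3) (x : S3) {w : ℍ[ℝ]} (hw : ⟪(F x : ℍ[ℝ]), w⟫ = 0) :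
    dAmb3 F x (dAmb3 F.symm (F x) w) = w := by
  have h1 := hasFDerivWithinAt_dAmb3_comp (s := Set.univ) (u := ((F x : S3) : ℍ[ℝ]))
    (k := fun q => F.symm (sphereProj q)) (F := F) (F.contMDiff _)
    (hasFDerivAt_dAmb3 (F.symm.contMDiff (F x))).hasFDerivWithinAt
  rw [hasFDerivWithinAt_univ] at h1
  simp only [Diffeomorph.apply_symm_apply, sphereProj_coe, Diffeomorph.symm_apply_apply] at h1
  have h2 : fderiv ℝ (radialExt ((↑) : S3 → ℍ[ℝ])) (F x) w = w := fderiv_radialExt_coe 3 hw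
  have h3 := h1.fderiv
  change fderiv ℝ (radialExt ((↑) : S3 → ℍ[ℝ])) (F x) = _ at h3
  rw [h3] at h2
  exact h2

theorem inner_mul_quatI_mul_quatI (p q : ℍ[ℝ]) : ⟪p * quatI, q * quatI⟫ = ⟪p, q⟫ := by
  simp only [inner_eq, Quaternion.re_mul, Quaternion.imI_mul,
    Quaternion.imJ_mul, Quaternion.imK_mul, re_quatI, imI_quatI, imJ_quatI, imK_quatI]
  ring

/-- The image W of the Reeb vector satisfies the two conditions α(W) = 1 and dα(W, ·) = 0 that
characterize the Reeb vector at F x. -/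
theorem dAmb3_reeb {F : DiffS3} (hF : F ∈ strictContact) (x : S3) :
    dAmb3 F x ((x : ℍ[ℝ]) * quatI) = (F x : ℍ[ℝ]) * quatI := by
  rw [mem_strictContact_iff] at hF
  set W := dAmb3 F x ((x : ℍ[ℝ]) * quatI) with hW
  -- This is dα(W, ·) = 0. Every tangent vector at F x is the image of one at x because F is a
  -- diffeomorphism, so the claim transfers back to x.
  have h1 : ∀ w, ⟪(F x : ℍ[ℝ]), w⟫ = 0 → ⟪W * quatI, w⟫ = 0 := by
    intro w hw
    rw [← dAmb3_dAmb3_symm F x hw]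
    have hxw : ⟪(x : ℍ[ℝ]), dAmb3 F.symm (F x) w⟫ = 0 := by
      have := inner_dAmb3 (F.symm.contMDiff (F x)) w
      rwa [F.symm_apply_apply] at this
    refine (ambientContact_dAmb3 F.contMDiff hF x (inner_mul_quatI _) hxw).trans ?_
    have h2 : (x : ℍ[ℝ]) * quatI * quatI = -x := by
      rw [mul_assoc, show quatI * quatI = -1 by
        ext <;> simp [re_quatI, imI_quatI, imJ_quatI, imK_quatI], mul_neg_one]
    rw [ambientContact, h2, inner_neg_left, hxw, neg_zero]
  have h2 : ambientContact (F x) W = 1 := by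
    rw [hW, hF x, ambientContact_reeb (norm_coe_S3 x)]
  have h3 : ⟪(F x : ℍ[ℝ]), W⟫ = 0 := inner_dAmb3 (F.contMDiff x) _
  set d := W - (F x : ℍ[ℝ]) * quatI with hd
  have h4 : ⟪(F x : ℍ[ℝ]) * quatI, d⟫ = 0 := by
    rw [hd, inner_sub_right]
    have := ambientContact_reeb (norm_coe_S3 (F x))
    rw [ambientContact] at this h2
    rw [this, h2, sub_self]
  -- Right multiplication by i is an isometry, and d i is tangent at F x because d is orthogonal to
  -- (F x) i; so the condition on W applies to d i. Together with `h4` this makes d orthogonal to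
  -- itself.
  have h5 : ⟪W, d⟫ = 0 := by
    rw [← inner_mul_quatI_mul_quatI]
    refine h1 _ ?_
    have h6 := ambientContact_swap (F x : ℍ[ℝ]) d
    rw [ambientContact, ambientContact, h4, neg_zero] at h6
    rwa [real_inner_comm]
  have h6 : ⟪d, d⟫ = 0 := by
    nth_rewrite 1 [hd]
    rw [inner_sub_left, h5, h4, sub_self]
  exact sub_eq_zero.1 (inner_self_eq_zero.1 h6)

theorem mem_strictHopfAut_of_mem_strictContact {F : DiffS3} (hF : F ∈ strictContact) :
    F ∈ strictHopfAut := mem_strictHopfAut_iff.2 (dAmb3_reeb hF)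

/-! ### Automorphisms of the Hopf fibration commute with the rotations of the fibers -/

theorem hasDerivAt_circleExp (θ : ℝ) :
    HasDerivAt (fun t : ℝ => ((Circle.exp t : ℂ) : ℍ[ℝ])) (((Circle.exp θ : ℂ) : ℍ[ℝ]) * quatI)
      θ := by
  have h1 : HasDerivAt (fun t : ℝ => Complex.exp (t * Complex.I))
      (Complex.exp (θ * Complex.I) * (1 * Complex.I)) θ :=
    ((hasDerivAt_id θ).ofReal_comp.mul_const Complex.I).cexp
  have h2 := (LinearMap.toContinuousLinearMap
    Quaternion.ofComplex.toLinearMap).hasFDerivAt.comp_hasDerivAt θ h1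
  simp only [Function.comp_def] at h2
  have h3 : (quatI : ℍ[ℝ]) = ((Complex.I : ℂ) : ℍ[ℝ]) := by
    ext <;> simp [re_quatI, imI_quatI, imJ_quatI, imK_quatI]
  rw [h3, ← Quaternion.coeComplex_mul]
  simpa using h2

theorem circle_mul_quatI (z : ℂ) : (z : ℍ[ℝ]) * quatI = quatI * (z : ℍ[ℝ]) := by
  ext <;> simp [re_quatI, imI_quatI, imJ_quatI, imK_quatI]

theorem map_rot_of_mem_strictHopfAut {F : DiffS3} (hF : F ∈ strictHopfAut) (z : Circle) (x : S3) :
    F (rot z x) = rot z (F x) := by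
  rw [mem_strictHopfAut_iff] at hF
  -- F carries the flow line x e^{it} of A to a flow line of A, so undoing the rotation by e^{-it}
  -- leaves a constant curve.
  have key : ∀ θ : ℝ, HasDerivAt (fun t : ℝ =>
      (F (rot (Circle.exp t) x) : ℍ[ℝ]) * ((Circle.exp (-t) : ℂ) : ℍ[ℝ])) 0 θ := by
    intro θ
    have h1 : HasDerivAt (fun t : ℝ => (rot (Circle.exp t) x : ℍ[ℝ]))
        ((rot (Circle.exp θ) x : ℍ[ℝ]) * quatI) θ := by
      have := (hasDerivAt_circleExp θ).const_mul (x : ℍ[ℝ])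
      rwa [← mul_assoc] at this
    have h2 := hasFDerivWithinAt_univ.1 (hasFDerivWithinAt_dAmb3_comp (F := F)
      (k := fun t => rot (Circle.exp t) x) (F.contMDiff _) h1.hasFDerivAt.hasFDerivWithinAt)
    have h3 : HasDerivAt (fun t : ℝ => (F (rot (Circle.exp t) x) : ℍ[ℝ]))
        ((F (rot (Circle.exp θ) x) : ℍ[ℝ]) * quatI) θ := by
      convert! h2.hasDerivAt using 1
      rw [← hF]
      simp
    have h4 : HasDerivAt (fun t : ℝ => ((Circle.exp (-t) : ℂ) : ℍ[ℝ]))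
        (-(((Circle.exp (-θ) : ℂ) : ℍ[ℝ]) * quatI)) θ := by
      have := (hasDerivAt_circleExp (-θ)).scomp θ (hasDerivAt_neg θ)
      simpa only [Function.comp_def, neg_smul, one_smul] using this
    convert! h3.mul h4 using 1
    rw [circle_mul_quatI, mul_neg, mul_assoc, ← sub_eq_add_neg, sub_self]
  obtain ⟨θ, rfl⟩ : ∃ θ, Circle.exp θ = z := ⟨_, Circle.exp_arg z⟩
  have h1 := is_const_of_deriv_eq_zero (fun θ => (key θ).differentiableAt)
    (fun θ => (key θ).deriv) θ 0
  have h2 : rot (Circle.exp (-θ)) (F (rot (Circle.exp θ) x)) = F x := by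
    apply Subtype.ext
    rw [coe_rot]
    simpa [rot_one] using h1
  rw [← h2, rot_rot, ← Circle.exp_add, add_neg_cancel, Circle.exp_zero, rot_one]

/-! ### The Hopf fibers as orbits of the circle -/

theorem hopfVec_rot (z : Circle) (x : S3) : hopfVec (rot z x) = hopfVec x := by
  have hz := Circle.normSq_coe z
  rw [Complex.normSq_apply] at hz
  rw [coe_rot]
  generalize (x : ℍ[ℝ]) = q
  rw [hopfVec_apply, hopfVec_apply]
  ext i
  fin_cases i
  · simp
    linear_combination (q.re ^ 2 + q.imI ^ 2 - q.imJ ^ 2 - q.imK ^ 2) * hz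
  · simp
    linear_combination (q.imI * q.imJ + q.re * q.imK) * hz
  · simp
    linear_combination (q.imI * q.imK - q.re * q.imJ) * hz

theorem hopf_rot (z : Circle) (x : S3) : hopf (rot z x) = hopf x := Subtype.ext (hopfVec_rot z x)

theorem exists_rot_eq {x x' : S3} (h : hopf x = hopf x') : ∃ z, rot z x = x' := by
  have h1 := mul_fiberQuot (norm_coe_S3 x) (norm_coe_S3 x') (congrArg Subtype.val h)
  have h2 : ‖fiberQuot x x'‖ = 1 := by
    have := congrArg norm h1
    rwa [norm_mul, norm_coeComplex, norm_coe_S3, norm_coe_S3, one_mul] at this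
  exact ⟨⟨_, mem_sphere_zero_iff_norm.2 h2⟩, Subtype.ext h1⟩

theorem rot_injective_left {z w : Circle} {x : S3} (h : rot z x = rot w x) : z = w := by
  have h1 := congrArg Subtype.val h
  rw [coe_rot, coe_rot] at h1
  have h2 := mul_left_cancel₀ (ne_zero_of_mem_unit_sphere x) h1
  apply Circle.ext
  exact Complex.ext (congrArg QuaternionAlgebra.re h2) (congrArg QuaternionAlgebra.imI h2)

/-! ### Tangent lifts along the Hopf map, and preservation of area -/

theorem dHopf_smul (q a : ℍ[ℝ]) (r : ℝ) : dHopf q (r • a) = r • dHopf q a := by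
  rw [dHopf_apply, dHopf_apply]
  ext i
  fin_cases i <;> simp <;> ring

theorem re_imQuat (v : EuclideanSpace ℝ (Fin 3)) : (imQuat v).re = 0 := rfl

theorem imI_imQuat (v : EuclideanSpace ℝ (Fin 3)) : (imQuat v).imI = v 0 := rfl

theorem imJ_imQuat (v : EuclideanSpace ℝ (Fin 3)) : (imQuat v).imJ = v 1 := rfl

theorem imK_imQuat (v : EuclideanSpace ℝ (Fin 3)) : (imQuat v).imK = v 2 := rfl

theorem inner_imQuat_mul (q : ℍ[ℝ]) (v : EuclideanSpace ℝ (Fin 3)) :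
    ⟪q, imQuat v * q * quatI⟫ = -⟪hopfVec q, v⟫ := by
  rw [hopfVec_apply, inner_eq]
  simp [re_imQuat, imI_imQuat, imJ_imQuat, imK_imQuat, re_quatI, imI_quatI,
    imJ_quatI, imK_quatI, PiLp.inner_apply, Fin.sum_univ_three]
  ring

/-- Since i² = -1, each of the two terms of the differential collapses to -|q|² v. At a unit q this
exhibits -½ v q i as a lift of v, and `inner_imQuat_mul` shows that it is tangent to S³ when v is
tangent to S². -/
theorem dHopf_imQuat_mul (q : ℍ[ℝ]) (v : EuclideanSpace ℝ (Fin 3)) :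
    dHopf q (imQuat v * q * quatI) = (-2 * ‖q‖ ^ 2) • v := by
  rw [sq, ← Quaternion.normSq_eq_norm_mul_self, Quaternion.normSq_def', dHopf_apply]
  ext i
  fin_cases i <;> simp [re_imQuat, imI_imQuat, imJ_imQuat, imK_imQuat, re_quatI, imI_quatI,
    imJ_quatI, imK_quatI] <;> ring

/-- A strict contactomorphism covering a map of `S2` covers an area-preserving map. -/
theorem det3_dAmb2_of_covers {F : DiffS3} (hF : F ∈ strictContact) {f : DiffS2}
    (hf : ∀ x, f (hopf x) = hopf (F x)) (x : S3) (v w : EuclideanSpace ℝ (Fin 3))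
    (hv : ⟪(hopf x : EuclideanSpace ℝ (Fin 3)), v⟫ = 0)
    (hw : ⟪(hopf x : EuclideanSpace ℝ (Fin 3)), w⟫ = 0) :
    det3 (f (hopf x)) (dAmb2 f (hopf x) v) (dAmb2 f (hopf x) w) = det3 (hopf x) v w := by
  have hlift : ∀ v : EuclideanSpace ℝ (Fin 3),
      ⟪(hopf x : EuclideanSpace ℝ (Fin 3)), v⟫ = 0 →
        ∃ a : ℍ[ℝ], ⟪(x : ℍ[ℝ]), a⟫ = 0 ∧ dHopf x a = v := by
    intro v hv
    refine ⟨-(1 / 2 : ℝ) • (imQuat v * x * quatI), ?_, ?_⟩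
    · rw [real_inner_smul_right, inner_imQuat_mul, show ⟪hopfVec x, v⟫ = 0 from hv]
      simp
    · rw [dHopf_smul, dHopf_imQuat_mul, norm_coe_S3, smul_smul]
      norm_num
  obtain ⟨a, ha, rfl⟩ := hlift v hv
  obtain ⟨b, hb, rfl⟩ := hlift w hw
  -- The chain rule for f ∘ p = p ∘ F.
  have hder : ∀ a, ⟪(x : ℍ[ℝ]), a⟫ = 0 →
      dAmb2 f (hopf x) (dHopf x a) = dHopf (F x) (dAmb3 F x a) := by
    intro a ha
    have h0 : HasFDerivAt (radialExt ((↑) : S3 → ℍ[ℝ])) (fderiv ℝ (radialExt ((↑) : S3 → ℍ[ℝ])) x)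
        (x : ℍ[ℝ]) :=
      ((contDiffAt_radialExt (n := 3) (ne_zero_of_mem_unit_sphere x)
        (contMDiff_coe_sphere _)).differentiableAt (by simp)).hasFDerivAt
    have h1 : HasFDerivAt (fun q : ℍ[ℝ] => hopfVec (sphereProj q : S3))
        (fderiv ℝ (fun q : ℍ[ℝ] => hopfVec (radialExt ((↑) : S3 → ℍ[ℝ]) q)) x) (x : ℍ[ℝ]) :=
      (contDiff_hopfVec.differentiable (by simp) _ |>.comp _ h0.differentiableAt).hasFDerivAt
    have h2 := hasFDerivWithinAt_univ.1 (hasFDerivWithinAt_dAmb2_comp (f := f)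
      (k := fun q : ℍ[ℝ] => hopf (sphereProj q)) (f.contMDiff _) h1.hasFDerivWithinAt)
    have h3 := hasFDerivAt_dAmb3 (F.contMDiff x)
    have h4 := fderiv_hopfVec_comp h3.differentiableAt a
    have h5 : (fun q => hopfVec (radialExt (fun y => (F y : ℍ[ℝ])) q)) =
        fun q : ℍ[ℝ] => (f (hopf (sphereProj q)) : EuclideanSpace ℝ (Fin 3)) :=
      funext fun q => (congrArg Subtype.val (hf _)).symm
    rw [h5, h2.fderiv, radialExt_coe, sphereProj_coe] at h4
    rw [ContinuousLinearMap.comp_apply, fderiv_hopfVec_comp h0.differentiableAt,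
      fderiv_radialExt_coe 3 ha, radialExt_coe] at h4
    exact h4
  have hx := det3_dHopf x a b (norm_coe_S3 x) ha hb
  have hFx := det3_dHopf (F x) (dAmb3 F x a) (dAmb3 F x b) (norm_coe_S3 _)
    (inner_dAmb3 (F.contMDiff x) _) (inner_dAmb3 (F.contMDiff x) _)
  have h6 := ambientContact_dAmb3 F.contMDiff (mem_strictContact_iff.1 hF) x ha hb
  rw [ambientContact, ambientContact] at h6
  rw [hder a ha, hder b hb, hf]
  exact hFx.trans ((congrArg _ h6).trans hx.symm)

/-! ### Local sections of the Hopf map -/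

theorem contDiff_imQuat : ContDiff ℝ ∞ imQuat :=
  (LinearMap.toContinuousLinearMap
    { toFun := imQuat
      map_add' := fun v w => by
        ext <;> simp [re_imQuat, imI_imQuat, imJ_imQuat, imK_imQuat]
      map_smul' := fun r v => by
        ext <;> simp [re_imQuat, imI_imQuat, imJ_imQuat, imK_imQuat] } :
    EuclideanSpace ℝ (Fin 3) →L[ℝ] ℍ[ℝ]).contDiff

theorem imQuat_injective : Function.Injective imQuat := by
  intro v w h
  ext i
  fin_cases i
  · exact congrArg QuaternionAlgebra.imI h
  · exact congrArg QuaternionAlgebra.imJ h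
  · exact congrArg QuaternionAlgebra.imK h

theorem imQuat_neg (v : EuclideanSpace ℝ (Fin 3)) : imQuat (-v) = -imQuat v := by
  ext <;> simp [re_imQuat, imI_imQuat, imJ_imQuat, imK_imQuat]

theorem imQuat_mul_self {v : EuclideanSpace ℝ (Fin 3)} (hv : ‖v‖ = 1) :
    imQuat v * imQuat v = -1 := by
  have h : v 0 ^ 2 + v 1 ^ 2 + v 2 ^ 2 = 1 := by
    have := EuclideanSpace.norm_sq_eq v
    rw [hv, Fin.sum_univ_three] at this
    simp only [Real.norm_eq_abs, sq_abs] at this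
    linarith
  ext <;> simp [re_imQuat, imI_imQuat, imJ_imQuat, imK_imQuat] <;> linarith

theorem quatI_mul_self : quatI * quatI = -1 := by
  ext <;> simp [re_quatI, imI_quatI, imJ_quatI, imK_quatI]

theorem mul_star_of_norm_eq_one {q : ℍ[ℝ]} (hq : ‖q‖ = 1) : q * star q = 1 := by
  rw [Quaternion.self_mul_star, Quaternion.normSq_eq_norm_mul_self, hq]; simp

theorem star_mul_of_norm_eq_one {q : ℍ[ℝ]} (hq : ‖q‖ = 1) : star q * q = 1 := by
  rw [Quaternion.star_mul_self, Quaternion.normSq_eq_norm_mul_self, hq]; simp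

theorem hopfVec_eq_of_mul_quatI {q : ℍ[ℝ]} (hq : ‖q‖ = 1) {v : EuclideanSpace ℝ (Fin 3)}
    (h : q * quatI = imQuat v * q) : hopfVec q = v := by
  apply imQuat_injective
  rw [imQuat_hopfVec, h, mul_assoc, mul_star_of_norm_eq_one hq, mul_one]

/-- A section of the Hopf map over the complement of the antipode of `hopf x₀`, before
normalization. -/
def preSection (x₀ : S3) (v : EuclideanSpace ℝ (Fin 3)) : ℍ[ℝ] := x₀ - imQuat v * x₀ * quatI

theorem preSection_ne_zero {x₀ : S3} {y : S2} (h : y ≠ -hopf x₀) : preSection x₀ y ≠ 0 := by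
  intro h0
  apply h
  rw [preSection, sub_eq_zero] at h0
  rw [eq_comm, neg_eq_iff_eq_neg]
  apply Subtype.ext
  refine hopfVec_eq_of_mul_quatI (norm_coe_S3 x₀) ?_
  rw [coe_neg_sphere, imQuat_neg]
  nth_rewrite 2 [h0]
  rw [mul_assoc (imQuat _) (x₀ : ℍ[ℝ]), ← mul_assoc (-imQuat _), neg_mul,
    imQuat_mul_self (norm_eq_of_mem_sphere y), neg_neg, one_mul]

/-- A section of the Hopf map over the complement of the antipode of `hopf x₀`. -/
def localSection (x₀ : S3) (v : EuclideanSpace ℝ (Fin 3)) : S3 := sphereProj (preSection x₀ v)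

/-- A unit q lies over v exactly when q i = v q. Since v² = -1, the quaternion s = x₀ - v x₀ i
satisfies s i = x₀ i + v x₀ = v s, and normalizing preserves this. -/
theorem hopf_localSection {x₀ : S3} {y : S2} (h : y ≠ -hopf x₀) : hopf (localSection x₀ y) = y := by
  apply Subtype.ext
  refine hopfVec_eq_of_mul_quatI (norm_coe_S3 _) ?_
  rw [localSection, coe_sphereProj (preSection_ne_zero h), smul_mul_assoc, mul_smul_comm]
  congr 1
  rw [preSection, sub_mul, mul_sub, mul_assoc _ quatI quatI, quatI_mul_self, ← mul_assoc,
    ← mul_assoc, imQuat_mul_self (norm_eq_of_mem_sphere y)]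
  noncomm_ring

theorem contMDiffAt_localSection {x₀ : S3} {y : S2} (h : y ≠ -hopf x₀) :
    ContMDiffAt 𝓘(ℝ, EuclideanSpace ℝ (Fin 3)) (𝓡 3) ∞ (localSection x₀) y := by
  have h1 : ContDiff ℝ ∞ (preSection x₀) :=
    contDiff_const.sub ((contDiff_imQuat.mul contDiff_const).mul contDiff_const)
  exact (contMDiffAt_sphereProj (preSection_ne_zero h)).comp _ h1.contMDiff.contMDiffAt

theorem contMDiffAt_localSection_coe {x₀ : S3} {y : S2} (h : y ≠ -hopf x₀) :
    ContMDiffAt (𝓡 2) (𝓡 3) ∞ (fun z : S2 => localSection x₀ z) y :=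
  (contMDiffAt_localSection h).comp y (contMDiff_coe_sphere y)

theorem ne_neg_self_S2 (y : S2) : y ≠ -y := ne_neg_of_mem_unit_sphere ℝ y

theorem hopf_surjective : Function.Surjective hopf := by
  intro y
  -- The local section based at 1 misses only the point -i, which is the image of j.
  by_cases h : y = -hopf 1
  · have hj : ‖imQuat !₂[0, 1, 0]‖ = 1 := by
      rw [norm_eq_one_iff_normSq]
      simp [re_imQuat, imI_imQuat, imJ_imQuat, imK_imQuat]
    refine ⟨⟨imQuat !₂[0, 1, 0], mem_sphere_zero_iff_norm.2 hj⟩, ?_⟩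
    rw [h]
    apply Subtype.ext
    change hopfVec (imQuat !₂[0, 1, 0]) = -hopfVec (1 : ℍ[ℝ])
    rw [hopfVec_apply, hopfVec_apply]
    ext i
    fin_cases i <;> simp [re_imQuat, imI_imQuat, imJ_imQuat, imK_imQuat]
  · exact ⟨_, hopf_localSection h⟩

theorem contMDiff_hopf : ContMDiff (𝓡 3) (𝓡 2) ∞ hopf :=
  contMDiff_sphere_iff.2 (contDiff_hopfVec.contMDiff.comp contMDiff_coe_sphere)

section Descend

variable {E H M E' H' N : Type*} [NormedAddCommGroup E] [NormedSpace ℝ E] [TopologicalSpace H]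
  {I : ModelWithCorners ℝ E H} [TopologicalSpace M] [ChartedSpace H M]
  [NormedAddCommGroup E'] [NormedSpace ℝ E'] [TopologicalSpace H']
  {I' : ModelWithCorners ℝ E' H'} [TopologicalSpace N] [ChartedSpace H' N]

/-- A smooth map on `S3` that is constant on Hopf fibers descends to a smooth map on `S2`. -/
theorem contMDiff_of_comp_hopf_prod {g : M × S3 → N} {g' : M × S2 → N}
    (hg : ContMDiff (I.prod (𝓡 3)) I' ∞ g) (h : ∀ m x, g' (m, hopf x) = g (m, x)) :
    ContMDiff (I.prod (𝓡 2)) I' ∞ g' := by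
  rintro ⟨m, y⟩
  obtain ⟨x₀, rfl⟩ := hopf_surjective y
  have h1 : ContMDiffAt (I.prod (𝓡 2)) (I.prod (𝓡 3)) ∞
      (fun p : M × S2 => (p.1, localSection x₀ p.2)) (m, hopf x₀) :=
    contMDiffAt_fst.prodMk
      (ContMDiffAt.comp (g := fun z : S2 => localSection x₀ z) (m, hopf x₀)
        (contMDiffAt_localSection_coe (ne_neg_self_S2 _)) contMDiffAt_snd)
  refine (hg.contMDiffAt.comp (m, hopf x₀) h1).congr_of_eventuallyEq ?_
  have h2 : ∀ᶠ p : M × S2 in nhds (m, hopf x₀), p.2 ≠ -hopf x₀ :=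
    (isOpen_ne.preimage continuous_snd).mem_nhds (ne_neg_self_S2 _)
  filter_upwards [h2] with p hp
  rw [Function.comp_apply, ← h, hopf_localSection hp]

theorem contMDiff_of_comp_hopf {g : S3 → N} {g' : S2 → N}
    (hg : ContMDiff (𝓡 3) I' ∞ g) (h : ∀ x, g' (hopf x) = g x) : ContMDiff (𝓡 2) I' ∞ g' := by
  intro y
  obtain ⟨x₀, rfl⟩ := hopf_surjective y
  refine (hg.contMDiffAt.comp (hopf x₀)
    (contMDiffAt_localSection_coe (ne_neg_self_S2 _))).congr_of_eventuallyEq ?_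
  filter_upwards [isOpen_ne.mem_nhds (ne_neg_self_S2 (hopf x₀))] with p hp
  rw [Function.comp_apply, ← h, hopf_localSection hp]

end Descend

/-! ### The induced diffeomorphism of `S2` -/

/-- The map of `S2` induced by a map of `S3` that permutes the Hopf fibers. -/
def inducedMap (F : S3 → S3) (y : S2) : S2 := hopf (F (Function.surjInv hopf_surjective y))

theorem inducedMap_hopf {F : S3 → S3} (hF : ∀ z x, F (rot z x) = rot z (F x)) (x : S3) :
    inducedMap F (hopf x) = hopf (F x) := by
  obtain ⟨z, hz⟩ := exists_rot_eq (Function.surjInv_eq hopf_surjective (hopf x))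
  nth_rewrite 2 [← hz]
  rw [hF, hopf_rot, inducedMap]

theorem map_rot {F : DiffS3} (hF : F ∈ strictContact) (z : Circle) (x : S3) :
    F (rot z x) = rot z (F x) :=
  map_rot_of_mem_strictHopfAut (mem_strictHopfAut_of_mem_strictContact hF) z x

theorem contMDiff_inducedMap {F : DiffS3} (hF : F ∈ strictContact) :
    ContMDiff (𝓡 2) (𝓡 2) ∞ (inducedMap F) :=
  contMDiff_of_comp_hopf (contMDiff_hopf.comp F.contMDiff) (inducedMap_hopf (map_rot hF))

/-- The diffeomorphism of `S2` induced by a strict contactomorphism. -/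
def inducedDiff (F : strictContact) : DiffS2 where
  toFun := inducedMap (F : DiffS3)
  invFun := inducedMap (F⁻¹ : strictContact).1
  left_inv y := by
    obtain ⟨x, rfl⟩ := hopf_surjective y
    rw [inducedMap_hopf (map_rot F.2), inducedMap_hopf (map_rot (F⁻¹).2)]
    exact congrArg hopf (F.1.symm_apply_apply x)
  right_inv y := by
    obtain ⟨x, rfl⟩ := hopf_surjective y
    rw [inducedMap_hopf (map_rot (F⁻¹).2), inducedMap_hopf (map_rot F.2)]
    exact congrArg hopf (F.1.apply_symm_apply x)
  contMDiff_toFun := contMDiff_inducedMap F.2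
  contMDiff_invFun := contMDiff_inducedMap (F⁻¹).2

theorem inducedDiff_hopf (F : strictContact) (x : S3) :
    inducedDiff F (hopf x) = hopf ((F : DiffS3) x) := inducedMap_hopf (map_rot F.2) x

theorem inducedDiff_mem (F : strictContact) : inducedDiff F ∈ areaPreserving := by
  rw [mem_areaPreserving_iff]
  intro y v w hv hw
  obtain ⟨x, rfl⟩ := hopf_surjective y
  exact det3_dAmb2_of_covers F.2 (inducedDiff_hopf F) x v w hv hw

/-- The homomorphism from strict contactomorphisms of `S3` to area-preserving diffeomorphisms
of `S2`. -/
def inducedHom : strictContact →* areaPreserving :=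
  MonoidHom.mk' (fun F => ⟨inducedDiff F, inducedDiff_mem F⟩) fun F G => by
    refine Subtype.ext (Diffeomorph.ext fun y => ?_)
    obtain ⟨x, rfl⟩ := hopf_surjective y
    change inducedDiff (F * G) (hopf x) = inducedDiff F (inducedDiff G (hopf x))
    rw [inducedDiff_hopf, inducedDiff_hopf, inducedDiff_hopf]
    rfl

theorem inducedHom_hopf (F : strictContact) (x : S3) :
    (inducedHom F : DiffS2) (hopf x) = hopf ((F : DiffS3) x) := inducedDiff_hopf F x

/-! ### Smooth families and injectivity of the fiber rotations -/

theorem contMDiff_inducedHom_family {n : ℕ} {c : EuclideanSpace ℝ (Fin n) → strictContact}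
    (hc : ContMDiff ((𝓡 n).prod (𝓡 3)) (𝓡 3) ∞
      (fun q : EuclideanSpace ℝ (Fin n) × S3 => (c q.1 : DiffS3) q.2)) :
    ContMDiff ((𝓡 n).prod (𝓡 2)) (𝓡 2) ∞
      (fun q : EuclideanSpace ℝ (Fin n) × S2 => (inducedHom (c q.1) : DiffS2) q.2) :=
  contMDiff_of_comp_hopf_prod (contMDiff_hopf.comp hc) fun _ _ => inducedHom_hopf _ _

theorem fiberRotation_injective : Function.Injective fiberRotation := by
  intro z w h
  exact rot_injective_left (x := 1) (congrArg (fun F : strictContact => (F : DiffS3) 1) h)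

attribute [local instance] finrank_real_complex_fact' in
theorem contMDiff_fiberRotation : ContMDiff ((𝓡 1).prod (𝓡 3)) (𝓡 3) ∞
    (fun q : Circle × S3 => (fiberRotation q.1 : DiffS3) q.2) := by
  rw [contMDiff_sphere_iff]
  have h1 : ContMDiff (𝓡 1) 𝓘(ℝ, ℂ) ∞ (fun z : Circle => (z : ℂ)) :=
    contMDiff_coe_sphere (E := ℂ)
  have h2 : ContDiff ℝ ∞ (fun z : ℂ => (z : ℍ[ℝ])) :=
    (LinearMap.toContinuousLinearMap Quaternion.ofComplex.toLinearMap).contDiff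
  have h3 : ContMDiff ((𝓡 1).prod (𝓡 3)) 𝓘(ℝ, ℍ[ℝ]) ∞ (fun q : Circle × S3 => (q.2 : ℍ[ℝ])) :=
    contMDiff_coe_sphere.comp contMDiff_snd
  have h4 : ContMDiff ((𝓡 1).prod (𝓡 3)) 𝓘(ℝ, ℍ[ℝ]) ∞
      (fun q : Circle × S3 => ((q.1 : ℂ) : ℍ[ℝ])) := h2.contMDiff.comp (h1.comp contMDiff_fst)
  have h5 : ContDiff ℝ ∞ (fun p : ℍ[ℝ] × ℍ[ℝ] => p.1 * p.2) := contDiff_fst.mul contDiff_snd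
  exact h5.contMDiff.comp (h3.prodMk_space h4)

/-! ### Rigidity of lifts with a prescribed pullback of the contact form -/

section Rigidity

variable {E : Type*} [NormedAddCommGroup E] [NormedSpace ℝ E]

/-- The complex part of a quaternion. -/
def complexPart : ℍ[ℝ] →L[ℝ] ℂ :=
  LinearMap.toContinuousLinearMap
    { toFun := fun q => ⟨q.re, q.imI⟩
      map_add' := fun p q => by apply Complex.ext <;> simp
      map_smul' := fun r q => by apply Complex.ext <;> simp }

/-- The inclusion of the complex numbers in the quaternions. -/
def complexIncl : ℂ →L[ℝ] ℍ[ℝ] := LinearMap.toContinuousLinearMap Quaternion.ofComplex.toLinearMap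

theorem fiberQuot_rot (z : Circle) (x : S3) : fiberQuot x (rot z x) = z := by
  rw [fiberQuot, coe_rot, ← mul_assoc, star_mul_of_norm_eq_one (norm_coe_S3 x), one_mul]
  rfl

theorem rot_eq_of_fiberQuot {z : Circle} {x x' : S3} (h : hopf x = hopf x')
    (hz : fiberQuot x x' = z) : rot z x = x' := by
  apply Subtype.ext
  rw [coe_rot, ← hz]
  exact mul_fiberQuot (norm_coe_S3 x) (norm_coe_S3 x') (congrArg Subtype.val h)

/-- Write K₂ = K₁ ζ with ζ the unit phase. By the gauge formula the pullbacks of α differ by the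
angular velocity of ζ; they agree at u, so ζ has zero derivative there. -/
theorem hasFDerivWithinAt_fiberQuot {K₁ K₂ : E → S3} {s : Set E} {u : E} {D₁ D₂ : E →L[ℝ] ℍ[ℝ]}
    (hs : UniqueDiffWithinAt ℝ s u) (hu : u ∈ s) (h : ∀ x ∈ s, hopf (K₁ x) = hopf (K₂ x))
    (h₁ : HasFDerivWithinAt (fun x => (K₁ x : ℍ[ℝ])) D₁ s u)
    (h₂ : HasFDerivWithinAt (fun x => (K₂ x : ℍ[ℝ])) D₂ s u)
    (hc : ∀ v, ambientContact (K₁ u) (D₁ v) = ambientContact (K₂ u) (D₂ v)) :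
    HasFDerivWithinAt (fun x => fiberQuot (K₁ x) (K₂ x)) (0 : E →L[ℝ] ℂ) s u := by
  obtain ⟨Z', hZ⟩ : ∃ Z', HasFDerivWithinAt (fun x => fiberQuot (K₁ x) (K₂ x)) Z' s u :=
    ⟨_, complexPart.hasFDerivAt.comp_hasFDerivWithinAt u
      ((starQuat.hasFDerivAt.comp_hasFDerivWithinAt u h₁).mul' h₂)⟩
  have hmul : ∀ x ∈ s, (K₁ x : ℍ[ℝ]) * (fiberQuot (K₁ x) (K₂ x) : ℍ[ℝ]) = K₂ x := fun x hx =>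
    mul_fiberQuot (norm_coe_S3 _) (norm_coe_S3 _) (congrArg Subtype.val (h x hx))
  have h3 := h₁.mul' (complexIncl.hasFDerivAt.comp_hasFDerivWithinAt u hZ)
  have h4 := hs.eq h₂ (h3.congr (fun x hx => (hmul x hx).symm) (hmul u hu).symm)
  have h5 : ∀ v,
      D₂ v = D₁ v * (fiberQuot (K₁ u) (K₂ u) : ℍ[ℝ]) + (K₁ u : ℍ[ℝ]) * (Z' v : ℍ[ℝ]) := by
    intro v
    rw [h4, add_comm (D₁ v * _)]
    rfl
  have hnorm : ‖fiberQuot (K₁ u) (K₂ u)‖ = 1 := by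
    have := congrArg norm (hmul u hu)
    rwa [norm_mul, norm_coeComplex, norm_coe_S3, norm_coe_S3, one_mul] at this
  have hZ0 : Z' = 0 := by
    ext1 v
    refine phase_velocity_eq_zero (norm_coe_S3 (K₁ u)) hnorm (h5 v) ?_ ?_ ?_
    · rw [hmul u hu, hc]
    · exact inner_fderiv_eq_zero h₁ hs hu (fun x _ => norm_coe_S3 _) v
    · rw [hmul u hu]
      exact inner_fderiv_eq_zero h₂ hs hu (fun x _ => norm_coe_S3 _) v
  rwa [hZ0] at hZ

/-- The version for sets that need not be open: it serves curves on [0, 1], with one-sided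
derivatives at the ends. -/
theorem eq_rot_of_convex {K₁ K₂ : E → S3} {s : Set E} (hconv : Convex ℝ s)
    (hs : UniqueDiffOn ℝ s) (h : ∀ x ∈ s, hopf (K₁ x) = hopf (K₂ x))
    (h' : ∀ x ∈ s, ∃ D₁ D₂ : E →L[ℝ] ℍ[ℝ],
      HasFDerivWithinAt (fun x => (K₁ x : ℍ[ℝ])) D₁ s x ∧
      HasFDerivWithinAt (fun x => (K₂ x : ℍ[ℝ])) D₂ s x ∧
      ∀ v, ambientContact (K₁ x) (D₁ v) = ambientContact (K₂ x) (D₂ v))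
    {u x : E} (hu : u ∈ s) (hx : x ∈ s) {z : Circle} (hz : rot z (K₁ u) = K₂ u) :
    rot z (K₁ x) = K₂ x := by
  have h0 : ∀ x ∈ s, HasFDerivWithinAt (fun x => fiberQuot (K₁ x) (K₂ x)) (0 : E →L[ℝ] ℂ) s x := by
    intro x hx
    obtain ⟨D₁, D₂, h₁, h₂, hc⟩ := h' x hx
    exact hasFDerivWithinAt_fiberQuot (hs x hx) hx h h₁ h₂ hc
  have h1 := hconv.is_const_of_fderivWithin_eq_zero (𝕜 := ℝ)
    (fun x hx => (h0 x hx).differentiableWithinAt)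
    (fun x hx => (h0 x hx).fderivWithin (hs x hx)) hu hx
  refine rot_eq_of_fiberQuot (h x hx) ?_
  rw [← fiberQuot_rot z (K₁ u), hz]
  exact h1.symm

/-- The version for open sets that need not be convex: it serves the punctured quaternions and the
punctured plane. -/
theorem exists_eq_rot_of_isOpen {K₁ K₂ : E → S3} {s : Set E} (hs : IsOpen s)
    (hs' : IsPreconnected s) (h : ∀ x ∈ s, hopf (K₁ x) = hopf (K₂ x))
    (h' : ∀ x ∈ s, ∃ D₁ D₂ : E →L[ℝ] ℍ[ℝ],
      HasFDerivAt (fun x => (K₁ x : ℍ[ℝ])) D₁ x ∧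
      HasFDerivAt (fun x => (K₂ x : ℍ[ℝ])) D₂ x ∧
      ∀ v, ambientContact (K₁ x) (D₁ v) = ambientContact (K₂ x) (D₂ v)) :
    ∃ z, ∀ x ∈ s, rot z (K₁ x) = K₂ x := by
  obtain rfl | ⟨u, hu⟩ := s.eq_empty_or_nonempty
  · exact ⟨1, fun _ h => h.elim⟩
  have h0 : ∀ x ∈ s, HasFDerivAt (fun x => fiberQuot (K₁ x) (K₂ x)) (0 : E →L[ℝ] ℂ) x := by
    intro x hx
    obtain ⟨D₁, D₂, h₁, h₂, hc⟩ := h' x hx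
    exact (hasFDerivWithinAt_fiberQuot (hs.uniqueDiffWithinAt hx) hx h h₁.hasFDerivWithinAt
      h₂.hasFDerivWithinAt hc).hasFDerivAt (hs.mem_nhds hx)
  obtain ⟨z, hz⟩ := exists_rot_eq (h u hu)
  refine ⟨z, fun x hx => rot_eq_of_fiberQuot (h x hx) ?_⟩
  rw [← fiberQuot_rot z (K₁ u), hz]
  exact hs.is_const_of_fderiv_eq_zero (𝕜 := ℝ) hs'
    (fun x hx => (h0 x hx).differentiableAt.differentiableWithinAt)
    (fun x hx => (h0 x hx).fderiv) hx hu

end Rigidity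

/-! ### The kernel of the induced homomorphism -/

/-- Contact maps of `S3` that cover the same map of `S2` differ by a uniform rotation of the
fibers. -/
theorem exists_rot_of_hopf_eq {F G : S3 → S3} (hF : ContMDiff (𝓡 3) (𝓡 3) ∞ F)
    (hG : ContMDiff (𝓡 3) (𝓡 3) ∞ G) (hF' : ∀ x, IsContactAt F x) (hG' : ∀ x, IsContactAt G x)
    (h : ∀ x, hopf (F x) = hopf (G x)) : ∃ z, ∀ x, rot z (F x) = G x := by
  have hrank : 1 < Module.rank ℝ ℍ[ℝ] := by
    rw [← Module.finrank_eq_rank, Quaternion.finrank_eq_four]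
    norm_num
  have h0 : ∀ q : ℍ[ℝ], q ≠ 0 →
      ∃ D, HasFDerivAt (fun q : ℍ[ℝ] => ((sphereProj q : S3) : ℍ[ℝ])) D q :=
    fun q hq => ⟨_, ((contDiffAt_radialExt (n := 3) hq
      (contMDiff_coe_sphere (E := ℍ[ℝ]) _)).differentiableAt (by simp)).hasFDerivAt⟩
  -- Extended along rays, both maps live on the punctured quaternions, an open connected subset of a
  -- vector space.
  obtain ⟨z, hz⟩ := exists_eq_rot_of_isOpen (K₁ := fun q : ℍ[ℝ] => F (sphereProj q))
    (K₂ := fun q : ℍ[ℝ] => G (sphereProj q)) (isOpen_compl_singleton (x := (0 : ℍ[ℝ])))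
    (isConnected_compl_singleton_of_one_lt_rank hrank 0).isPreconnected (fun q _ => h _) (by
      intro q hq
      obtain ⟨D, hD⟩ := h0 q hq
      refine ⟨_, _, hasFDerivWithinAt_univ.1 (hasFDerivWithinAt_dAmb3_comp (hF _)
        hD.hasFDerivWithinAt), hasFDerivWithinAt_univ.1 (hasFDerivWithinAt_dAmb3_comp (hG _)
        hD.hasFDerivWithinAt), fun v => ?_⟩
      exact (hF' _ _).trans (hG' _ _).symm)
  refine ⟨z, fun x => ?_⟩
  have := hz x (ne_zero_of_mem_unit_sphere x)
  rwa [sphereProj_coe] at this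

theorem isContactAt_id (x : S3) : IsContactAt id x :=
  mem_strictContact_iff.1 (one_mem strictContact) x

/-- An element of the kernel covers the same map of S² as the identity, so rigidity makes it a
uniform rotation. -/
theorem fiberRotation_range_eq_ker : fiberRotation.range = inducedHom.ker := by
  ext F
  rw [MonoidHom.mem_ker]
  constructor
  · rintro ⟨z, rfl⟩
    refine Subtype.ext (Diffeomorph.ext fun y => ?_)
    obtain ⟨x, rfl⟩ := hopf_surjective y
    exact (inducedHom_hopf _ x).trans (hopf_rot z x)
  · intro h
    obtain ⟨z, hz⟩ := exists_rot_of_hopf_eq contMDiff_id (F : DiffS3).contMDiff isContactAt_id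
      (mem_strictContact_iff.1 F.2) (fun x => by rw [← inducedHom_hopf, h]; rfl)
    exact ⟨z, Subtype.ext (Diffeomorph.ext hz)⟩

/-! ### Horizontal lifts -/

theorem uniqueDiffOn_unitInterval : UniqueDiffOn ℝ (Set.Icc (0 : ℝ) 1) :=
  uniqueDiffOn_Icc zero_lt_one

theorem zero_mem_unitInterval : (0 : ℝ) ∈ Set.Icc (0 : ℝ) 1 := ⟨le_rfl, zero_le_one⟩

theorem one_mem_unitInterval : (1 : ℝ) ∈ Set.Icc (0 : ℝ) 1 := ⟨zero_le_one, le_rfl⟩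

theorem contDiffOn_coe_S3 {c : ℝ → S3} {s : Set ℝ} :
    ContMDiffOn 𝓘(ℝ, ℝ) (𝓡 3) ∞ c s ↔ ContDiffOn ℝ ∞ (fun t => (c t : ℍ[ℝ])) s :=
  contMDiffOn_sphere_iff.trans contMDiffOn_iff_contDiffOn

theorem hasDerivWithinAt_coe_S3 {c : ℝ → S3} {s : Set ℝ} (hc : ContMDiffOn 𝓘(ℝ, ℝ) (𝓡 3) ∞ c s)
    {t : ℝ} (ht : t ∈ s) :
    HasDerivWithinAt (fun t => (c t : ℍ[ℝ])) (derivWithin (fun t => (c t : ℍ[ℝ])) s t) s t :=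
  ((contDiffOn_coe_S3.1 hc).differentiableOn (by simp) t ht).hasDerivWithinAt

/-- Both lifts pull α back to zero, so their initial phase difference persists. -/
theorem eq_rot_of_isHorizontalLift {γ : ℝ → S2} {c c' : ℝ → S3} (hc : IsHorizontalLift γ c)
    (hc' : IsHorizontalLift γ c') {z : Circle} (h : rot z (c 0) = c' 0) {t : ℝ}
    (ht : t ∈ Set.Icc (0 : ℝ) 1) : rot z (c t) = c' t := by
  refine eq_rot_of_convex (convex_Icc 0 1) uniqueDiffOn_unitInterval
    (fun x hx => (hc.2.1 x hx).trans (hc'.2.1 x hx).symm) (fun x hx => ?_)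
    zero_mem_unitInterval ht h
  refine ⟨_, _, (hasDerivWithinAt_coe_S3 hc.1 hx).hasFDerivWithinAt,
    (hasDerivWithinAt_coe_S3 hc'.1 hx).hasFDerivWithinAt, fun v => ?_⟩
  simp only [ContinuousLinearMap.toSpanSingleton_apply, ambientContact_smul]
  congr 1
  exact (hc.2.2 x hx).trans (hc'.2.2 x hx).symm

theorem IsHorizontalLift.eqOn {γ : ℝ → S2} {c c' : ℝ → S3} (hc : IsHorizontalLift γ c)
    (hc' : IsHorizontalLift γ c') (h : c 0 = c' 0) : Set.EqOn c c' (Set.Icc 0 1) := by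
  intro t ht
  have := eq_rot_of_isHorizontalLift hc hc' (z := 1) (by rw [rot_one, h]) ht
  rwa [rot_one] at this

theorem IsHorizontalLift.transport_eq {γ : ℝ → S2} {c : ℝ → S3} (hc : IsHorizontalLift γ c) :
    transport γ (c 0) = c 1 := by
  have h : ∃ c', IsHorizontalLift γ c' ∧ c' 0 = c 0 := ⟨c, hc, rfl⟩
  rw [transport, dif_pos h]
  exact h.choose_spec.1.eqOn hc h.choose_spec.2 one_mem_unitInterval

theorem IsHorizontalLift.rot {γ : ℝ → S2} {c : ℝ → S3} (hc : IsHorizontalLift γ c) (z : Circle) :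
    IsHorizontalLift γ fun t => HopfContact.rot z (c t) := by
  refine ⟨(contMDiff_rot z).comp_contMDiffOn hc.1, fun t ht => (hopf_rot _ _).trans (hc.2.1 t ht),
    fun t ht => ?_⟩
  have h1 : HasDerivWithinAt (fun t => (HopfContact.rot z (c t) : ℍ[ℝ])) _ (Set.Icc 0 1) t :=
    (hasDerivWithinAt_coe_S3 hc.1 ht).mul_const _
  rw [h1.derivWithin (uniqueDiffOn_unitInterval t ht), coe_rot, mul_assoc, circle_mul_quatI,
    ← mul_assoc, inner_mul_right_circle]
  exact hc.2.2 t ht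

/-- The velocity of the curve `τ` along the Hopf fibers. -/
def verticalSpeed (τ : ℝ → S3) (t : ℝ) : ℝ :=
  ambientContact (τ t) (derivWithin (fun s => (τ s : ℍ[ℝ])) (Set.Icc 0 1) t)

theorem contDiffOn_verticalSpeed {τ : ℝ → S3} (hτ : ContMDiffOn 𝓘(ℝ, ℝ) (𝓡 3) ∞ τ (Set.Icc 0 1)) :
    ContDiffOn ℝ ∞ (verticalSpeed τ) (Set.Icc 0 1) := by
  have h := contDiffOn_coe_S3.1 hτ
  exact ContDiffOn.inner ℝ (h.mul contDiffOn_const)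
    (((contDiffOn_infty_iff_derivWithin uniqueDiffOn_unitInterval).1 h).2)

theorem hasDerivWithinAt_integral_verticalSpeed {τ : ℝ → S3}
    (hτ : ContMDiffOn 𝓘(ℝ, ℝ) (𝓡 3) ∞ τ (Set.Icc 0 1)) {t : ℝ} (ht : t ∈ Set.Icc (0 : ℝ) 1) :
    HasDerivWithinAt (fun u => ∫ s in (0 : ℝ)..u, verticalSpeed τ s) (verticalSpeed τ t)
      (Set.Icc 0 1) t := by
  have hc := (contDiffOn_verticalSpeed hτ).continuousOn
  have hfact : Fact (t ∈ Set.Icc (0 : ℝ) 1) := ⟨ht⟩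
  refine intervalIntegral.integral_hasDerivWithinAt_right
    ((hc.mono (Set.Icc_subset_Icc_right ht.2)).intervalIntegrable_of_Icc ht.1)
    (hc.stronglyMeasurableAtFilter_nhdsWithin measurableSet_Icc t) (hc t ht)

/-- The curve `τ`, rotated within the Hopf fibers so as to become horizontal. -/
def straighten (τ : ℝ → S3) (t : ℝ) : S3 :=
  rot (Circle.exp (-∫ s in (0 : ℝ)..t, verticalSpeed τ s)) (τ t)

theorem straighten_zero (τ : ℝ → S3) : straighten τ 0 = τ 0 := by
  rw [straighten, intervalIntegral.integral_same, neg_zero, Circle.exp_zero, rot_one]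

theorem contDiff_circleExp_quaternion :
    ContDiff ℝ ∞ fun t : ℝ => ((Circle.exp t : ℂ) : ℍ[ℝ]) := by
  refine complexIncl.contDiff.comp ?_
  simp only [Circle.coe_exp]
  exact Complex.contDiff_exp.comp (Complex.ofRealCLM.contDiff.mul contDiff_const)

theorem isHorizontalLift_straighten {γ : ℝ → S2} {τ : ℝ → S3}
    (hτ : ContMDiffOn 𝓘(ℝ, ℝ) (𝓡 3) ∞ τ (Set.Icc 0 1))
    (hγ : ∀ t ∈ Set.Icc (0 : ℝ) 1, hopf (τ t) = γ t) : IsHorizontalLift γ (straighten τ) := by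
  -- The integral is smooth up to the endpoints because its derivative, the vertical speed, is.
  have hφ : ContDiffOn ℝ ∞ (fun u => ∫ s in (0 : ℝ)..u, verticalSpeed τ s) (Set.Icc 0 1) := by
    rw [contDiffOn_infty_iff_derivWithin uniqueDiffOn_unitInterval]
    refine ⟨fun t ht => (hasDerivWithinAt_integral_verticalSpeed hτ ht).differentiableWithinAt,
      (contDiffOn_verticalSpeed hτ).congr fun t ht => ?_⟩
    exact (hasDerivWithinAt_integral_verticalSpeed hτ ht).derivWithin
      (uniqueDiffOn_unitInterval t ht)
  refine ⟨contDiffOn_coe_S3.2 ((contDiffOn_coe_S3.1 hτ).mul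
    (contDiff_circleExp_quaternion.comp_contDiffOn hφ.neg)),
    fun t ht => (hopf_rot _ _).trans (hγ t ht), fun t ht => ?_⟩
  have h1 := (hasDerivWithinAt_coe_S3 hτ ht).mul ((hasDerivAt_circleExp _).scomp_hasDerivWithinAt t
    (hasDerivWithinAt_integral_verticalSpeed hτ ht).neg)
  have h2 : HasDerivWithinAt (fun t => (straighten τ t : ℍ[ℝ])) _ (Set.Icc 0 1) t := h1
  rw [h2.derivWithin (uniqueDiffOn_unitInterval t ht)]
  set z : ℂ := ((Circle.exp (-∫ s in (0 : ℝ)..t, verticalSpeed τ s) : Circle) : ℂ) with hz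
  have hz1 : ‖z‖ = 1 := Circle.norm_coe _
  have h3 : -verticalSpeed τ t • ((z : ℍ[ℝ]) * quatI) =
      ((-verticalSpeed τ t • (z * Complex.I) : ℂ) : ℍ[ℝ]) := by
    ext <;> simp [re_quatI, imI_quatI, imJ_quatI, imK_quatI]
  have h4 := ambientContact_gauge (τ t) (derivWithin (fun t => (τ t : ℍ[ℝ])) (Set.Icc 0 1) t) z
    (-verticalSpeed τ t • (z * Complex.I))
  rw [← h3, ambientContact_smul, ambientContact_reeb (by rw [norm_coeComplex, hz1]), hz1,
    norm_coe_S3] at h4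
  refine h4.trans ?_
  change 1 ^ 2 * verticalSpeed τ t + _ = 0
  ring

/-- Any smooth lift, horizontal or not, computes the transport through its total vertical
displacement. Holonomy is read off from this formula. -/
theorem transport_eq_of_lift {γ : ℝ → S2} {τ : ℝ → S3}
    (hτ : ContMDiffOn 𝓘(ℝ, ℝ) (𝓡 3) ∞ τ (Set.Icc 0 1))
    (hγ : ∀ t ∈ Set.Icc (0 : ℝ) 1, hopf (τ t) = γ t) :
    transport γ (τ 0) = rot (Circle.exp (-∫ s in (0 : ℝ)..1, verticalSpeed τ s)) (τ 1) := by
  have := (isHorizontalLift_straighten hτ hγ).transport_eq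
  rwa [straighten_zero] at this

/-- A smooth path in `S2` is not onto. -/
theorem exists_forall_ne_neg_hopf {γ : ℝ → S2} (hγ : IsSmoothPath γ) :
    ∃ x₀ : S3, ∀ t ∈ Set.Icc (0 : ℝ) 1, γ t ≠ -hopf x₀ := by
  have h1 : ContDiffOn ℝ ∞ (fun t => (γ t : EuclideanSpace ℝ (Fin 3))) (Set.Icc 0 1) :=
    contMDiffOn_iff_contDiffOn.1 (contMDiffOn_sphere_iff.1 hγ)
  -- The cone over the path is a C¹ image of a two-dimensional strip in three-space, so its
  -- complement is dense. A point p off the cone is nonzero, and its direction is missed by the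
  -- path.
  have h2 : ContDiffOn ℝ 1 (fun p : ℝ × ℝ => p.1 • (γ p.2 : EuclideanSpace ℝ (Fin 3)))
      (Set.univ ×ˢ Set.Icc 0 1) :=
    contDiff_fst.contDiffOn.smul
      ((h1.of_le (by simp)).comp contDiff_snd.contDiffOn fun p hp => hp.2)
  have h3 := h2.dense_compl_image_of_dimH_lt_finrank (convex_univ.prod (convex_Icc 0 1))
    subset_rfl ((dimH_mono (Set.subset_univ _)).trans_lt (by
      rw [Real.dimH_univ_eq_finrank, Module.finrank_prod, Module.finrank_self,
        finrank_euclideanSpace_fin]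
      norm_num))
  obtain ⟨p, hp⟩ := h3.nonempty
  have hp0 : p ≠ 0 := by
    rintro rfl
    exact hp ⟨(0, 0), ⟨Set.mem_univ _, zero_mem_unitInterval⟩, zero_smul _ _⟩
  obtain ⟨x₀, hx₀⟩ := hopf_surjective (-sphereProj p)
  refine ⟨x₀, fun t ht h => hp ⟨(‖p‖, t), ⟨Set.mem_univ _, ht⟩, ?_⟩⟩
  rw [hx₀, neg_neg] at h
  simp only [h, coe_sphereProj hp0, smul_smul, mul_inv_cancel₀ (norm_ne_zero_iff.2 hp0), one_smul]

/-- Since the path misses a point, a single local section lifts all of it. Straightening makes that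
lift horizontal, and a rotation moves its start to x. -/
theorem exists_isHorizontalLift {γ : ℝ → S2} (hγ : IsSmoothPath γ) {x : S3}
    (hx : x ∈ hopfFiber (γ 0)) : ∃ c, IsHorizontalLift γ c ∧ c 0 = x := by
  obtain ⟨x₀, h⟩ := exists_forall_ne_neg_hopf hγ
  have hτ : ContMDiffOn 𝓘(ℝ, ℝ) (𝓡 3) ∞ (fun t => localSection x₀ (γ t)) (Set.Icc 0 1) :=
    fun t ht => (contMDiffAt_localSection_coe (h t ht)).comp_contMDiffWithinAt t (hγ t ht)
  have hl := isHorizontalLift_straighten hτ fun t ht => hopf_localSection (h t ht)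
  obtain ⟨z, hz⟩ := exists_rot_eq ((hl.2.1 0 zero_mem_unitInterval).trans (Eq.symm hx))
  exact ⟨_, hl.rot z, hz⟩

theorem transport_rot {γ : ℝ → S2} (hγ : IsSmoothPath γ) {x : S3} (hx : x ∈ hopfFiber (γ 0))
    (z : Circle) : transport γ (rot z x) = rot z (transport γ x) := by
  obtain ⟨c, hc, rfl⟩ := exists_isHorizontalLift hγ hx
  rw [hc.transport_eq]
  exact (hc.rot z).transport_eq

theorem transport_mem {γ : ℝ → S2} (hγ : IsSmoothPath γ) {x : S3} (hx : x ∈ hopfFiber (γ 0)) :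
    transport γ x ∈ hopfFiber (γ 1) := by
  obtain ⟨c, hc, rfl⟩ := exists_isHorizontalLift hγ hx
  rw [hc.transport_eq]
  exact hc.2.1 1 one_mem_unitInterval

/-- An equivariant map between free transitive circle orbits is bijective. -/
theorem bijOn_transport {γ : ℝ → S2} (hγ : IsSmoothPath γ) :
    Set.BijOn (transport γ) (hopfFiber (γ 0)) (hopfFiber (γ 1)) := by
  refine ⟨fun x hx => transport_mem hγ hx, fun x hx x' hx' h => ?_, fun y hy => ?_⟩
  · obtain ⟨z, rfl⟩ := exists_rot_eq (Eq.trans hx (Eq.symm hx'))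
    rw [transport_rot hγ hx] at h
    have hz : (1 : Circle) = z := rot_injective_left ((rot_one _).trans h)
    rw [← hz, rot_one]
  · obtain ⟨x, hx⟩ := hopf_surjective (γ 0)
    obtain ⟨z, hz⟩ := exists_rot_eq (Eq.trans (transport_mem hγ hx) (Eq.symm hy))
    exact ⟨rot z x, (hopf_rot z x).trans hx, (transport_rot hγ hx z).trans hz⟩

/-! ### Strict contactomorphisms and horizontal transport -/

theorem IsSmoothPath.comp_diff {γ : ℝ → S2} (hγ : IsSmoothPath γ) (f : DiffS2) :
    IsSmoothPath (f ∘ γ) := f.contMDiff.comp_contMDiffOn hγ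

theorem hasDerivWithinAt_comp_curve {F : S3 → S3} {c : ℝ → S3} {s : Set ℝ} {t : ℝ} {c' : ℍ[ℝ]}
    (hF : ContMDiffAt (𝓡 3) (𝓡 3) ∞ F (c t))
    (hc : HasDerivWithinAt (fun t => (c t : ℍ[ℝ])) c' s t) :
    HasDerivWithinAt (fun t => (F (c t) : ℍ[ℝ])) (dAmb3 F (c t) c') s t := by
  have h := (hasFDerivWithinAt_dAmb3_comp hF hc.hasFDerivWithinAt).hasDerivWithinAt
  simpa using h

theorem IsHorizontalLift.comp_contact {F : DiffS3} (hF : F ∈ strictContact) {f : DiffS2}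
    (hf : ∀ x, f (hopf x) = hopf (F x)) {γ : ℝ → S2} {c : ℝ → S3} (hc : IsHorizontalLift γ c) :
    IsHorizontalLift (f ∘ γ) (F ∘ c) := by
  refine ⟨F.contMDiff.comp_contMDiffOn hc.1, fun t ht => ?_, fun t ht => ?_⟩
  · rw [Function.comp_apply, Function.comp_apply, ← hf, hc.2.1 t ht]
  · have h := hasDerivWithinAt_comp_curve (F := F) (F.contMDiff _) (hasDerivWithinAt_coe_S3 hc.1 ht)
    simp only [Function.comp_apply]
    rw [h.derivWithin (uniqueDiffOn_unitInterval t ht)]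
    exact (mem_strictContact_iff.1 hF _ _).trans (hc.2.2 t ht)

theorem map_transport {F : DiffS3} (hF : F ∈ strictContact) {f : DiffS2}
    (hf : ∀ x, f (hopf x) = hopf (F x)) {γ : ℝ → S2} (hγ : IsSmoothPath γ) {x : S3}
    (hx : x ∈ hopfFiber (γ 0)) : F (transport γ x) = transport (f ∘ γ) (F x) := by
  obtain ⟨c, hc, rfl⟩ := exists_isHorizontalLift hγ hx
  rw [hc.transport_eq]
  exact (hc.comp_contact hF hf).transport_eq.symm

/-- Initial segments, rescaled to unit time, make every point of a horizontal lift the endpoint of a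
transport. The degenerate case r = 0 is included. -/
theorem IsHorizontalLift.reparam {γ : ℝ → S2} {c : ℝ → S3} (hc : IsHorizontalLift γ c) {r : ℝ}
    (hr : r ∈ Set.Icc (0 : ℝ) 1) : IsHorizontalLift (fun t => γ (r * t)) (fun t => c (r * t)) := by
  have hmaps : Set.MapsTo (fun t => r * t) (Set.Icc (0 : ℝ) 1) (Set.Icc 0 1) := fun t ht =>
    ⟨mul_nonneg hr.1 ht.1, mul_le_one₀ hr.2 ht.1 ht.2⟩
  refine ⟨?_, fun t ht => hc.2.1 _ (hmaps ht), fun t ht => ?_⟩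
  · exact hc.1.comp (contDiff_const.mul contDiff_id).contMDiff.contMDiffOn hmaps
  · have h1 : HasDerivWithinAt (fun t => r * t) r (Set.Icc 0 1) t := by
      simpa using ((hasDerivAt_id t).const_mul r).hasDerivWithinAt
    have h2 := (hasDerivWithinAt_coe_S3 hc.1 (hmaps ht)).scomp t h1 hmaps
    have h3 := h2.derivWithin (uniqueDiffOn_unitInterval t ht)
    simp only [Function.comp_def] at h3
    rw [h3, real_inner_smul_right, hc.2.2 _ (hmaps ht), mul_zero]

/-! ### Great circles, and the contact condition recovered from transport -/

/-- The great circle through `x` with initial velocity `v`. -/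
def greatCircle (x v : S3) (h : ⟪(x : ℍ[ℝ]), v⟫ = 0) (t : ℝ) : S3 :=
  ⟨Real.cos t • (x : ℍ[ℝ]) + Real.sin t • (v : ℍ[ℝ]), by
    rw [mem_sphere_zero_iff_norm, ← sq_eq_sq₀ (norm_nonneg _) zero_le_one, norm_add_sq_real,
      real_inner_smul_left, real_inner_smul_right, h, norm_smul, norm_smul, norm_coe_S3,
      norm_coe_S3, Real.norm_eq_abs, Real.norm_eq_abs]
    simp⟩

theorem greatCircle_zero (x v : S3) (h : ⟪(x : ℍ[ℝ]), v⟫ = 0) : greatCircle x v h 0 = x :=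
  Subtype.ext (by simp [greatCircle])

theorem hasDerivAt_greatCircle (x v : S3) (h : ⟪(x : ℍ[ℝ]), v⟫ = 0) (t : ℝ) :
    HasDerivAt (fun t => (greatCircle x v h t : ℍ[ℝ]))
      (-Real.sin t • (x : ℍ[ℝ]) + Real.cos t • (v : ℍ[ℝ])) t :=
  ((Real.hasDerivAt_cos t).smul_const _).add ((Real.hasDerivAt_sin t).smul_const _)

theorem contMDiff_greatCircle (x v : S3) (h : ⟪(x : ℍ[ℝ]), v⟫ = 0) :
    ContMDiff 𝓘(ℝ, ℝ) (𝓡 3) ∞ (greatCircle x v h) :=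
  contMDiff_sphere_iff.2 ((Real.contDiff_cos.smul contDiff_const).add
    (Real.contDiff_sin.smul contDiff_const)).contMDiff

/-- The value of α on the velocity of a great circle is constant in time, since it is cos² + sin²
times the initial value; so a great circle that starts horizontal stays horizontal. -/
theorem isHorizontalLift_greatCircle (x v : S3) (h : ⟪(x : ℍ[ℝ]), v⟫ = 0)
    (hv : ambientContact x v = 0) :
    IsHorizontalLift (fun t => hopf (greatCircle x v h t)) (greatCircle x v h) := by
  refine ⟨(contMDiff_greatCircle x v h).contMDiffOn, fun _ _ => rfl, fun t ht => ?_⟩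
  rw [(hasDerivAt_greatCircle x v h t).hasDerivWithinAt.derivWithin
    (uniqueDiffOn_unitInterval t ht)]
  change ambientContact (Real.cos t • (x : ℍ[ℝ]) + Real.sin t • (v : ℍ[ℝ])) _ = 0
  rw [ambientContact_eq] at hv ⊢
  simp
  linear_combination (Real.cos t ^ 2 + Real.sin t ^ 2) * hv

theorem ambientContact_dAmb3_eq_zero_of_transport {F : DiffS3} {f : DiffS2}
    (hT : ∀ γ : ℝ → S2, IsSmoothPath γ → ∀ x ∈ hopfFiber (γ 0),
      F (transport γ x) = transport (f ∘ γ) (F x))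
    (hf : ∀ x, f (hopf x) = hopf (F x)) {x v : S3} (h : ⟪(x : ℍ[ℝ]), v⟫ = 0)
    (hv : ambientContact x v = 0) : ambientContact (F x) (dAmb3 F x v) = 0 := by
  set c := greatCircle x v h with hc
  set γ : ℝ → S2 := fun t => hopf (c t) with hγ
  have hlift : IsHorizontalLift γ c := isHorizontalLift_greatCircle x v h hv
  have hγs : IsSmoothPath γ := contMDiff_hopf.comp_contMDiffOn hlift.1
  have hc0 : c 0 = x := greatCircle_zero x v h
  obtain ⟨c', hc', hc'0⟩ := exists_isHorizontalLift (hγs.comp_diff f) (x := F x)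
    ((hf x).symm.trans (by simp only [Function.comp_apply, hγ, hc0]))
  -- Equivariance on each initial segment identifies F ∘ c with the horizontal lift c' of f ∘ γ for
  -- all times. Differentiating at 0 then gives the claim.
  have key : ∀ r ∈ Set.Icc (0 : ℝ) 1, (F (c r) : ℍ[ℝ]) = c' r := by
    intro r hr
    have h1 := (hlift.reparam hr).transport_eq
    have h2 := (hc'.reparam hr).transport_eq
    simp only [mul_zero, mul_one, hc0, hc'0] at h1 h2
    have h3 := hT (fun t => γ (r * t))
      (contMDiff_hopf.comp_contMDiffOn (hlift.reparam hr).1) x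
      (by simp only [hopfFiber, Set.mem_ofPred_eq, hγ, mul_zero, hc0])
    rw [h1] at h3
    rw [h3]
    exact congrArg Subtype.val h2
  have h1 : HasDerivWithinAt (fun t => (F (c t) : ℍ[ℝ])) (dAmb3 F x v) (Set.Icc 0 1) 0 := by
    have := hasDerivWithinAt_comp_curve (F := F) (s := Set.Icc 0 1) (F.contMDiff (c 0))
      (hasDerivAt_greatCircle x v h 0).hasDerivWithinAt
    simpa [← hc, hc0] using this
  have h2 := (h1.congr (fun t ht => (key t ht).symm) (key 0 zero_mem_unitInterval).symm).derivWithin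
    (uniqueDiffOn_unitInterval 0 zero_mem_unitInterval)
  have h3 := hc'.2.2 0 zero_mem_unitInterval
  rw [h2, hc'0] at h3
  exact h3

theorem mem_strictContact_iff_transport {F : DiffS3} (hF : F ∈ strictHopfAut) {f : DiffS2}
    (hf : ∀ x, f (hopf x) = hopf (F x)) :
    F ∈ strictContact ↔ ∀ γ : ℝ → S2, IsSmoothPath γ → ∀ x ∈ hopfFiber (γ 0),
      F (transport γ x) = transport (f ∘ γ) (F x) := by
  refine ⟨fun h γ hγ x hx => map_transport h hf hγ hx, fun hT => ?_⟩
  rw [mem_strictContact_iff]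
  intro x
  refine isContactAt_of_tangent (F.contMDiff x) fun w hw => ?_
  rw [mem_strictHopfAut_iff] at hF
  set a := ambientContact x w with ha
  -- Split w into a horizontal part and a multiple of the Reeb vector. F preserves the Reeb vector
  -- by hypothesis; transport handles the horizontal part.
  set w' := w - a • ((x : ℍ[ℝ]) * quatI) with hw'
  have h1 : ⟪(x : ℍ[ℝ]), w'⟫ = 0 := by
    rw [hw', inner_sub_right, real_inner_smul_right, inner_mul_quatI, hw, mul_zero, sub_zero]
  have h2 : ambientContact x w' = 0 := by
    have h3 : w = w' + a • ((x : ℍ[ℝ]) * quatI) := by rw [hw', sub_add_cancel]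
    rw [h3, ambientContact_add, ambientContact_smul, ambientContact_reeb (norm_coe_S3 x)] at ha
    linarith
  have h3 : ambientContact (F x) (dAmb3 F x w') = 0 := by
    -- The great circle needs a unit initial velocity, so a nonzero w' is normalized first.
    by_cases h0 : w' = 0
    · rw [h0, map_zero]
      exact inner_zero_right _
    have hn : ‖w'‖ ≠ 0 := norm_ne_zero_iff.2 h0
    have h4 := ambientContact_dAmb3_eq_zero_of_transport (v := sphereProj w') hT hf (x := x)
      (by rw [coe_sphereProj h0, real_inner_smul_right, h1, mul_zero])
      (by rw [coe_sphereProj h0, ambientContact_smul, h2, mul_zero])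
    rw [coe_sphereProj h0, map_smul, ambientContact_smul] at h4
    exact (mul_eq_zero.1 h4).resolve_left (inv_ne_zero hn)
  have h5 : w = w' + a • ((x : ℍ[ℝ]) * quatI) := by rw [hw', sub_add_cancel]
  rw [h5, map_add, map_smul, hF, ambientContact_add, ambientContact_smul, h3,
    ambientContact_reeb (norm_coe_S3 _), zero_add, mul_one]

/-! ### Local lifts of area-preserving diffeomorphisms -/

/-- The inverse of the stereographic chart of `S2` centred at `y₀`. -/
def stereoParam (y₀ : S2) (u : EuclideanSpace ℝ (Fin 2)) : S2 :=
  (chartAt (EuclideanSpace ℝ (Fin 2)) y₀).symm u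

theorem chartAt_source_S2 (y₀ : S2) :
    (chartAt (EuclideanSpace ℝ (Fin 2)) y₀).source = {-y₀}ᶜ := stereographic'_source (-y₀)

theorem chartAt_target_S2 (y₀ : S2) :
    (chartAt (EuclideanSpace ℝ (Fin 2)) y₀).target = Set.univ := stereographic'_target (-y₀)

theorem stereoParam_ne (y₀ : S2) (u : EuclideanSpace ℝ (Fin 2)) : stereoParam y₀ u ≠ -y₀ := by
  have h := (chartAt (EuclideanSpace ℝ (Fin 2)) y₀).map_target (x := u)
    (by rw [chartAt_target_S2]; exact Set.mem_univ _)
  rw [chartAt_source_S2] at h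
  exact h

theorem stereoParam_chartAt {y₀ y : S2} (h : y ≠ -y₀) :
    stereoParam y₀ (chartAt (EuclideanSpace ℝ (Fin 2)) y₀ y) = y :=
  (chartAt (EuclideanSpace ℝ (Fin 2)) y₀).left_inv (by rw [chartAt_source_S2]; exact h)

theorem chartAt_stereoParam (y₀ : S2) (u : EuclideanSpace ℝ (Fin 2)) :
    chartAt (EuclideanSpace ℝ (Fin 2)) y₀ (stereoParam y₀ u) = u :=
  (chartAt (EuclideanSpace ℝ (Fin 2)) y₀).right_inv
    (by rw [chartAt_target_S2]; exact Set.mem_univ _)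

theorem contMDiff_stereoParam (y₀ : S2) : ContMDiff (𝓡 2) (𝓡 2) ∞ (stereoParam y₀) := by
  have h := contMDiffOn_chart_symm (I := 𝓡 2) (n := ∞) (x := y₀)
  rw [chartAt_target_S2] at h
  exact contMDiffOn_univ.1 h

theorem contMDiffAt_chartAt_S2 {y₀ y : S2} (h : y ≠ -y₀) :
    ContMDiffAt (𝓡 2) (𝓡 2) ∞ (chartAt (EuclideanSpace ℝ (Fin 2)) y₀) y :=
  (contMDiffOn_chart (I := 𝓡 2) (n := ∞) (x := y₀)).contMDiffAt
    ((chartAt (EuclideanSpace ℝ (Fin 2)) y₀).open_source.mem_nhds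
      (by rw [chartAt_source_S2]; exact h))

theorem contDiff_coe_S3_plane {K : EuclideanSpace ℝ (Fin 2) → S3} :
    ContMDiff (𝓡 2) (𝓡 3) ∞ K ↔ ContDiff ℝ ∞ fun u => (K u : ℍ[ℝ]) :=
  contMDiff_sphere_iff.trans contMDiff_iff_contDiff

theorem contMDiff_localSection_stereoParam {x₀ : S3} {y₀ : S2} {g : S2 → S2}
    (hg : ContMDiff (𝓡 2) (𝓡 2) ∞ g) (h : ∀ u, g (stereoParam y₀ u) ≠ -hopf x₀) :
    ContMDiff (𝓡 2) (𝓡 3) ∞ fun u => localSection x₀ (g (stereoParam y₀ u)) := fun u =>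
  ContMDiffAt.comp (g := fun z : S2 => localSection x₀ z) u (contMDiffAt_localSection_coe (h u))
    (hg.comp (contMDiff_stereoParam y₀) u)

/-- Rotating a map to `S3` along the fibers by the angle `h` adds `dh` to the pullback of the
contact form. -/
theorem ambientContact_fderiv_rot_exp {E : Type*} [NormedAddCommGroup E] [NormedSpace ℝ E]
    {K : E → S3} {h : E → ℝ} {u : E} {K' : E →L[ℝ] ℍ[ℝ]} {h' : E →L[ℝ] ℝ}
    (hK : HasFDerivAt (fun u => (K u : ℍ[ℝ])) K' u) (hh : HasFDerivAt h h' u) (v : E) :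
    ambientContact (rot (Circle.exp (h u)) (K u))
        (fderiv ℝ (fun u => (rot (Circle.exp (h u)) (K u) : ℍ[ℝ])) u v) =
      ambientContact (K u) (K' v) + h' v := by
  have h1 : HasFDerivAt (fun u => (rot (Circle.exp (h u)) (K u) : ℍ[ℝ])) _ u :=
    hK.mul' ((hasDerivAt_circleExp (h u)).hasFDerivAt.comp u hh)
  rw [h1.fderiv]
  set z : ℂ := ((Circle.exp (h u) : Circle) : ℂ) with hz
  have hz1 : ‖z‖ = 1 := Circle.norm_coe _
  have h3 : h' v • ((z : ℍ[ℝ]) * quatI) = ((h' v • (z * Complex.I) : ℂ) : ℍ[ℝ]) := by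
    ext <;> simp [re_quatI, imI_quatI, imJ_quatI, imK_quatI]
  have h4 := ambientContact_gauge (K u) (K' v) z (h' v • (z * Complex.I))
  rw [← h3, ambientContact_smul, ambientContact_reeb (by rw [norm_coeComplex, hz1]), hz1,
    norm_coe_S3] at h4
  rw [one_pow, one_mul, one_mul, mul_one] at h4
  rw [← h4, coe_rot, add_comm (K' v * _)]
  rfl

section Primitive

variable {E : Type*} [NormedAddCommGroup E] [NormedSpace ℝ E]

/-- The two exterior derivatives are -½ φ^*ω and -½ φ^*f^*ω. This is where preservation of area
makes the obstruction form closed. -/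
theorem fderiv_pullContact_sub_eq_of_areaPreserving {f : DiffS2} (hf : f ∈ areaPreserving)
    {φ : E → S2} {τ K : E → S3} (hτ : ContDiff ℝ ∞ fun u => (τ u : ℍ[ℝ]))
    (hK : ContDiff ℝ ∞ fun u => (K u : ℍ[ℝ])) (hτh : ∀ u, hopf (τ u) = φ u)
    (hKh : ∀ u, hopf (K u) = f (φ u)) (u a b : E) :
    fderiv ℝ (pullContact fun u => (τ u : ℍ[ℝ])) u a b -
        fderiv ℝ (pullContact fun u => (τ u : ℍ[ℝ])) u b a =
      fderiv ℝ (pullContact fun u => (K u : ℍ[ℝ])) u a b -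
        fderiv ℝ (pullContact fun u => (K u : ℍ[ℝ])) u b a := by
  rw [fderiv_pullContact_sub_eq_det3 hτ.contDiffAt (u := u) Filter.univ_mem
      (fun x _ => norm_coe_S3 (τ x)) a b,
    fderiv_pullContact_sub_eq_det3 hK.contDiffAt (u := u) Filter.univ_mem
      (fun x _ => norm_coe_S3 (K x)) a b]
  have hφ1 : (fun u => hopfVec (τ u)) = fun u => (φ u : EuclideanSpace ℝ (Fin 3)) :=
    funext fun u => congrArg Subtype.val (hτh u)
  have hφ2 : (fun u => hopfVec (K u)) = fun u => (f (φ u) : EuclideanSpace ℝ (Fin 3)) :=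
    funext fun u => congrArg Subtype.val (hKh u)
  have hφ : ContDiff ℝ ∞ fun u => (φ u : EuclideanSpace ℝ (Fin 3)) := by
    rw [← hφ1]
    exact contDiff_hopfVec.comp hτ
  have hφu := (hφ.differentiable (by simp) u).hasFDerivAt.hasFDerivWithinAt (s := Set.univ)
  have hfφ := hasFDerivWithinAt_univ.1 (hasFDerivWithinAt_dAmb2_comp (f := f) (f.contMDiff _) hφu)
  have ht : ∀ a, ⟪(φ u : EuclideanSpace ℝ (Fin 3)),
      fderiv ℝ (fun u => (φ u : EuclideanSpace ℝ (Fin 3))) u a⟫ = 0 :=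
    inner_fderiv_eq_zero hφu uniqueDiffWithinAt_univ (Set.mem_univ _)
      fun x _ => norm_eq_of_mem_sphere _
  rw [hφ1, congrFun hφ1 u, hφ2, congrFun hφ2 u, hfφ.fderiv, ContinuousLinearMap.comp_apply,
    ContinuousLinearMap.comp_apply, mem_areaPreserving_iff.1 hf _ _ _ (ht a) (ht b)]

theorem contDiff_pullContact {K : E → ℍ[ℝ]} (hK : ContDiff ℝ ∞ K) : ContDiff ℝ ∞ (pullContact K) :=
  contDiff_iff_contDiffAt.2 fun _ => contDiffAt_pullContact hK.contDiffAt

/-- The Poincaré lemma on a vector space. -/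
theorem exists_primitive_pullContact_sub {K L : E → ℍ[ℝ]} (hK : ContDiff ℝ ∞ K)
    (hL : ContDiff ℝ ∞ L)
    (h : ∀ u a b, fderiv ℝ (pullContact K) u a b - fderiv ℝ (pullContact K) u b a =
      fderiv ℝ (pullContact L) u a b - fderiv ℝ (pullContact L) u b a) :
    ∃ g : E → ℝ, ContDiff ℝ ∞ g ∧ ∀ u, HasFDerivAt g (pullContact K u - pullContact L u) u := by
  have hK' := contDiff_pullContact hK
  have hL' := contDiff_pullContact hL
  have hd : ContDiff ℝ ∞ fun u => pullContact K u - pullContact L u := hK'.sub hL'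
  have hsymm : ∀ u a b, fderiv ℝ (fun u => pullContact K u - pullContact L u) u a b =
      fderiv ℝ (fun u => pullContact K u - pullContact L u) u b a := by
    intro u a b
    rw [fderiv_fun_sub (hK'.differentiable (by simp) u) (hL'.differentiable (by simp) u)]
    simp only [sub_apply]
    linarith [h u a b]
  obtain ⟨g, hg⟩ := convex_univ.exists_forall_hasFDerivAt_of_fderiv_symmetric isOpen_univ
    (hd.differentiable (by simp)).differentiableOn (fun a _ x y => hsymm a x y)
  refine ⟨g, ?_, fun u => hg u (Set.mem_univ _)⟩
  rw [contDiff_infty_iff_fderiv]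
  refine ⟨fun u => (hg u (Set.mem_univ _)).differentiableAt, ?_⟩
  rwa [funext fun u => (hg u (Set.mem_univ _)).fderiv]

end Primitive

/-- Over the complement of a point, an area-preserving diffeomorphism lifts compatibly with the
pullbacks of the contact form. -/
theorem exists_lift_stereoParam {f : DiffS2} (hf : f ∈ areaPreserving) (y₀ : S2) :
    ∃ τ K : EuclideanSpace ℝ (Fin 2) → S3, ContMDiff (𝓡 2) (𝓡 3) ∞ τ ∧ ContMDiff (𝓡 2) (𝓡 3) ∞ K ∧
      (∀ u, hopf (τ u) = stereoParam y₀ u) ∧ (∀ u, hopf (K u) = f (stereoParam y₀ u)) ∧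
      ∀ u v, ambientContact (K u) (fderiv ℝ (fun u => (K u : ℍ[ℝ])) u v) =
        ambientContact (τ u) (fderiv ℝ (fun u => (τ u : ℍ[ℝ])) u v) := by
  obtain ⟨x₀, hx₀⟩ := hopf_surjective y₀
  -- With this choice -`hopf x₁` is f(-y₀), a value that f never takes on the chart, so one local
  -- section lifts all of it.
  obtain ⟨x₁, hx₁⟩ := hopf_surjective (-f (-y₀))
  have h0 : ∀ u, stereoParam y₀ u ≠ -hopf x₀ := fun u => by rw [hx₀]; exact stereoParam_ne y₀ u
  have h1 : ∀ u, f (stereoParam y₀ u) ≠ -hopf x₁ := fun u => by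
    rw [hx₁, neg_neg]
    exact fun h => stereoParam_ne y₀ u (f.injective h)
  obtain ⟨τ, hτ, hτh⟩ : ∃ τ : EuclideanSpace ℝ (Fin 2) → S3, ContMDiff (𝓡 2) (𝓡 3) ∞ τ ∧
      ∀ u, hopf (τ u) = stereoParam y₀ u :=
    ⟨_, contMDiff_localSection_stereoParam contMDiff_id h0, fun u => hopf_localSection (h0 u)⟩
  obtain ⟨K, hK, hKh⟩ : ∃ K : EuclideanSpace ℝ (Fin 2) → S3, ContMDiff (𝓡 2) (𝓡 3) ∞ K ∧
      ∀ u, hopf (K u) = f (stereoParam y₀ u) :=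
    ⟨_, contMDiff_localSection_stereoParam f.contMDiff h1, fun u => hopf_localSection (h1 u)⟩
  have hτd := contDiff_coe_S3_plane.1 hτ
  have hKd := contDiff_coe_S3_plane.1 hK
  obtain ⟨g, hg, hg'⟩ := exists_primitive_pullContact_sub hτd hKd
    (fderiv_pullContact_sub_eq_of_areaPreserving hf hτd hKd hτh hKh)
  -- Here dg = τ^*α - K^*α, so rotating K by the angle g turns its pullback into τ^*α.
  refine ⟨τ, fun u => rot (Circle.exp (g u)) (K u), hτ, ?_, hτh,
    fun u => (hopf_rot _ _).trans (hKh u), fun u v => ?_⟩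
  · rw [contDiff_coe_S3_plane]
    exact hKd.mul (contDiff_circleExp_quaternion.comp hg)
  · rw [ambientContact_fderiv_rot_exp (hKd.differentiable (by simp) u).hasFDerivAt (hg' u)]
    simp only [sub_apply, pullContact_apply]
    ring

/-! ### Lifting area-preserving diffeomorphisms -/

/-- The map `F` of `S3` is, at `x`, a lift of `f` to a contact map. -/
structure IsContactLiftAt (f : S2 → S2) (F : S3 → S3) (x : S3) : Prop where
  contMDiffAt : ContMDiffAt (𝓡 3) (𝓡 3) ∞ F x
  isContactAt : IsContactAt F x
  hopf_eq : hopf (F x) = f (hopf x)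
  map_rot : ∀ z, F (rot z x) = rot z (F x)

theorem IsContactAt.congr {F G : S3 → S3} {x : S3} (hF : IsContactAt F x) (h : G =ᶠ[nhds x] F) :
    IsContactAt G x := by
  have h1 : (radialExt fun y => (G y : ℍ[ℝ])) =ᶠ[nhds (x : ℍ[ℝ])]
      radialExt fun y => (F y : ℍ[ℝ]) := by
    have hc := (contMDiffAt_sphereProj (n := 3) (ne_zero_of_mem_unit_sphere x)).continuousAt
    rw [ContinuousAt, sphereProj_coe] at hc
    filter_upwards [hc h] with q hq
    exact congrArg Subtype.val hq
  intro w
  rw [dAmb3, h1.fderiv_eq, h.self_of_nhds]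
  exact hF w

theorem IsContactAt.comp {F G : S3 → S3} {x : S3} (hG : IsContactAt G (F x))
    (hF : IsContactAt F x) (hG' : ContMDiffAt (𝓡 3) (𝓡 3) ∞ G (F x))
    (hF' : ContMDiffAt (𝓡 3) (𝓡 3) ∞ F x) : IsContactAt (G ∘ F) x := by
  have h1 := hasFDerivWithinAt_dAmb3_comp (F := G) (k := fun q => F (sphereProj q))
    (u := (x : ℍ[ℝ])) (by rwa [sphereProj_coe]) (hasFDerivAt_dAmb3 hF').hasFDerivWithinAt
    (s := Set.univ)
  rw [hasFDerivWithinAt_univ, sphereProj_coe] at h1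
  have h2 : dAmb3 (G ∘ F) x = (dAmb3 G (F x)).comp (dAmb3 F x) := h1.fderiv
  intro w
  rw [h2]
  exact (hG _).trans (hF w)

theorem isContactAt_rot (z : Circle) (x : S3) : IsContactAt (rot z) x :=
  mem_strictContact_iff.1 (rotDiff_mem z) x

theorem rot_comm (z w : Circle) (x : S3) : rot z (rot w x) = rot w (rot z x) := by
  rw [rot_rot, rot_rot, mul_comm]

theorem IsContactLiftAt.rot {f : S2 → S2} {F : S3 → S3} {x : S3} (h : IsContactLiftAt f F x)
    (z : Circle) : IsContactLiftAt f (fun x => HopfContact.rot z (F x)) x where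
  contMDiffAt := (contMDiff_rot z _).comp x h.contMDiffAt
  isContactAt := (isContactAt_rot z _).comp h.isContactAt (contMDiff_rot z _) h.contMDiffAt
  hopf_eq := (hopf_rot _ _).trans h.hopf_eq
  map_rot w := by rw [h.map_rot, rot_comm]

/-- Agreement is required over an open set of the base, not merely near x, because equivariance
involves the whole fiber. -/
theorem IsContactLiftAt.congr {f : S2 → S2} {F G : S3 → S3} {x : S3} (h : IsContactLiftAt f F x)
    {U : Set S2} (hU : IsOpen U) (hx : hopf x ∈ U) (hG : ∀ x, hopf x ∈ U → G x = F x) :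
    IsContactLiftAt f G x := by
  have h1 : G =ᶠ[nhds x] F := by
    filter_upwards [(hU.preimage contMDiff_hopf.continuous).mem_nhds hx] with y hy using hG y hy
  refine ⟨h.contMDiffAt.congr_of_eventuallyEq h1, h.isContactAt.congr h1, ?_, fun z => ?_⟩
  · rw [hG x hx, h.hopf_eq]
  · rw [hG x hx, hG _ (by rwa [hopf_rot]), h.map_rot]

/-- The map of `S3` which is equivariant for the rotations of the fibers and takes `τ u` to `K u`,
where `u` is the parameter of the fiber. -/
def equivariantExt {E : Type*} (τ K : E → S3) (ψ : S2 → E) (x : S3) : S3 :=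
  ⟨K (ψ (hopf x)) * (star (τ (ψ (hopf x)) : ℍ[ℝ]) * x), by
    rw [mem_sphere_zero_iff_norm, norm_mul, norm_mul, norm_star, norm_coe_S3, norm_coe_S3,
      norm_coe_S3]
    norm_num⟩

theorem equivariantExt_rot {E : Type*} (τ K : E → S3) (ψ : S2 → E) (z : Circle) (x : S3) :
    equivariantExt τ K ψ (rot z x) = rot z (equivariantExt τ K ψ x) := by
  apply Subtype.ext
  simp only [equivariantExt, coe_rot, hopf_rot, mul_assoc]

theorem equivariantExt_apply {E : Type*} {τ K : E → S3} {ψ : S2 → E} {u : E}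
    (h : ψ (hopf (τ u)) = u) : equivariantExt τ K ψ (τ u) = K u := by
  apply Subtype.ext
  simp only [equivariantExt, h]
  rw [star_mul_of_norm_eq_one (norm_coe_S3 _), mul_one]

theorem contMDiffAt_equivariantExt {τ K : EuclideanSpace ℝ (Fin 2) → S3}
    {ψ : S2 → EuclideanSpace ℝ (Fin 2)} (hτ : ContMDiff (𝓡 2) (𝓡 3) ∞ τ)
    (hK : ContMDiff (𝓡 2) (𝓡 3) ∞ K) {x : S3} (hψ : ContMDiffAt (𝓡 2) (𝓡 2) ∞ ψ (hopf x)) :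
    ContMDiffAt (𝓡 3) (𝓡 3) ∞ (equivariantExt τ K ψ) x := by
  rw [contMDiffAt_sphere_iff]
  have h1 : ContMDiffAt (𝓡 3) (𝓡 2) ∞ (fun x => ψ (hopf x)) x :=
    hψ.comp x (contMDiff_hopf x)
  have h2 : ContMDiffAt (𝓡 3) 𝓘(ℝ, ℍ[ℝ]) ∞ (fun x => (K (ψ (hopf x)) : ℍ[ℝ])) x :=
    (contMDiff_sphere_iff.1 hK _).comp x h1
  have h3 : ContMDiffAt (𝓡 3) 𝓘(ℝ, ℍ[ℝ]) ∞ (fun x => (τ (ψ (hopf x)) : ℍ[ℝ])) x :=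
    (contMDiff_sphere_iff.1 hτ _).comp x h1
  have h4 : ContMDiffAt (𝓡 3) 𝓘(ℝ, ℍ[ℝ]) ∞ (fun x : S3 => (x : ℍ[ℝ])) x := contMDiff_coe_sphere x
  have h5 : ContDiff ℝ ∞ (fun p : ℍ[ℝ] × ℍ[ℝ] × ℍ[ℝ] => p.1 * (star p.2.1 * p.2.2)) :=
    contDiff_fst.mul ((contDiff_star_quaternion.comp (contDiff_fst.comp contDiff_snd)).mul
      (contDiff_snd.comp contDiff_snd))
  exact h5.contMDiff.contMDiffAt.comp x (h2.prodMk_space (h3.prodMk_space h4))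

/-- If `X` and `Y` are obtained from lifts `τ` and `K` with the same pullback of the contact form
by the same phase, then they have the same pullback of the contact form. -/
theorem ambientContact_eq_of_phase {V E : Type*} [NormedAddCommGroup V] [NormedSpace ℝ V]
    [NormedAddCommGroup E] [NormedSpace ℝ E] {u : V → E} {u' : V →L[ℝ] E} {p : V}
    {τ K : E → S3} {Dτ DK : E →L[ℝ] ℍ[ℝ]} {X Y : V → S3} {DX DY : V →L[ℝ] ℍ[ℝ]}
    (hu : HasFDerivAt u u' p) (hτ : HasFDerivAt (fun e => (τ e : ℍ[ℝ])) Dτ (u p))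
    (hK : HasFDerivAt (fun e => (K e : ℍ[ℝ])) DK (u p))
    (hX : HasFDerivAt (fun q => (X q : ℍ[ℝ])) DX p)
    (hY : HasFDerivAt (fun q => (Y q : ℍ[ℝ])) DY p)
    (hc : ∀ v, ambientContact (K (u p)) (DK v) = ambientContact (τ (u p)) (Dτ v))
    (hXτ : ∀ᶠ q in nhds p, hopf (τ (u q)) = hopf (X q))
    (hYK : ∀ᶠ q in nhds p, (Y q : ℍ[ℝ]) = K (u q) * (fiberQuot (τ (u q)) (X q) : ℍ[ℝ])) (w : V) :
    ambientContact (Y p) (DY w) = ambientContact (X p) (DX w) := by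
  have hτu := hτ.comp p hu
  have hKu := hK.comp p hu
  obtain ⟨ζ', hζ⟩ : ∃ ζ', HasFDerivAt (fun q => fiberQuot (τ (u q)) (X q)) ζ' p :=
    ⟨_, complexPart.hasFDerivAt.comp p ((starQuat.hasFDerivAt.comp p hτu).mul' hX)⟩
  have hX' : ∀ᶠ q in nhds p, (X q : ℍ[ℝ]) = τ (u q) * (fiberQuot (τ (u q)) (X q) : ℍ[ℝ]) :=
    hXτ.mono fun q hq =>
      (mul_fiberQuot (norm_coe_S3 _) (norm_coe_S3 _) (congrArg Subtype.val hq)).symm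
  have hζq := complexIncl.hasFDerivAt.comp p hζ
  have e1 := (hX.congr_of_eventuallyEq (hX'.mono fun q hq => hq.symm)).unique (hτu.mul' hζq)
  have e2 := (hY.congr_of_eventuallyEq (hYK.mono fun q hq => hq.symm)).unique (hKu.mul' hζq)
  have hw1 : DX w = Dτ (u' w) * (fiberQuot (τ (u p)) (X p) : ℍ[ℝ])
      + (τ (u p) : ℍ[ℝ]) * (ζ' w : ℍ[ℝ]) := by
    rw [e1, add_comm]
    rfl
  have hw2 : DY w = DK (u' w) * (fiberQuot (τ (u p)) (X p) : ℍ[ℝ])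
      + (K (u p) : ℍ[ℝ]) * (ζ' w : ℍ[ℝ]) := by
    rw [e2, add_comm]
    rfl
  have h1 := ambientContact_gauge (K (u p)) (DK (u' w)) (fiberQuot (τ (u p)) (X p)) (ζ' w)
  have h2 := ambientContact_gauge (τ (u p)) (Dτ (u' w)) (fiberQuot (τ (u p)) (X p)) (ζ' w)
  rw [← hYK.self_of_nhds, ← hw2, norm_coe_S3, hc] at h1
  rw [← hX'.self_of_nhds, ← hw1, norm_coe_S3] at h2
  exact h1.trans h2.symm

theorem hasFDerivAt_sphereProj_S3 (x : S3) :
    HasFDerivAt (fun q : ℍ[ℝ] => ((sphereProj q : S3) : ℍ[ℝ]))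
      (fderiv ℝ (radialExt ((↑) : S3 → ℍ[ℝ])) x) (x : ℍ[ℝ]) :=
  ((contDiffAt_radialExt (n := 3) (ne_zero_of_mem_unit_sphere x)
    (contMDiff_coe_sphere (E := ℍ[ℝ]) _)).differentiableAt (by simp)).hasFDerivAt

theorem eventually_hopf_sphereProj_mem {x : S3} {U : Set S2} (hU : IsOpen U) (hx : hopf x ∈ U) :
    ∀ᶠ q in nhds (x : ℍ[ℝ]), hopf (sphereProj q) ∈ U := by
  have hc := (contMDiffAt_sphereProj (n := 3) (ne_zero_of_mem_unit_sphere x)).continuousAt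
  rw [ContinuousAt, sphereProj_coe] at hc
  exact hc ((hU.preimage contMDiff_hopf.continuous).mem_nhds hx)

/-- If x = τ(u) ζ with ζ a phase, then the extension takes x to K(u) ζ. The same ζ contributes the
same angular velocity to both pullbacks. -/
theorem isContactAt_equivariantExt {τ K : EuclideanSpace ℝ (Fin 2) → S3}
    {ψ : S2 → EuclideanSpace ℝ (Fin 2)} {U : Set S2} (hτ : ContMDiff (𝓡 2) (𝓡 3) ∞ τ)
    (hK : ContMDiff (𝓡 2) (𝓡 3) ∞ K) (hψ : ∀ y ∈ U, ContMDiffAt (𝓡 2) (𝓡 2) ∞ ψ y)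
    (hU : IsOpen U) (hτψ : ∀ y ∈ U, hopf (τ (ψ y)) = y)
    (hc : ∀ u v, ambientContact (K u) (fderiv ℝ (fun u => (K u : ℍ[ℝ])) u v) =
        ambientContact (τ u) (fderiv ℝ (fun u => (τ u : ℍ[ℝ])) u v))
    {x : S3} (hx : hopf x ∈ U) : IsContactAt (equivariantExt τ K ψ) x := by
  have hF := contMDiffAt_equivariantExt hτ hK (hψ _ hx)
  have hud : DifferentiableAt ℝ (radialExt fun x : S3 => ψ (hopf x)) (x : ℍ[ℝ]) := by
    have h1 : ContMDiffAt (𝓡 3) 𝓘(ℝ, EuclideanSpace ℝ (Fin 2)) ∞ (fun x => ψ (hopf x)) x :=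
      (hψ _ hx).comp x (contMDiff_hopf x)
    exact (contDiffAt_radialExt (ne_zero_of_mem_unit_sphere x)
      (by rwa [sphereProj_coe])).differentiableAt (by simp)
  have hnear := eventually_hopf_sphereProj_mem hU hx
  refine isContactAt_of_tangent hF fun w hw => ?_
  have key := ambientContact_eq_of_phase hud.hasFDerivAt
    ((contDiff_coe_S3_plane.1 hτ).differentiable (by simp) _).hasFDerivAt
    ((contDiff_coe_S3_plane.1 hK).differentiable (by simp) _).hasFDerivAt
    (hasFDerivAt_sphereProj_S3 x) (hasFDerivAt_dAmb3 hF) (hc _)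
    (hnear.mono fun q hq => hτψ _ hq) (hnear.mono fun q hq => by
      change (K (ψ (hopf (sphereProj q))) : ℍ[ℝ]) * (star (τ (ψ (hopf (sphereProj q))) : ℍ[ℝ])
        * (sphereProj q : S3)) = _
      nth_rewrite 1 [← mul_fiberQuot (norm_coe_S3 _) (norm_coe_S3 _)
        (congrArg Subtype.val (hτψ _ hq))]
      rw [← mul_assoc (star _), star_mul_of_norm_eq_one (norm_coe_S3 _), one_mul]
      rfl) w
  rwa [fderiv_radialExt_coe 3 hw, sphereProj_coe] at key

theorem exists_isContactLiftAt {f : DiffS2} (hf : f ∈ areaPreserving) (y₀ : S2) :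
    ∃ F : S3 → S3, ∀ x, hopf x ≠ -y₀ → IsContactLiftAt f F x := by
  obtain ⟨τ, K, hτ, hK, hτh, hKh, hc⟩ := exists_lift_stereoParam hf y₀
  have hψτ : ∀ u, chartAt (EuclideanSpace ℝ (Fin 2)) y₀ (hopf (τ u)) = u := fun u => by
    rw [hτh, chartAt_stereoParam]
  have hτψ : ∀ y ∈ ({-y₀}ᶜ : Set S2), hopf (τ (chartAt (EuclideanSpace ℝ (Fin 2)) y₀ y)) = y :=
    fun y hy => (hτh _).trans (stereoParam_chartAt hy)
  refine ⟨equivariantExt τ K (chartAt (EuclideanSpace ℝ (Fin 2)) y₀), fun x hx => ⟨?_, ?_, ?_, ?_⟩⟩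
  · exact contMDiffAt_equivariantExt hτ hK (contMDiffAt_chartAt_S2 hx)
  · exact isContactAt_equivariantExt hτ hK (fun y hy => contMDiffAt_chartAt_S2 hy)
      isOpen_compl_singleton hτψ hc hx
  · obtain ⟨z, hz⟩ := exists_rot_eq (hτψ _ hx)
    rw [← hz, equivariantExt_rot, equivariantExt_apply (hψτ _), hopf_rot, hopf_rot, hKh, hτh]
  · exact fun z => equivariantExt_rot _ _ _ z x

/-- Compare the two lifts along a section over the punctured plane, which parametrizes the overlap.
It is connected, so rigidity gives one phase there, and equivariance carries it over whole fibers.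
-/
theorem exists_rot_eq_of_isContactLiftAt {f : S2 → S2} {F₁ F₂ : S3 → S3} {y₀ : S2}
    (h₁ : ∀ x, hopf x ≠ -y₀ → IsContactLiftAt f F₁ x)
    (h₂ : ∀ x, hopf x ≠ y₀ → IsContactLiftAt f F₂ x) :
    ∃ z, ∀ x, hopf x ≠ -y₀ → hopf x ≠ y₀ → rot z (F₁ x) = F₂ x := by
  obtain ⟨x₀, hx₀⟩ := hopf_surjective y₀
  have hs : ∀ u, stereoParam y₀ u ≠ -hopf x₀ := fun u => by rw [hx₀]; exact stereoParam_ne y₀ u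
  obtain ⟨τ, hτ, hτh⟩ : ∃ τ : EuclideanSpace ℝ (Fin 2) → S3, ContMDiff (𝓡 2) (𝓡 3) ∞ τ ∧
      ∀ u, hopf (τ u) = stereoParam y₀ u :=
    ⟨_, contMDiff_localSection_stereoParam contMDiff_id hs, fun u => hopf_localSection (hs u)⟩
  obtain ⟨u₀, hu₀⟩ : ∃ u₀, ∀ u, stereoParam y₀ u = y₀ ↔ u = u₀ := by
    refine ⟨chartAt (EuclideanSpace ℝ (Fin 2)) y₀ y₀, fun u => ⟨fun h => ?_, fun h => ?_⟩⟩
    · have h' := chartAt_stereoParam y₀ u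
      rw [h] at h'
      exact h'.symm
    · rw [h]
      exact stereoParam_chartAt (ne_neg_self_S2 y₀)
  have hne₁ : ∀ u, hopf (τ u) ≠ -y₀ := fun u => by rw [hτh]; exact stereoParam_ne y₀ u
  have hne₂ : ∀ u, u ∈ ({u₀}ᶜ : Set (EuclideanSpace ℝ (Fin 2))) → hopf (τ u) ≠ y₀ := fun u hu h =>
    hu ((hu₀ u).1 (by rw [← hτh, h]))
  have hrank : 1 < Module.rank ℝ (EuclideanSpace ℝ (Fin 2)) := by
    rw [← Module.finrank_eq_rank, finrank_euclideanSpace_fin]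
    norm_num
  obtain ⟨z, hz⟩ := exists_eq_rot_of_isOpen (K₁ := fun u => F₁ (τ u)) (K₂ := fun u => F₂ (τ u))
    (isOpen_compl_singleton (x := u₀))
    (isConnected_compl_singleton_of_one_lt_rank hrank u₀).isPreconnected
    (fun u hu => by rw [(h₁ _ (hne₁ u)).hopf_eq, (h₂ _ (hne₂ u hu)).hopf_eq])
    (fun u hu => by
      have e₁ := h₁ _ (hne₁ u)
      have e₂ := h₂ _ (hne₂ u hu)
      have hd := ((contDiff_coe_S3_plane.1 hτ).differentiable (by simp) u).hasFDerivAt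
      exact ⟨_, _, hasFDerivWithinAt_univ.1 (hasFDerivWithinAt_dAmb3_comp e₁.contMDiffAt
        hd.hasFDerivWithinAt), hasFDerivWithinAt_univ.1 (hasFDerivWithinAt_dAmb3_comp
        e₂.contMDiffAt hd.hasFDerivWithinAt),
        fun v => (e₁.isContactAt _).trans (e₂.isContactAt _).symm⟩)
  refine ⟨z, fun x hx hx' => ?_⟩
  obtain ⟨u, hu⟩ : ∃ u, stereoParam y₀ u = hopf x := ⟨_, stereoParam_chartAt hx⟩
  obtain ⟨w, rfl⟩ := exists_rot_eq ((hτh u).trans hu)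
  have hu' : u ∈ ({u₀}ᶜ : Set (EuclideanSpace ℝ (Fin 2))) := fun h =>
    hx' (by rw [← hu]; exact (hu₀ u).2 h)
  rw [(h₁ _ (hne₁ u)).map_rot, (h₂ _ (hne₂ u hu')).map_rot, rot_comm]
  exact congrArg (rot w) (hz u hu')

theorem exists_contact_lift {f : DiffS2} (hf : f ∈ areaPreserving) :
    ∃ F : S3 → S3, ∀ x, IsContactLiftAt f F x := by
  obtain ⟨y₀⟩ : Nonempty S2 := ⟨hopf 1⟩
  obtain ⟨F₁, h₁⟩ := exists_isContactLiftAt hf y₀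
  obtain ⟨F₂, h₂⟩ := exists_isContactLiftAt hf (-y₀)
  rw [neg_neg] at h₂
  obtain ⟨z, hz⟩ := exists_rot_eq_of_isContactLiftAt h₁ h₂
  classical
  -- Off the fiber over y₀ this map is F₂, and off the fiber over -y₀ it is the rotated F₁; each
  -- point of S² has a neighborhood of one of these kinds.
  refine ⟨fun x => if hopf x = -y₀ then F₂ x else rot z (F₁ x), fun x => ?_⟩
  by_cases hx : hopf x = -y₀
  · have hx' : hopf x ≠ y₀ := by rw [hx]; exact (ne_neg_self_S2 y₀).symm
    refine (h₂ x hx').congr (isOpen_compl_singleton (x := y₀)) hx' fun y hy => ?_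
    split_ifs with h
    · rfl
    · exact hz y h hy
  · refine ((h₁ x hx).rot z).congr (isOpen_compl_singleton (x := -y₀)) hx fun y hy => ?_
    exact if_neg hy

/-! ### Surjectivity, and the lift prescribed on one fiber -/

/-- Lift f and its inverse. The two composites cover the identity, so they are uniform rotations,
and the lift of f is a diffeomorphism. -/
theorem exists_strictContact_lift {f : DiffS2} (hf : f ∈ areaPreserving) :
    ∃ F ∈ strictContact, ∀ x, hopf (F x) = f (hopf x) := by
  obtain ⟨F, hF⟩ := exists_contact_lift hf
  obtain ⟨G, hG⟩ := exists_contact_lift (inv_mem hf)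
  have hGF : ∃ z, ∀ x, rot z (G (F x)) = x :=
    exists_rot_of_hopf_eq (F := G ∘ F) (G := id)
      (fun x => (hG _).contMDiffAt.comp x (hF x).contMDiffAt) contMDiff_id
      (fun x => (hG _).isContactAt.comp (hF x).isContactAt (hG _).contMDiffAt (hF x).contMDiffAt)
      isContactAt_id (fun x => by
        rw [Function.comp_apply, (hG _).hopf_eq, (hF x).hopf_eq]
        exact f.symm_apply_apply _)
  have hFG : ∃ z, ∀ x, rot z x = F (G x) :=
    exists_rot_of_hopf_eq (F := id) (G := F ∘ G) contMDiff_id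
      (fun x => (hF _).contMDiffAt.comp x (hG x).contMDiffAt) isContactAt_id
      (fun x => (hF _).isContactAt.comp (hG x).isContactAt (hF _).contMDiffAt (hG x).contMDiffAt)
      (fun x => by
        rw [Function.comp_apply, (hF _).hopf_eq, (hG x).hopf_eq]
        exact (f.apply_symm_apply _).symm)
  obtain ⟨z, hz⟩ := hGF
  obtain ⟨w, hw⟩ := hFG
  let F' : DiffS3 :=
    { toFun := F
      invFun := fun x => rot z (G x)
      left_inv := hz
      -- The rotation equal to F ∘ G makes F onto, and a left inverse of a surjection is two-sided.
      right_inv := fun x => by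
        obtain ⟨p, rfl⟩ : ∃ p, F p = x :=
          ⟨G (rot w⁻¹ x), by rw [← hw, rot_rot, mul_inv_cancel, rot_one]⟩
        exact congrArg F (hz p)
      contMDiff_toFun := fun x => (hF x).contMDiffAt
      contMDiff_invFun := fun x => (contMDiff_rot z _).comp x (hG x).contMDiffAt }
  exact ⟨F', mem_strictContact_iff.2 fun x => (hF x).isContactAt, fun x => (hF x).hopf_eq⟩

theorem inducedHom_surjective : Function.Surjective inducedHom := by
  rintro ⟨f, hf⟩
  obtain ⟨F, hF, h⟩ := exists_strictContact_lift hf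
  refine ⟨⟨F, hF⟩, Subtype.ext (Diffeomorph.ext fun y => ?_)⟩
  obtain ⟨x, rfl⟩ := hopf_surjective y
  exact (inducedHom_hopf _ x).trans (h x)

theorem isSmoothPath_const (y : S2) : IsSmoothPath fun _ => y := contMDiffOn_const

theorem transport_const (y : S2) {x : S3} (hx : hopf x = y) : transport (fun _ => y) x = x := by
  have h : IsHorizontalLift (fun _ => y) fun _ => x :=
    ⟨contMDiffOn_const, fun _ _ => hx, fun t _ => by simp⟩
  exact h.transport_eq

/-- Rotate any contact lift so that it matches F₀ at one point of the fiber. Equivariance gives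
agreement on the fiber, and compatibility with transport gives the formula along every path. -/
theorem existsUnique_lift {f : DiffS2} (hf : f ∈ areaPreserving) (y₀ : S2) (F₀ : S3 → S3)
    (hmaps : Set.MapsTo F₀ (hopfFiber y₀) (hopfFiber (f y₀)))
    (hrot : ∀ x ∈ hopfFiber y₀, ∀ z : Circle, F₀ (rot z x) = rot z (F₀ x)) :
    ∃! F : DiffS3, F ∈ strictContact ∧ (∀ x, hopf (F x) = f (hopf x)) ∧
      ∀ γ : ℝ → S2, IsSmoothPath γ → γ 0 = y₀ → ∀ x ∈ hopfFiber y₀,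
        F (transport γ x) = transport (f ∘ γ) (F₀ x) := by
  obtain ⟨x₀, hx₀⟩ := hopf_surjective y₀
  obtain ⟨G, hG, hGf⟩ := exists_strictContact_lift hf
  obtain ⟨z, hz⟩ : ∃ z, rot z (G x₀) = F₀ x₀ :=
    exists_rot_eq ((hGf x₀).trans (by rw [hx₀]; exact (hmaps hx₀).symm))
  have hF : rotDiff z * G ∈ strictContact := mul_mem (rotDiff_mem z) hG
  have hFf : ∀ x, hopf ((rotDiff z * G) x) = f (hopf x) := fun x => (hopf_rot z _).trans (hGf x)
  have hfib : ∀ x ∈ hopfFiber y₀, (rotDiff z * G) x = F₀ x := by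
    intro x hx
    obtain ⟨w, rfl⟩ := exists_rot_eq (hx₀.trans (Eq.symm hx))
    rw [hrot x₀ hx₀, map_rot hF, ← hz]
    rfl
  refine ⟨rotDiff z * G, ⟨hF, hFf, fun γ hγ h0 x hx => ?_⟩, fun F' ⟨hF', hF'f, hT⟩ => ?_⟩
  · rw [map_transport hF (fun x => (hFf x).symm) hγ (by rwa [h0]), hfib x hx]
  · obtain ⟨w, hw⟩ := exists_rot_of_hopf_eq (rotDiff z * G).contMDiff F'.contMDiff
      (mem_strictContact_iff.1 hF) (mem_strictContact_iff.1 hF')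
      (fun x => (hFf x).trans (hF'f x).symm)
    -- The constant path forces a competing lift to equal F₀ at x₀, which fixes the one remaining
    -- phase.
    have h1 := hT (fun _ => y₀) (isSmoothPath_const y₀) rfl x₀ hx₀
    rw [transport_const y₀ hx₀] at h1
    have h2 : F' x₀ = F₀ x₀ := h1.trans (transport_const (f y₀) (hmaps hx₀))
    have h3 : w = 1 := rot_injective_left (x := F₀ x₀)
      (by rw [rot_one, ← hfib x₀ hx₀, hw, h2, hfib x₀ hx₀])
    refine Diffeomorph.ext fun x => ?_
    rw [← hw x, h3, rot_one]

/-! ### Holonomy -/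

section Slices

variable {F : Type*} [NormedAddCommGroup F] [NormedSpace ℝ F] {f : ℝ × ℝ → F} {S T : Set ℝ}
  {s t : ℝ}

theorem derivWithin_slice_left (hf : DifferentiableWithinAt ℝ f (S ×ˢ T) (s, t))
    (hS : UniqueDiffWithinAt ℝ S s) (ht : t ∈ T) :
    derivWithin (fun s' => f (s', t)) S s = fderivWithin ℝ f (S ×ˢ T) (s, t) (1, 0) :=
  (hf.hasFDerivWithinAt.comp_hasDerivWithinAt (f := fun s' => (s', t)) s
    ((hasDerivWithinAt_id s S).prodMk (hasDerivWithinAt_const s S t))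
    fun _ hs' => ⟨hs', ht⟩).derivWithin hS

theorem derivWithin_slice_right (hf : DifferentiableWithinAt ℝ f (S ×ˢ T) (s, t))
    (hT : UniqueDiffWithinAt ℝ T t) (hs : s ∈ S) :
    derivWithin (fun t' => f (s, t')) T t = fderivWithin ℝ f (S ×ˢ T) (s, t) (0, 1) :=
  (hf.hasFDerivWithinAt.comp_hasDerivWithinAt (f := fun t' => (s, t')) t
    ((hasDerivWithinAt_const t T s).prodMk (hasDerivWithinAt_id t T))
    fun _ ht' => ⟨hs, ht'⟩).derivWithin hT

end Slices

/-- Green's formula for the pullback of the contact form to a rectangle. -/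
theorem integral_det3_eq {K : ℝ × ℝ → ℍ[ℝ]} {s₁ s₂ : ℝ} (hs : s₁ < s₂)
    (hK : ContDiffOn ℝ ∞ K (Set.Icc s₁ s₂ ×ˢ Set.Icc 0 1))
    (h1 : ∀ p ∈ Set.Icc s₁ s₂ ×ˢ Set.Icc (0 : ℝ) 1, ‖K p‖ = 1)
    (h0 : ∀ s ∈ Set.Icc s₁ s₂, K (s, 0) = K (s₁, 0) ∧ K (s, 1) = K (s₁, 0)) :
    (∫ s in s₁..s₂, ∫ t in (0 : ℝ)..1, -(1 / 2) * det3 (hopfVec (K (s, t)))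
        (fderiv ℝ (fun p => hopfVec (K p)) (s, t) (1, 0))
        (fderiv ℝ (fun p => hopfVec (K p)) (s, t) (0, 1))) =
      (∫ t in (0 : ℝ)..1, ambientContact (K (s₂, t))
        (derivWithin (fun t => K (s₂, t)) (Set.Icc 0 1) t)) -
      ∫ t in (0 : ℝ)..1, ambientContact (K (s₁, t))
        (derivWithin (fun t => K (s₁, t)) (Set.Icc 0 1) t) := by
  have hu : UniqueDiffOn ℝ (Set.Icc s₁ s₂ ×ˢ Set.Icc (0 : ℝ) 1) :=
    (uniqueDiffOn_Icc hs).prod uniqueDiffOn_unitInterval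
  have hle : (∞ : WithTop ℕ∞) + 1 ≤ ∞ := le_rfl
  have hD := hK.fderivWithin hu hle
  have hB : ContDiffOn ℝ ∞ (fun p => (contactBilin (K p)).comp
      (fderivWithin ℝ K (Set.Icc s₁ s₂ ×ˢ Set.Icc 0 1) p)) (Set.Icc s₁ s₂ ×ˢ Set.Icc 0 1) :=
    (contDiff_contactBilin.comp_contDiffOn hK).clm_comp hD
  have hint : ∀ p ∈ Set.Ioo s₁ s₂ ×ˢ Set.Ioo (0 : ℝ) 1,
      Set.Icc s₁ s₂ ×ˢ Set.Icc (0 : ℝ) 1 ∈ nhds p := fun p hp =>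
    prod_mem_nhds (Icc_mem_nhds hp.1.1 hp.1.2) (Icc_mem_nhds hp.2.1 hp.2.2)
  -- B is the pullback of α, formed with the derivative within the rectangle so that it is smooth up
  -- to the boundary. In the interior it agrees with `pullContact K`.
  obtain ⟨B, hBdef⟩ : ∃ B : ℝ × ℝ → ℝ × ℝ →L[ℝ] ℝ, B = fun p => (contactBilin (K p)).comp
      (fderivWithin ℝ K (Set.Icc s₁ s₂ ×ˢ Set.Icc 0 1) p) := ⟨_, rfl⟩
  rw [← hBdef] at hB
  have hBp : ∀ p ∈ Set.Ioo s₁ s₂ ×ˢ Set.Ioo (0 : ℝ) 1, B =ᶠ[nhds p] pullContact K := by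
    intro p hp
    filter_upwards [(isOpen_Ioo.prod isOpen_Ioo).mem_nhds hp] with q hq
    rw [hBdef, pullContact, ← fderivWithin_of_mem_nhds (hint q hq)]
  have hBv : ∀ v : ℝ × ℝ, ContDiffOn ℝ ∞ (fun p => B p v) (Set.Icc s₁ s₂ ×ˢ Set.Icc 0 1) :=
    fun v => hB.clm_apply contDiffOn_const
  have hBf : ∀ v, ∀ p ∈ Set.Ioo s₁ s₂ ×ˢ Set.Ioo (0 : ℝ) 1, HasFDerivAt (fun p => B p v)
      (fderivWithin ℝ (fun p => B p v) (Set.Icc s₁ s₂ ×ˢ Set.Icc 0 1) p) p := by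
    intro v p hp
    exact ((hBv v).differentiableOn (by simp) p
      (mem_of_mem_nhds (hint p hp))).hasFDerivWithinAt.hasFDerivAt (hint p hp)
  have hcont : ∀ v w, ContinuousOn (fun p => fderivWithin ℝ (fun p => B p v)
      (Set.Icc s₁ s₂ ×ˢ Set.Icc 0 1) p w) (Set.Icc s₁ s₂ ×ˢ Set.Icc 0 1) := fun v w =>
    (((hBv v).fderivWithin hu hle).clm_apply contDiffOn_const).continuousOn
  -- The divergence of the field (B_t, -B_s) is ∂_s B_t - ∂_t B_s, the coefficient of the exterior
  -- derivative of B.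
  have hg := MeasureTheory.integral2_divergence_prod_of_hasFDerivAt (fun p => B p (0, 1))
    (fun p => -B p (1, 0)) (fderivWithin ℝ (fun p => B p (0, 1)) (Set.Icc s₁ s₂ ×ˢ Set.Icc 0 1))
    (-fderivWithin ℝ (fun p => B p (1, 0)) (Set.Icc s₁ s₂ ×ˢ Set.Icc 0 1)) s₁ 0 s₂ 1
  rw [Set.uIcc_of_le hs.le, Set.uIcc_of_le zero_le_one, min_eq_left hs.le, max_eq_right hs.le,
    min_eq_left zero_le_one, max_eq_right zero_le_one] at hg
  specialize hg (hBv _).continuousOn (hBv _).neg.continuousOn (hBf _)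
    (fun p hp => (hBf _ p hp).neg)
    (((hcont _ _).add (hcont _ _).neg).integrableOn_compact (isCompact_Icc.prod isCompact_Icc))
  have hBt : ∀ s ∈ Set.Icc s₁ s₂, (∫ t in (0 : ℝ)..1, B (s, t) (0, 1)) =
      ∫ t in (0 : ℝ)..1, ambientContact (K (s, t))
        (derivWithin (fun t => K (s, t)) (Set.Icc 0 1) t) := by
    intro s hs
    refine intervalIntegral.integral_congr fun t ht => ?_
    rw [Set.uIcc_of_le zero_le_one] at ht
    simp only [hBdef]
    rw [derivWithin_slice_right (hK.differentiableOn (by simp) (s, t) ⟨hs, ht⟩)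
      (uniqueDiffOn_unitInterval t ht) hs]
    rfl
  -- On the sides t = 0 and t = 1 the map K is constant, so they contribute nothing.
  have hBs : ∀ t ∈ Set.Icc (0 : ℝ) 1, (∀ s ∈ Set.Icc s₁ s₂, K (s, t) = K (s₁, 0)) →
      (∫ s in s₁..s₂, -B (s, t) (1, 0)) = 0 := by
    intro t ht hKt
    rw [intervalIntegral.integral_congr (g := fun _ => 0), intervalIntegral.integral_zero]
    intro s hs'
    rw [Set.uIcc_of_le hs.le] at hs'
    simp only [hBdef]
    have h := derivWithin_slice_left (hK.differentiableOn (by simp) (s, t) ⟨hs', ht⟩)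
      (uniqueDiffOn_Icc hs s hs') ht
    rw [derivWithin_congr hKt (hKt s hs'), derivWithin_fun_const] at h
    rw [ContinuousLinearMap.comp_apply, ← h]
    simp
  rw [hBs 1 one_mem_unitInterval fun s hs => (h0 s hs).2,
    hBs 0 zero_mem_unitInterval fun s hs => (h0 s hs).1, hBt s₂ (Set.right_mem_Icc.2 hs.le),
    hBt s₁ (Set.left_mem_Icc.2 hs.le), sub_zero, zero_add] at hg
  rw [← hg]
  refine intervalIntegral.integral_congr_Ioo_of_le hs.le fun s hs' =>
    intervalIntegral.integral_congr_Ioo_of_le zero_le_one fun t ht => ?_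
  have hp : (s, t) ∈ Set.Ioo s₁ s₂ ×ˢ Set.Ioo (0 : ℝ) 1 := ⟨hs', ht⟩
  have hKp : ContDiffAt ℝ ∞ K (s, t) := hK.contDiffAt (hint _ hp)
  have hd : ∀ v w, fderivWithin ℝ (fun p => B p v) (Set.Icc s₁ s₂ ×ˢ Set.Icc 0 1) (s, t) w =
      fderiv ℝ (pullContact K) (s, t) w v := by
    intro v w
    have h2 : HasFDerivAt (fun p => pullContact K p v) _ (s, t) :=
      (((contDiffAt_pullContact hKp).differentiableAt (by simp)).hasFDerivAt).clm_apply
        (hasFDerivAt_const v _)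
    have h3 := (hBf v _ hp).unique (h2.congr_of_eventuallyEq ((hBp _ hp).mono fun q hq => by
      simp only [hq]))
    rw [h3]
    simp
  simp only [Pi.neg_apply, neg_apply, hd]
  rw [← sub_eq_add_neg, fderiv_pullContact_sub_eq_det3 hKp (hint _ hp) h1]

/-! ### The area swept out by a contraction -/

/-- The integrand of `sweptArea σ`. -/
def areaDensity (σ : ℝ × ℝ → S2) (s t : ℝ) : ℝ :=
  (1 / 4) * det3 (σ (s, t))
    (derivWithin (fun s' => (σ (s', t) : EuclideanSpace ℝ (Fin 3))) (Set.Icc 0 1) s)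
    (derivWithin (fun t' => (σ (s, t') : EuclideanSpace ℝ (Fin 3))) (Set.Icc 0 1) t)

theorem ContinuousOn.det3 {X : Type*} [TopologicalSpace X] {s : Set X}
    {a b c : X → EuclideanSpace ℝ (Fin 3)} (ha : ContinuousOn a s) (hb : ContinuousOn b s)
    (hc : ContinuousOn c s) : ContinuousOn (fun x => HopfContact.det3 (a x) (b x) (c x)) s := by
  simp only [det3_apply]
  fun_prop

variable {y : S2} {σ : ℝ × ℝ → S2}

theorem IsContraction.contDiffOn_coe (hσ : IsContraction y σ) :
    ContDiffOn ℝ ∞ (fun p => (σ p : EuclideanSpace ℝ (Fin 3)))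
      (Set.Icc 0 1 ×ˢ Set.Icc 0 1) :=
  contMDiffOn_iff_contDiffOn.1 (contMDiffOn_sphere_iff.1 hσ.1)

theorem IsContraction.areaDensity_eq (hσ : IsContraction y σ) {s t : ℝ}
    (hs : s ∈ Set.Icc (0 : ℝ) 1) (ht : t ∈ Set.Icc (0 : ℝ) 1) :
    areaDensity σ s t = (1 / 4) * det3 (σ (s, t))
      (fderivWithin ℝ (fun p => (σ p : EuclideanSpace ℝ (Fin 3)))
        (Set.Icc 0 1 ×ˢ Set.Icc 0 1) (s, t) (1, 0))
      (fderivWithin ℝ (fun p => (σ p : EuclideanSpace ℝ (Fin 3)))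
        (Set.Icc 0 1 ×ˢ Set.Icc 0 1) (s, t) (0, 1)) := by
  have hd := hσ.contDiffOn_coe.differentiableOn (by simp) (s, t) ⟨hs, ht⟩
  rw [areaDensity, derivWithin_slice_left hd (uniqueDiffOn_unitInterval s hs) ht,
    derivWithin_slice_right hd (uniqueDiffOn_unitInterval t ht) hs]

theorem IsContraction.continuousOn_areaDensity (hσ : IsContraction y σ) :
    ContinuousOn (fun p : ℝ × ℝ => areaDensity σ p.1 p.2) (Set.Icc 0 1 ×ˢ Set.Icc 0 1) := by
  have hD := (hσ.contDiffOn_coe.fderivWithin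
    (uniqueDiffOn_unitInterval.prod uniqueDiffOn_unitInterval) (m := ∞) le_rfl)
  exact ((ContinuousOn.det3 hσ.contDiffOn_coe.continuousOn
    (hD.clm_apply contDiffOn_const).continuousOn
    (hD.clm_apply contDiffOn_const).continuousOn).const_mul (1 / 4)).congr
    fun p hp => hσ.areaDensity_eq hp.1 hp.2

theorem IsContraction.intervalIntegrable (hσ : IsContraction y σ) {s₁ s₂ : ℝ}
    (h1 : s₁ ∈ Set.Icc (0 : ℝ) 1) (h2 : s₂ ∈ Set.Icc (0 : ℝ) 1) :
    IntervalIntegrable (fun s => ∫ t in (0 : ℝ)..1, areaDensity σ s t) MeasureTheory.volume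
      s₁ s₂ := by
  -- Clamping both variables to [0, 1] extends the density continuously to the plane without
  -- changing it on the square.
  have hc : Continuous (Function.uncurry fun s t : ℝ =>
      areaDensity σ (Set.projIcc 0 1 zero_le_one s) (Set.projIcc 0 1 zero_le_one t)) :=
    hσ.continuousOn_areaDensity.comp_continuous
      (f := fun p : ℝ × ℝ => ((Set.projIcc (0 : ℝ) 1 zero_le_one p.1 : ℝ),
        (Set.projIcc (0 : ℝ) 1 zero_le_one p.2 : ℝ)))
      (by fun_prop) fun p => ⟨Subtype.coe_prop _, Subtype.coe_prop _⟩
  refine ((intervalIntegral.continuous_parametric_intervalIntegral_of_continuous'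
    (μ := MeasureTheory.volume) hc 0 1).intervalIntegrable s₁ s₂).congr fun s hs => ?_
  have hs' := Set.uIcc_subset_Icc h1 h2 (Set.uIoc_subset_uIcc hs)
  refine intervalIntegral.integral_congr fun t ht => ?_
  rw [Set.uIcc_of_le zero_le_one] at ht
  simp only [Set.projIcc_of_mem _ hs', Set.projIcc_of_mem _ ht]

theorem IsContraction.isSmoothPath (hσ : IsContraction y σ) {s : ℝ}
    (hs : s ∈ Set.Icc (0 : ℝ) 1) : IsSmoothPath fun t => σ (s, t) :=
  hσ.1.comp (contMDiff_iff_contDiff.2 (contDiff_const.prodMk contDiff_id)).contMDiffOn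
    fun _ ht => ⟨hs, ht⟩

/-- On a strip that misses a point, one local section lifts σ. Each transport phase is minus the
integral of the vertical speed, and Green's formula expresses the change of that integral through
the area. -/
theorem IsContraction.transport_eq_of_lt (hσ : IsContraction y σ) {x : S3} (hx : hopf x = y)
    {s₁ s₂ : ℝ} (h1 : 0 ≤ s₁) (hs : s₁ < s₂) (h2 : s₂ ≤ 1) {x₀ : S3}
    (h : ∀ s ∈ Set.Icc s₁ s₂, ∀ t ∈ Set.Icc (0 : ℝ) 1, σ (s, t) ≠ -hopf x₀) :
    transport (fun t => σ (s₂, t)) x =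
      rot (Circle.exp (2 * ∫ s in s₁..s₂, ∫ t in (0 : ℝ)..1, areaDensity σ s t))
        (transport (fun t => σ (s₁, t)) x) := by
  have hsub : Set.Icc s₁ s₂ ⊆ Set.Icc (0 : ℝ) 1 := Set.Icc_subset_Icc h1 h2
  have h1m : s₁ ∈ Set.Icc s₁ s₂ := Set.left_mem_Icc.2 hs.le
  have h2m : s₂ ∈ Set.Icc s₁ s₂ := Set.right_mem_Icc.2 hs.le
  have hτ : ContMDiffOn 𝓘(ℝ, ℝ × ℝ) (𝓡 3) ∞ (fun p => localSection x₀ (σ p))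
      (Set.Icc s₁ s₂ ×ˢ Set.Icc 0 1) := fun p hp =>
    (contMDiffAt_localSection_coe (h p.1 hp.1 p.2 hp.2)).comp_contMDiffWithinAt p
      ((hσ.1 p ⟨hsub hp.1, hp.2⟩).mono (Set.prod_mono hsub le_rfl))
  have hτK : ContDiffOn ℝ ∞ (fun p => (localSection x₀ (σ p) : ℍ[ℝ]))
      (Set.Icc s₁ s₂ ×ˢ Set.Icc 0 1) :=
    contMDiffOn_iff_contDiffOn.1 (contMDiffOn_sphere_iff.1 hτ)
  have hτs : ∀ s ∈ Set.Icc s₁ s₂, ContMDiffOn 𝓘(ℝ, ℝ) (𝓡 3) ∞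
      (fun t => localSection x₀ (σ (s, t))) (Set.Icc 0 1) := fun s hs =>
    hτ.comp (contMDiff_iff_contDiff.2 (contDiff_const.prodMk contDiff_id)).contMDiffOn
      fun _ ht => ⟨hs, ht⟩
  have hend : ∀ s ∈ Set.Icc s₁ s₂, σ (s, 0) = y ∧ σ (s, 1) = y := fun s hs => hσ.2.1 s (hsub hs)
  obtain ⟨w, hw⟩ : ∃ w, rot w (localSection x₀ y) = x := by
    refine exists_rot_eq (Eq.trans ?_ hx.symm)
    rw [← (hend s₁ h1m).1]
    exact hopf_localSection (h s₁ h1m 0 zero_mem_unitInterval)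
  have hT : ∀ s ∈ Set.Icc s₁ s₂, transport (fun t => σ (s, t)) x =
      rot (w * Circle.exp (-∫ t in (0 : ℝ)..1,
        verticalSpeed (fun t => localSection x₀ (σ (s, t))) t)) (localSection x₀ y) := by
    intro s hs
    have h3 := transport_eq_of_lift (hτs s hs) fun t ht => hopf_localSection (h s hs t ht)
    simp only [hend s hs] at h3
    rw [← hw, transport_rot (hσ.isSmoothPath (hsub hs)) ?_ w, h3, rot_rot]
    change _ = σ (s, 0)
    rw [← (hend s hs).1]
    exact hopf_localSection (h s hs 0 zero_mem_unitInterval)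
  rw [hT s₁ h1m, hT s₂ h2m, rot_rot, mul_left_comm, ← Circle.exp_add]
  have hG := integral_det3_eq hs hτK (fun p _ => norm_coe_S3 _) fun s hs => by
    simp only [hend s hs, hend s₁ h1m, and_self]
  -- Green's integrand is -½ of the unit-sphere density, and the area uses ¼ of it, whence the
  -- factor -½. The phase changes by minus Green's integral, that is, by twice the area.
  have hA : (∫ s in s₁..s₂, ∫ t in (0 : ℝ)..1, areaDensity σ s t) = -(1 / 2) *
      ∫ s in s₁..s₂, ∫ t in (0 : ℝ)..1,
        -(1 / 2) * det3 (hopfVec (localSection x₀ (σ (s, t))))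
        (fderiv ℝ (fun p => hopfVec (localSection x₀ (σ p))) (s, t) (1, 0))
        (fderiv ℝ (fun p => hopfVec (localSection x₀ (σ p))) (s, t) (0, 1)) := by
    rw [← intervalIntegral.integral_const_mul]
    refine intervalIntegral.integral_congr_Ioo_of_le hs.le fun s hs' => ?_
    rw [← intervalIntegral.integral_const_mul]
    refine intervalIntegral.integral_congr_Ioo_of_le zero_le_one fun t ht => ?_
    have hev : (fun p => hopfVec (localSection x₀ (σ p))) =ᶠ[nhds (s, t)]
        fun p => (σ p : EuclideanSpace ℝ (Fin 3)) := by
      filter_upwards [(isOpen_Ioo.prod isOpen_Ioo).mem_nhds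
        (show (s, t) ∈ Set.Ioo s₁ s₂ ×ˢ Set.Ioo (0 : ℝ) 1 from ⟨hs', ht⟩)] with p hp
      exact congrArg Subtype.val (hopf_localSection
        (h p.1 (Set.Ioo_subset_Icc_self hp.1) p.2 (Set.Ioo_subset_Icc_self hp.2)))
    have hnh : Set.Icc (0 : ℝ) 1 ×ˢ Set.Icc (0 : ℝ) 1 ∈ nhds (s, t) :=
      prod_mem_nhds (Icc_mem_nhds (h1.trans_lt hs'.1) (hs'.2.trans_le h2))
        (Icc_mem_nhds ht.1 ht.2)
    rw [hσ.areaDensity_eq (hsub (Set.Ioo_subset_Icc_self hs')) (Set.Ioo_subset_Icc_self ht),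
      fderivWithin_of_mem_nhds hnh, hev.fderiv_eq, hev.eq_of_nhds]
    ring
  congr 3
  rw [hA, hG]
  change _ = 2 * (-(1 / 2) * ((∫ t in (0 : ℝ)..1,
    verticalSpeed (fun t => localSection x₀ (σ (s₂, t))) t) - ∫ t in (0 : ℝ)..1,
    verticalSpeed (fun t => localSection x₀ (σ (s₁, t))) t)) + _
  ring

/-- The tube lemma: a point missed by one compact slice is missed by all nearby slices. -/
theorem IsContraction.eventually_forall_ne (hσ : IsContraction y σ) {s₀ : ℝ}
    (hs₀ : s₀ ∈ Set.Icc (0 : ℝ) 1) {z : S2} (h : ∀ t ∈ Set.Icc (0 : ℝ) 1, σ (s₀, t) ≠ z) :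
    ∀ᶠ s in nhdsWithin s₀ (Set.Icc 0 1), ∀ t ∈ Set.Icc (0 : ℝ) 1, σ (s, t) ≠ z := by
  obtain ⟨u, hu, hu'⟩ := continuousOn_iff'.1 hσ.1.continuousOn {z}ᶜ isOpen_compl_singleton
  have hmem : {p : ℝ × ℝ | σ p ≠ z} ∈
      nhdsSetWithin ({s₀} ×ˢ Set.Icc (0 : ℝ) 1) (Set.Icc (0 : ℝ) 1 ×ˢ Set.Icc (0 : ℝ) 1) := by
    have hsub : {s₀} ×ˢ Set.Icc (0 : ℝ) 1 ⊆ u := by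
      rintro ⟨s, t⟩ ⟨rfl, ht⟩
      exact (hu'.subset ⟨h t ht, hs₀, ht⟩).1
    rw [nhdsSetWithin, Filter.mem_inf_principal]
    filter_upwards [hu.mem_nhdsSet.2 hsub] with p hp hpQ
    exact (hu'.superset ⟨hp, hpQ⟩).1
  obtain ⟨v, hv, hvu⟩ := generalized_tube_lemma_left isCompact_singleton isCompact_Icc hmem
  rw [nhdsSetWithin, nhdsSet_singleton] at hv
  filter_upwards [hv] with s hs t ht
  exact hvu (Set.mk_mem_prod hs ht)

/-- The whole of σ may be onto S², but each slice misses a point, so the formula holds for nearby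
parameters. As a relation between s₁ and s₂ it is symmetric and transitive, by additivity of the
integral, so connectedness of [0, 1] extends it to all pairs. -/
theorem IsContraction.transport_eq (hσ : IsContraction y σ) {x : S3} (hx : hopf x = y) {s₁ s₂ : ℝ}
    (h1 : s₁ ∈ Set.Icc (0 : ℝ) 1) (h2 : s₂ ∈ Set.Icc (0 : ℝ) 1) :
    transport (fun t => σ (s₂, t)) x =
      rot (Circle.exp (2 * ∫ s in s₁..s₂, ∫ t in (0 : ℝ)..1, areaDensity σ s t))
        (transport (fun t => σ (s₁, t)) x) := by
  have hsymm : ∀ a b, transport (fun t => σ (b, t)) x =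
      rot (Circle.exp (2 * ∫ s in a..b, ∫ t in (0 : ℝ)..1, areaDensity σ s t))
        (transport (fun t => σ (a, t)) x) → transport (fun t => σ (a, t)) x =
      rot (Circle.exp (2 * ∫ s in b..a, ∫ t in (0 : ℝ)..1, areaDensity σ s t))
        (transport (fun t => σ (b, t)) x) := fun a b h => by
    rw [h, rot_rot, ← Circle.exp_add, intervalIntegral.integral_symm b a, mul_neg,
      add_neg_cancel, Circle.exp_zero, rot_one]
  refine isPreconnected_Icc.induction₂ (fun a b => transport (fun t => σ (b, t)) x =
      rot (Circle.exp (2 * ∫ s in a..b, ∫ t in (0 : ℝ)..1, areaDensity σ s t))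
        (transport (fun t => σ (a, t)) x)) (fun a ha => ?_) (fun a b c ha hb hc hab hbc => ?_)
    (fun a b _ _ => hsymm a b) h1 h2
  · obtain ⟨x₀, hx₀⟩ := exists_forall_ne_neg_hopf (hσ.isSmoothPath ha)
    obtain ⟨ε, hε, hball⟩ := Metric.mem_nhdsWithin_iff.1 (hσ.eventually_forall_ne ha hx₀)
    filter_upwards [inter_mem_nhdsWithin (Set.Icc (0 : ℝ) 1) (Metric.ball_mem_nhds a hε)]
      with b ⟨hb, hba⟩
    have hconv : ∀ s ∈ Set.uIcc a b, ∀ t ∈ Set.Icc (0 : ℝ) 1, σ (s, t) ≠ -hopf x₀ := fun s hs =>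
      hball ⟨(convex_ball a ε).ordConnected.uIcc_subset (Metric.mem_ball_self hε) hba hs,
        Set.uIcc_subset_Icc ha hb hs⟩
    rcases lt_trichotomy a b with hab | rfl | hab
    · rw [Set.uIcc_of_le hab.le] at hconv
      exact hσ.transport_eq_of_lt hx ha.1 hab hb.2 hconv
    · rw [intervalIntegral.integral_same, mul_zero, Circle.exp_zero, rot_one]
    · rw [Set.uIcc_of_ge hab.le] at hconv
      exact hsymm b a (hσ.transport_eq_of_lt hx hb.1 hab ha.2 hconv)
  · rw [hbc, hab, rot_rot, ← Circle.exp_add, ← mul_add, add_comm,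
      intervalIntegral.integral_add_adjacent_intervals (hσ.intervalIntegrable ha hb)
        (hσ.intervalIntegrable hb hc)]

/-- The holonomy angle around a contracted loop is twice the area swept out. -/
theorem transport_contraction (hσ : IsContraction y σ) {x : S3} (hx : x ∈ hopfFiber y) :
    transport (fun t => σ (1, t)) x = rot (Circle.exp (2 * sweptArea σ)) x := by
  -- The slice s = 0 is constant, so its transport is the identity and the comparison with s = 1
  -- gives the total holonomy.
  have h0 : IsHorizontalLift (fun t => σ (0, t)) fun _ => x :=
    ⟨contMDiffOn_const, fun t ht => Eq.trans hx (hσ.2.2 t ht).symm, fun t _ => by simp⟩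
  have h := hσ.transport_eq hx zero_mem_unitInterval one_mem_unitInterval
  rw [h0.transport_eq] at h
  exact h

end

end HopfContact

theorem mainTheorem4 :
    -- the exact sequence
    (∃ P : strictContact →* areaPreserving,
      (∀ (F : strictContact) (x : S3), (P F : DiffS2) (hopf x) = hopf ((F : DiffS3) x)) ∧
      -- `J` and `P` take smooth families to smooth families
      ContMDiff ((𝓡 1).prod (𝓡 3)) (𝓡 3) ∞
        (fun q : Circle × S3 => (fiberRotation q.1 : DiffS3) q.2) ∧
      (∀ (n : ℕ) (c : EuclideanSpace ℝ (Fin n) → strictContact),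
        ContMDiff ((𝓡 n).prod (𝓡 3)) (𝓡 3) ∞
          (fun q : EuclideanSpace ℝ (Fin n) × S3 => (c q.1 : DiffS3) q.2) →
        ContMDiff ((𝓡 n).prod (𝓡 2)) (𝓡 2) ∞
          (fun q : EuclideanSpace ℝ (Fin n) × S2 => (P (c q.1) : DiffS2) q.2)) ∧
      Function.Injective fiberRotation ∧
      fiberRotation.range = P.ker ∧
      Function.Surjective P) ∧
    -- horizontal lifts exist and are unique
    (∀ γ : ℝ → S2, IsSmoothPath γ → ∀ x ∈ hopfFiber (γ 0),
      ∃ c, IsHorizontalLift γ c ∧ c 0 = x ∧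
        ∀ c', IsHorizontalLift γ c' → c' 0 = x → Set.EqOn c' c (Set.Icc 0 1)) ∧
    -- horizontal transport is a rigid motion between Hopf fibers
    (∀ γ : ℝ → S2, IsSmoothPath γ →
      Set.BijOn (transport γ) (hopfFiber (γ 0)) (hopfFiber (γ 1)) ∧
      ∀ x ∈ hopfFiber (γ 0), ∀ z : Circle, transport γ (rot z x) = rot z (transport γ x)) ∧
    -- the holonomy around a loop is twice the enclosed area
    (∀ (y : S2) (σ : ℝ × ℝ → S2), IsContraction y σ → ∀ x ∈ hopfFiber y,
      transport (fun t => σ (1, t)) x = rot (Circle.exp (2 * sweptArea σ)) x) ∧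
    -- strict contactomorphisms are the strict automorphisms that commute with transport
    (∀ F ∈ strictHopfAut, ∀ f ∈ areaPreserving, (∀ x, f (hopf x) = hopf (F x)) →
      (F ∈ strictContact ↔
        ∀ γ : ℝ → S2, IsSmoothPath γ → ∀ x ∈ hopfFiber (γ 0),
          F (transport γ x) = transport (f ∘ γ) (F x))) ∧
    -- the lift of an area-preserving diffeomorphism by horizontal transport
    (∀ f ∈ areaPreserving, ∀ (y₀ : S2) (F₀ : S3 → S3),
      Set.MapsTo F₀ (hopfFiber y₀) (hopfFiber (f y₀)) →
      (∀ x ∈ hopfFiber y₀, ∀ z : Circle, F₀ (rot z x) = rot z (F₀ x)) →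
      ∃! F : DiffS3, F ∈ strictContact ∧ (∀ x, hopf (F x) = f (hopf x)) ∧
        ∀ γ : ℝ → S2, IsSmoothPath γ → γ 0 = y₀ → ∀ x ∈ hopfFiber y₀,
          F (transport γ x) = transport (f ∘ γ) (F₀ x)) := by
  refine ⟨⟨inducedHom, inducedHom_hopf, contMDiff_fiberRotation,
    fun _ _ => contMDiff_inducedHom_family, fiberRotation_injective, fiberRotation_range_eq_ker,
    inducedHom_surjective⟩, fun γ hγ x hx => ?_,
    fun γ hγ => ⟨bijOn_transport hγ, fun x hx z => transport_rot hγ hx z⟩,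
    fun y σ hσ x hx => transport_contraction hσ hx,
    fun F hF f _ hf => mem_strictContact_iff_transport hF hf,
    fun f hf y₀ F₀ hm hr => existsUnique_lift hf y₀ F₀ hm hr⟩
  obtain ⟨c, hc, h0⟩ := exists_isHorizontalLift hγ hx
  exact ⟨c, hc, h0, fun c' hc' h' => hc'.eqOn hc (h'.trans h0.symm)⟩
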